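/- Let $\beta\in\mathbb R$. The $\beta$-plane equation on $\mathbb R^2$ is $$\partial_t\omega+u\cdot\nabla\omega=\beta L_1\omega,\qquad u=\nabla^\perp(-\Delta)^{-1}\omega,\qquad L_1=\frac{R_1}{|\nabla|}=\partial_1(-\Delta)^{-1},$$ for a real-valued $\omega=\omega(t,x)$, where $\nabla^\perp=(-\partial_2,\partial_1)$ and $(-\Delta)^{-1}$ is understood as a Fourier multiplier. For an integer $m\ge 1$ and $T\ge 0$, a solution of class $H^m$ on $[0,T]$ is a function $\omega\in C([0,T];H^m(\mathbb R^2))$ whose velocity field $u(t)$ lies in $L^2(\mathbb R^2)$ and is bounded there uniformly in $t\in[0,T]$, such that $\omega$ is differentiable in time with values in $L^2(\mathbb R^2)$ (one-sidedly at $0$ and $T$), $L_1\omega(t)\in L^2(\mathbb R^2)$, and the equation holds in $L^2(\mathbb R^2)$ for every $t\in[0,T]$. Let $$\|f\|_{H^k}^2=\sum_{|\alpha|\le k}\|\partial^\alpha f\|_{L^2}^2,\qquad \|Du\|_{L^\infty}=\max_{i,j\in\{1,2\}}\|\partial_iu_j\|_{L^\infty}.$$ **Lemma 4.1.** There is a universal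 constant $c_1\ge 0$ such that for every $\beta\in\mathbb R$, every $T\ge 0$, all integers $m\ge1$ and $0\le k\le m$, and every solution $\omega$ of class $H^m$ of the $\beta$-plane equation on $[0,T]$, $$\|\omega(T)\|_{H^k}\le\|\omega(0)\|_{H^k}\,\exp\Big(c_1\,2^{2k}\int_0^T\big(\|Du(t)\|_{L^\infty}+\|\omega(t)\|_{L^\infty}\big)\,dt\Big).$$ In particular $c_1$ does not depend on $k$. (If the integral is infinite, the right-hand side is $\infty$ when $\omega(0)\ne0$ and $0$ when $\omega(0)=0$.) -/

import Mathlib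

open MeasureTheory Set Filter Topology
open scoped ENNReal NNReal SchwartzMap FourierTransform LineDeriv

noncomputable section

namespace BetaPlane

/-- The plane `ℝ²` with its Euclidean norm and Lebesgue measure. -/
abbrev Plane : Type := EuclideanSpace ℝ (Fin 2)

/-- Real-valued square-integrable functions on the plane (up to a.e. equality). -/
abbrev L2 : Type := Lp ℝ 2 (volume : Measure Plane)

/-- A real square-integrable function, regarded as complex-valued. -/
def cplx (f : L2) : Lp ℂ 2 (volume : Measure Plane) :=
  Complex.ofRealCLM.compLp f

/-- A real square-integrable function, regarded as a tempered distribution. -/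
def toDist (f : L2) : 𝓢'(Plane, ℂ) :=
  Lp.toTemperedDistribution (cplx f)

/-- The distributional partial derivative `∂ᵢ`. -/
def pd (i : Fin 2) (F : 𝓢'(Plane, ℂ)) : 𝓢'(Plane, ℂ) :=
  ∂_{(EuclideanSpace.single i 1 : Plane)} F

/-- The `L^p` norm of a tempered distribution, equal to `∞` if it is not (represented by)
an `L^p` function. The representative is unique when it exists. -/
def distLpNorm (p : ℝ≥0∞) [Fact (1 ≤ p)] (F : 𝓢'(Plane, ℂ)) : ℝ≥0∞ :=
  ⨅ (g : Lp ℂ p (volume : Measure Plane)) (_ : F = Lp.toTemperedDistribution g), ‖g‖ₑ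

/-- The norm of the Sobolev space `H^k`, with value `∞` outside `H^k`:
`‖f‖_{H^k}² = ∑_{|α| ≤ k} ‖∂^α f‖_{L²}²`, the sum being over the multi-indices `α = (α₁, α₂)`. -/
def sobolevNorm (k : ℕ) (f : L2) : ℝ≥0∞ :=
  (∑ j ∈ Finset.range (k + 1), ∑ α ∈ Finset.HasAntidiagonal.antidiagonal j,
    distLpNorm 2 ((pd 0)^[α.1] ((pd 1)^[α.2] (toDist f))) ^ 2) ^ (1 / 2 : ℝ)

/-- `g` is obtained from `f` by the Fourier multiplier `m`: the Fourier transform of `g` is `m` times that of `f`. -/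
def HasMultiplier (m : Plane → ℂ) (f g : L2) : Prop :=
  (𝓕 (cplx g) : Lp ℂ 2 (volume : Measure Plane)) =ᵐ[volume]
    fun ξ => m ξ * (𝓕 (cplx f) : Lp ℂ 2 (volume : Measure Plane)) ξ

/-- The Fourier symbol of `∂ⱼ (-Δ)⁻¹`. The Fourier transform is
`f̂(ξ) = ∫ f(x) exp(-2πi x·ξ) dx`, so that `∂ⱼ` has the symbol `2πi ξⱼ` and `-Δ` has the symbol
`(2π|ξ|)²`. -/
def derivInvLaplaceSymbol (j : Fin 2) (ξ : Plane) : ℂ :=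
  (2 * Real.pi * Complex.I * (ξ j : ℝ)) / (((2 * Real.pi * ‖ξ‖) ^ 2 : ℝ) : ℂ)

/-- `u = ∇^⊥ (-Δ)⁻¹ ω` with `∇^⊥ = (-∂₂, ∂₁)`, the velocity field being square-integrable. -/
def IsVelocity (ω : L2) (u : Fin 2 → L2) : Prop :=
  HasMultiplier (fun ξ => -derivInvLaplaceSymbol 1 ξ) ω (u 0) ∧
    HasMultiplier (derivInvLaplaceSymbol 0) ω (u 1)

/-- `h = L₁ ω`, where `L₁ = R₁ / |∇| = ∂₁ (-Δ)⁻¹`. -/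
def IsL1 (ω h : L2) : Prop :=
  HasMultiplier (derivInvLaplaceSymbol 0) ω h

/-- `g = ∇ω` in the sense of distributions. -/
def IsGradient (ω : L2) (g : Fin 2 → L2) : Prop :=
  ∀ i, pd i (toDist ω) = toDist (g i)

/-- `ω`, with velocity field `u`, is a solution of the `β`-plane equation
`∂_t ω + u·∇ω = β L₁ω` on `[0,T]` in the class `C([0,T]; H^m)`. -/
structure IsSolution (β : ℝ) (m : ℕ) (T : ℝ) (ω : ℝ → L2) (u : ℝ → Fin 2 → L2) : Prop where
  /-- `ω(t) ∈ H^m` -/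
  memSobolev : ∀ t ∈ Icc 0 T, sobolevNorm m (ω t) < ∞
  /-- `ω` is continuous in time with values in `H^m` -/
  continuous : ∀ t ∈ Icc 0 T,
    Tendsto (fun s => sobolevNorm m (ω s - ω t)) (𝓝[Icc 0 T] t) (𝓝 0)
  /-- `u = ∇^⊥ (-Δ)⁻¹ ω` -/
  velocity : ∀ t ∈ Icc 0 T, IsVelocity (ω t) (u t)
  /-- the kinetic energy is bounded on `[0,T]` -/
  velocity_bounded : ∃ M : ℝ, ∀ t ∈ Icc 0 T, ∀ i, ‖u t i‖ ≤ M
  /-- the equation holds in `L²` at all times (with one-sided time derivatives at `0` and `T`) -/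
  equation : ∀ t ∈ Icc 0 T, ∃ (ω' h : L2) (g : Fin 2 → L2),
    HasDerivWithinAt ω ω' (Icc 0 T) t ∧ IsL1 (ω t) h ∧ IsGradient (ω t) g ∧
      ∀ᵐ x, ω' x + (u t 0 x * g 0 x + u t 1 x * g 1 x) = β * h x

/-- `‖Du‖_{L^∞}`, the largest of the `L^∞` norms of the entries `∂ᵢ uⱼ` of the Jacobian matrix. -/
def jacobianSupNorm (u : Fin 2 → L2) : ℝ≥0∞ :=
  ⨆ (i : Fin 2) (j : Fin 2), distLpNorm ∞ (pd i (toDist (u j)))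

end BetaPlane

end

/-! The proof is an `L²` energy estimate for every derivative of order at most `k`. The term `β L₁ω`
contributes nothing because its symbol is purely imaginary, and transport by a divergence-free field
is antisymmetric. Only the commutator of the derivative with multiplication by `u` remains, and the
point is to bound it with a constant growing no faster than `4^k`.

Since the equation holds only in `L²`, derivatives are replaced by iterated difference quotients.
These are bounded on `L²`, commute with Fourier multipliers, and converge to the derivatives as the
step tends to `0`. In the discrete Leibniz rule the undifferentiated factor gets shifted. A shifted
velocity is still real, bounded and divergence-free, so the antisymmetry survives
(`re_inner_transport`). The commutator of order `j` consists of at most `2^j` products per velocity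
component. In each, at least one difference quotient falls on `u`, and the orders on `u` and on `∇ω`
add up to `j` (`eLpNorm_commutator_le`).

Each product is estimated by bilinear interpolation (`eLpNorm_mul_le`): its `L²` norm is at most `16
(25/16)^j C₀ A` times the homogeneous seminorm `X j`, where `A` bounds `Du` and `ω` in `L^∞`. The
argument is pointwise. At every scale `(5/4)^m` a function is a low-frequency part, bounded in `L^∞`
by Bernstein's inequality, plus a remainder controlled by one square function in `L²`; the scale is
then chosen at each point. Constants do not pile up with the order, because Bernstein's inequality
holds here with constant one (`Bdd.of_bandLim`) and the low-pass filter is applied only once.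

Summing over the `j + 1` multi-indices and using `(j + 1) (25/8)^j ≤ 4 * 4^j` gives `128 C₀ 4^k A`
times the energy (`sum_abs_re_inner_le`). In time, the inequality for difference quotients is
integrated, the step is sent to `0`, and Grönwall's inequality with an integrable coefficient is
applied. If the time integral is infinite, only zero initial data need an argument, and there
conservation of the `L²` norm suffices. -/

noncomputable section

namespace BetaPlane

/-! ### Fourier transform on `L²`: duality, translations, inversion. -/

/-- Complex-valued square-integrable functions on the plane. -/
abbrev H : Type := Lp ℂ 2 (volume : Measure Plane)

/-- The Fourier transform on `L²`. -/
abbrev ft (f : H) : H := 𝓕 f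

lemma ft_injective : Function.Injective ft :=
  (Lp.fourierTransformₗᵢ Plane ℂ).injective

lemma ft_sub (f g : H) : ft (f - g) = ft f - ft g :=
  (Lp.fourierTransformₗᵢ Plane ℂ).map_sub f g

lemma ft_add (f g : H) : ft (f + g) = ft f + ft g :=
  (Lp.fourierTransformₗᵢ Plane ℂ).map_add f g

lemma ft_smul (c : ℂ) (f : H) : ft (c • f) = c • ft f :=
  (Lp.fourierTransformₗᵢ Plane ℂ).map_smul c f

lemma ft_sum {ι : Type*} (s : Finset ι) (f : ι → H) :
    ft (∑ i ∈ s, f i) = ∑ i ∈ s, ft (f i) :=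
  map_sum (Lp.fourierTransformₗᵢ Plane ℂ).toLinearEquiv f s

lemma norm_ft (f : H) : ‖ft f‖ = ‖f‖ := Lp.norm_fourier_eq f

/-- Duality with Schwartz functions is the working description of the Fourier transform on `L²`,
where no integral formula is available; translation and inversion are both derived from it. -/
lemma integral_ft_mul_schwartz (f : H) (φ : 𝓢(Plane, ℂ)) :
    ∫ ξ, φ ξ * ft f ξ = ∫ x, (𝓕 φ) x * f x := by
  have h := congrArg (fun D : 𝓢'(Plane, ℂ) => D φ) (Lp.fourier_toTemperedDistribution_eq f)
  simp only [TemperedDistribution.fourier_apply, Lp.toTemperedDistribution_apply,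
    smul_eq_mul] at h
  exact h.symm

lemma locallyIntegrable_coe (f : H) : LocallyIntegrable f volume :=
  (Lp.memLp f).locallyIntegrable (by norm_num)

/-- Two locally integrable functions with the same integrals against compactly supported smooth
functions agree almost everywhere. -/
lemma ae_eq_of_schwartz {f g : Plane → ℂ} (hf : LocallyIntegrable f volume)
    (hg : LocallyIntegrable g volume)
    (h : ∀ φ : 𝓢(Plane, ℂ), HasCompactSupport φ → ∫ x, φ x * f x = ∫ x, φ x * g x) :
    f =ᵐ[volume] g := by
  refine ae_eq_of_integral_contDiff_smul_eq hf hg fun φ hφ hc => ?_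
  have h1 : HasCompactSupport (Complex.ofRealCLM ∘ φ) := hc.comp_left rfl
  have h2 : ContDiff ℝ (⊤ : ℕ∞) (Complex.ofRealCLM ∘ φ) := by fun_prop
  have := h (h1.toSchwartzMap h2) h1
  simpa using this

/-- The character `ξ ↦ exp (2πi ⟨a, ξ⟩)`. -/
def chr (a ξ : Plane) : ℂ := Complex.exp (2 * Real.pi * Complex.I * (inner ℝ a ξ : ℝ))

lemma norm_chr (a ξ : Plane) : ‖chr a ξ‖ = 1 := by
  have : (2 * Real.pi * Complex.I * (inner ℝ a ξ : ℝ) : ℂ)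
      = ((2 * Real.pi * (inner ℝ a ξ : ℝ) : ℝ) : ℂ) * Complex.I := by push_cast; ring
  rw [chr, this, Complex.norm_exp_ofReal_mul_I]

lemma contDiff_chr (a : Plane) : ContDiff ℝ (⊤ : ℕ∞) (chr a) := by
  unfold chr
  refine ContDiff.cexp (contDiff_const.mul ?_)
  exact Complex.ofRealCLM.contDiff.comp (contDiff_const.inner ℝ contDiff_id)

lemma continuous_chr (a : Plane) : Continuous (chr a) := (contDiff_chr a).continuous

/-- Modulation of a compactly supported Schwartz function translates its Fourier transform. -/
lemma exists_modulation (φ : 𝓢(Plane, ℂ)) (hφ : HasCompactSupport φ) (a : Plane) :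
    ∃ ψ : 𝓢(Plane, ℂ), (∀ ξ, ψ ξ = chr a ξ * φ ξ) ∧ ∀ x, (𝓕 ψ) x = (𝓕 φ) (x - a) := by
  have h1 : HasCompactSupport (fun ξ => chr a ξ * φ ξ) := hφ.mul_left
  have h2 : ContDiff ℝ (⊤ : ℕ∞) (fun ξ => chr a ξ * φ ξ) := (contDiff_chr a).mul (φ.smooth ⊤)
  refine ⟨h1.toSchwartzMap h2, fun ξ => rfl, fun x => ?_⟩
  rw [SchwartzMap.fourier_coe, SchwartzMap.fourier_coe, Real.fourier_eq', Real.fourier_eq']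
  refine integral_congr_ae (Eventually.of_forall fun ξ => ?_)
  change Complex.exp _ • (chr a ξ * φ ξ) = Complex.exp _ • φ ξ
  simp only [smul_eq_mul, chr]
  rw [← mul_assoc, ← Complex.exp_add, inner_sub_right, real_inner_comm ξ a]
  congr 2
  push_cast
  ring

/-- Translation `f ↦ f (· + a)` on `L²`. -/
def tr (a : Plane) : H →ₗᵢ[ℂ] H :=
  Lp.compMeasurePreservingₗᵢ ℂ (fun x => x + a) (measurePreserving_add_right volume a)

lemma coeFn_tr (a : Plane) (f : H) : tr a f =ᵐ[volume] fun x => f (x + a) :=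
  Lp.coeFn_compMeasurePreserving f (measurePreserving_add_right volume a)

lemma memLp_bdd_mul {m : Plane → ℂ} {C : ℝ} (hm : AEStronglyMeasurable m volume)
    (hC : ∀ ξ, ‖m ξ‖ ≤ C) (f : H) : MemLp (fun ξ => m ξ * f ξ) 2 volume :=
  MemLp.of_le_mul (Lp.memLp f) (hm.mul (Lp.aestronglyMeasurable f))
    (Eventually.of_forall fun ξ => by
      rw [norm_mul]; exact mul_le_mul_of_nonneg_right (hC ξ) (norm_nonneg _))

/-- By duality the character moves onto the test function, whose Fourier transform it translates; a
change of variables moves the translation onto `f`. -/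
lemma ft_tr (a : Plane) (f : H) : ft (tr a f) =ᵐ[volume] fun ξ => chr a ξ * ft f ξ := by
  refine ae_eq_of_schwartz (locallyIntegrable_coe _)
    ((memLp_bdd_mul (C := 1) (continuous_chr a).aestronglyMeasurable
      (fun ξ => (norm_chr a ξ).le) (ft f)).locallyIntegrable (by norm_num)) fun φ hφ => ?_
  obtain ⟨ψ, hψ, hψ'⟩ := exists_modulation φ hφ a
  have e1 : ∫ ξ, φ ξ * (chr a ξ * ft f ξ) = ∫ ξ, ψ ξ * ft f ξ :=
    integral_congr_ae (Eventually.of_forall fun ξ => by simp only [hψ]; ring)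
  rw [e1, integral_ft_mul_schwartz, integral_ft_mul_schwartz]
  have e2 : ∫ x, (𝓕 φ) x * (tr a f) x = ∫ x, (𝓕 φ) x * f (x + a) :=
    integral_congr_ae (by filter_upwards [coeFn_tr a f] with x hx; rw [hx])
  have e3 := integral_add_right_eq_self (μ := volume) (fun x => (𝓕 ψ) x * f x) a
  rw [e2, ← e3]
  simp [hψ']

/-- A square-integrable function with integrable Fourier transform is given by the inversion
formula. -/
lemma ae_eq_inversion (f : H) (hf : Integrable (ft f) volume) :
    f =ᵐ[volume] fun x => ∫ ξ, chr x ξ * ft f ξ := by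
  have hbd : ∀ x, ‖∫ ξ, chr x ξ * ft f ξ‖ ≤ ∫ ξ, ‖ft f ξ‖ := fun x => by
    refine (norm_integral_le_integral_norm _).trans (le_of_eq ?_)
    simp [norm_chr]
  have hcont2 : Continuous fun p : Plane × Plane => chr p.1 p.2 := by unfold chr; fun_prop
  have hcont : Continuous fun x => ∫ ξ, chr x ξ * ft f ξ := by
    refine continuous_of_dominated (bound := fun ξ => ‖ft f ξ‖) (fun x => ?_) (fun x => ?_)
      hf.norm ?_
    · exact (continuous_chr x).aestronglyMeasurable.mul hf.aestronglyMeasurable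
    · exact Eventually.of_forall fun ξ => by simp [norm_chr]
    · refine Eventually.of_forall fun ξ => Continuous.mul ?_ continuous_const
      exact hcont2.comp (by fun_prop : Continuous fun x : Plane => (x, ξ))
  refine ae_eq_of_schwartz (locallyIntegrable_coe f) hcont.locallyIntegrable fun φ _ => ?_
  have e0 : 𝓕 (𝓕⁻ φ) = φ := FourierTransform.fourier_fourierInv_eq φ
  have e1 := integral_ft_mul_schwartz f (𝓕⁻ φ)
  rw [e0] at e1
  rw [← e1]
  have e2 : ∀ ξ, (𝓕⁻ φ) ξ = ∫ x, chr x ξ * φ x := fun ξ => by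
    rw [SchwartzMap.fourierInv_coe, Real.fourierInv_eq']
    refine integral_congr_ae (Eventually.of_forall fun x => ?_)
    simp only [chr, smul_eq_mul]
    congr 2
    push_cast
    ring
  calc ∫ ξ, (𝓕⁻ φ) ξ * ft f ξ = ∫ ξ, ∫ x, chr x ξ * φ x * ft f ξ := by
        refine integral_congr_ae (Eventually.of_forall fun ξ => ?_)
        simp only [e2, integral_mul_const]
    _ = ∫ x, ∫ ξ, chr x ξ * φ x * ft f ξ := by
        refine integral_integral_swap ?_
        have hi : Integrable (fun p : Plane × Plane => ft f p.1 * φ p.2)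
            (volume.prod volume) := hf.mul_prod φ.integrable
        refine (hi.bdd_mul (f := fun p : Plane × Plane => chr p.2 p.1) (c := 1) ?_ ?_).congr ?_
        · exact (hcont2.comp continuous_swap).aestronglyMeasurable
        · exact Eventually.of_forall fun p => (norm_chr _ _).le
        · exact Eventually.of_forall fun p => by simp [Function.uncurry]; ring
    _ = ∫ x, φ x * ∫ ξ, chr x ξ * ft f ξ := by
        refine integral_congr_ae (Eventually.of_forall fun x => ?_)
        simp only [← integral_const_mul]
        refine integral_congr_ae (Eventually.of_forall fun ξ => ?_)
        simp only
        ring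

/-- Essential boundedness by the constant `C`. -/
def Bdd (C : ℝ) (f : Plane → ℂ) : Prop := ∀ᵐ x, ‖f x‖ ≤ C

lemma exists_bdd_of_integrable_ft (f : H) (hf : Integrable (ft f) volume) : ∃ C, Bdd C f := by
  refine ⟨∫ ξ, ‖ft f ξ‖, ?_⟩
  filter_upwards [ae_eq_inversion f hf] with x hx
  rw [hx]
  refine (norm_integral_le_integral_norm _).trans (le_of_eq ?_)
  simp [norm_chr]

/-! ### Fourier multipliers and low-pass filters. -/

open Classical in
/-- The Fourier multiplier operator with symbol `m`, extended by zero outside its domain. -/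
def mulOp (m : Plane → ℂ) (f : H) : H :=
  if h : MemLp (fun ξ => m ξ * ft f ξ) 2 volume then 𝓕⁻ (h.toLp _ : H) else 0

lemma ft_mulOp {m : Plane → ℂ} {f : H} (h : MemLp (fun ξ => m ξ * ft f ξ) 2 volume) :
    ft (mulOp m f) =ᵐ[volume] fun ξ => m ξ * ft f ξ := by
  have e : ft (mulOp m f) = h.toLp _ := by
    rw [mulOp, dif_pos h, ft, FourierTransform.fourier_fourierInv_eq]
  rw [e]
  exact h.coeFn_toLp

lemma ft_mulOp_of_bdd {m : Plane → ℂ} {C : ℝ} (hm : AEStronglyMeasurable m volume)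
    (hC : ∀ ξ, ‖m ξ‖ ≤ C) (f : H) : ft (mulOp m f) =ᵐ[volume] fun ξ => m ξ * ft f ξ :=
  ft_mulOp (memLp_bdd_mul hm hC (ft f))

lemma eq_of_ft_ae_eq {f g : H} (h : ft f =ᵐ[volume] ft g) : f = g :=
  ft_injective (Lp.ext h)

/-- `2π max (|ξ₁|, |ξ₂|)`. -/
def zt (ξ : Plane) : ℝ := 2 * Real.pi * max |ξ 0| |ξ 1|

lemma zt_nonneg (ξ : Plane) : 0 ≤ zt ξ := by unfold zt; positivity

lemma le_zt (i : Fin 2) (ξ : Plane) : 2 * Real.pi * |ξ i| ≤ zt ξ := by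
  unfold zt
  have : |ξ i| ≤ max |ξ 0| |ξ 1| := by
    fin_cases i
    · exact le_max_left _ _
    · exact le_max_right _ _
  gcongr

lemma zt_le (ξ : Plane) : zt ξ ≤ 2 * Real.pi * ‖ξ‖ := by
  unfold zt
  have h : ∀ i : Fin 2, |ξ i| ≤ ‖ξ‖ := fun i => by
    simpa using PiLp.norm_apply_le ξ i
  have := max_le (h 0) (h 1)
  gcongr

@[fun_prop]
lemma continuous_zt : Continuous zt := by unfold zt; fun_prop

lemma zt_smul (c : ℝ) (ξ : Plane) : zt (c • ξ) = |c| * zt ξ := by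
  unfold zt
  simp only [PiLp.smul_apply, smul_eq_mul, abs_mul]
  rw [← mul_max_of_nonneg _ _ (abs_nonneg c)]
  ring

/-- A smooth cutoff, equal to `1` on `{zt ≤ 1}` and supported in `{zt ≤ 5/4}`. -/
lemma exists_cutoff : ∃ χ : 𝓢(Plane, ℂ), HasCompactSupport χ ∧
    (∀ ξ, zt ξ ≤ 1 → χ ξ = 1) ∧ (∀ ξ, 5 / 4 ≤ zt ξ → χ ξ = 0) ∧ (∀ ξ, ‖χ ξ‖ ≤ 1) ∧
    ∀ ξ, ‖1 - χ ξ‖ ≤ 1 := by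
  -- The bump lives on `Fin 2 → ℝ` with the sup norm, so after rescaling by `2π` its balls are
  -- exactly the sublevel sets of `zt`.
  let b : ContDiffBump (0 : Fin 2 → ℝ) := ⟨1, 5 / 4, by norm_num, by norm_num⟩
  let e : Plane ≃L[ℝ] (Fin 2 → ℝ) := EuclideanSpace.equiv (Fin 2) ℝ
  let s : ℝ := 2 * Real.pi
  have hs : 0 < s := by positivity
  let g : Plane → ℝ := fun ξ => b (s • e ξ)
  have hsm : ContDiff ℝ (⊤ : ℕ∞) g :=
    b.contDiff.comp ((contDiff_const_smul s).comp e.contDiff)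
  have hn : ∀ ξ, ‖s • e ξ‖ = zt ξ := fun ξ => by
    rw [norm_smul, Real.norm_of_nonneg hs.le, zt]
    congr 1
    have h1 : ‖e ξ‖ = max ‖(e ξ) 0‖ ‖(e ξ) 1‖ := by
      rw [Pi.norm_def]
      simp [Fin.univ_succ]
    rw [h1]
    rfl
  have hcs : HasCompactSupport g := by
    have h0 : HasCompactSupport (b : (Fin 2 → ℝ) → ℝ) := b.hasCompactSupport
    exact h0.comp_homeomorph (e.toHomeomorph.trans (Homeomorph.smulOfNeZero s hs.ne'))
  have h1 : HasCompactSupport (Complex.ofRealCLM ∘ g) := hcs.comp_left rfl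
  have h2 : ContDiff ℝ (⊤ : ℕ∞) (Complex.ofRealCLM ∘ g) := Complex.ofRealCLM.contDiff.comp hsm
  have hval : ∀ ξ, (h1.toSchwartzMap h2) ξ = ((g ξ : ℝ) : ℂ) := fun ξ => rfl
  refine ⟨h1.toSchwartzMap h2, h1, fun ξ hξ => ?_, fun ξ hξ => ?_, fun ξ => ?_, fun ξ => ?_⟩
  · rw [hval, show g ξ = 1 from b.one_of_mem_closedBall (by simpa [hn ξ] using hξ)]
    simp
  · rw [hval, show g ξ = 0 from b.zero_of_le_dist (by simpa [hn ξ] using hξ)]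
    simp
  · rw [hval, Complex.norm_real, Real.norm_of_nonneg b.nonneg]
    exact b.le_one
  · rw [hval, ← Complex.ofReal_one, ← Complex.ofReal_sub, Complex.norm_real,
      Real.norm_of_nonneg (sub_nonneg.2 b.le_one)]
    have : 0 ≤ g ξ := b.nonneg
    linarith

/-- The cutoff of `exists_cutoff`. -/
def cutoff : 𝓢(Plane, ℂ) := exists_cutoff.choose

lemma hasCompactSupport_cutoff : HasCompactSupport cutoff := exists_cutoff.choose_spec.1

/-- The symbol of the low-pass filter at frequency `μ`. -/
def filt (μ : ℝ) (ξ : Plane) : ℂ := cutoff (μ⁻¹ • ξ)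

lemma filt_eq_one {μ : ℝ} (hμ : 0 < μ) {ξ : Plane} (h : zt ξ ≤ μ) : filt μ ξ = 1 := by
  refine exists_cutoff.choose_spec.2.1 _ ?_
  rw [zt_smul, abs_of_pos (inv_pos.2 hμ), inv_mul_le_iff₀ hμ]
  linarith

lemma filt_eq_zero {μ : ℝ} (hμ : 0 < μ) {ξ : Plane} (h : 5 / 4 * μ ≤ zt ξ) : filt μ ξ = 0 := by
  refine exists_cutoff.choose_spec.2.2.1 _ ?_
  rw [zt_smul, abs_of_pos (inv_pos.2 hμ), ← div_eq_inv_mul, le_div_iff₀ hμ]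
  linarith

lemma norm_filt_le (μ : ℝ) (ξ : Plane) : ‖filt μ ξ‖ ≤ 1 := exists_cutoff.choose_spec.2.2.2.1 _

lemma norm_one_sub_filt_le (μ : ℝ) (ξ : Plane) : ‖1 - filt μ ξ‖ ≤ 1 :=
  exists_cutoff.choose_spec.2.2.2.2 _

lemma continuous_filt (μ : ℝ) : Continuous (filt μ) :=
  cutoff.continuous.comp (continuous_const_smul _)

/-- The low-pass filter at frequency `μ`. -/
def lowPass (μ : ℝ) (f : H) : H := mulOp (filt μ) f

lemma ft_lowPass (μ : ℝ) (f : H) :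
    ft (lowPass μ f) =ᵐ[volume] fun ξ => filt μ ξ * ft f ξ :=
  ft_mulOp_of_bdd (continuous_filt μ).aestronglyMeasurable (norm_filt_le μ) f

lemma hasCompactSupport_filt {μ : ℝ} (hμ : 0 < μ) : HasCompactSupport (filt μ) :=
  hasCompactSupport_cutoff.comp_homeomorph (Homeomorph.smulOfNeZero μ⁻¹ (inv_pos.2 hμ).ne')

lemma integrable_ft_lowPass {μ : ℝ} (hμ : 0 < μ) (f : H) :
    Integrable (ft (lowPass μ f)) volume := by
  refine Integrable.congr ?_ (ft_lowPass μ f).symm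
  refine MemLp.integrable_mul (p := 2) (q := 2) ?_ (Lp.memLp _)
  exact (continuous_filt μ).memLp_of_hasCompactSupport (hasCompactSupport_filt hμ)

/-- The low-pass filters are bounded on `L^∞`, uniformly in the frequency. -/
lemma exists_bdd_lowPass : ∃ C₀ : ℝ, 1 ≤ C₀ ∧ ∀ μ : ℝ, 0 < μ → ∀ (f : H) (F : ℝ), Bdd F f →
    Bdd (C₀ * F) (lowPass μ f) := by
  refine ⟨max 1 (∫ y, ‖(𝓕 cutoff) y‖), le_max_left _ _, fun μ hμ f F hF => ?_⟩
  have hcs := hasCompactSupport_filt hμ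
  have hsm : ContDiff ℝ (⊤ : ℕ∞) (filt μ) := (cutoff.smooth ⊤).comp (contDiff_const_smul _)
  let χ : 𝓢(Plane, ℂ) := hcs.toSchwartzMap hsm
  have hχ : ∀ ξ, χ ξ = filt μ ξ := fun ξ => rfl
  -- The `L¹` norm of the convolution kernel is invariant under dilation, which makes the bound
  -- uniform in `μ`.
  have hint : ∫ y, ‖(𝓕 χ) y‖ = ∫ y, ‖(𝓕 cutoff) y‖ := by
    have e : ∀ y, (𝓕 χ) y = (μ ^ 2 : ℝ) • (𝓕 cutoff) (μ • y) := fun y => by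
      rw [SchwartzMap.fourier_coe, SchwartzMap.fourier_coe, Real.fourier_eq', Real.fourier_eq']
      have := Measure.integral_comp_smul (volume : Measure Plane)
        (fun ξ => Complex.exp (↑(-2 * Real.pi * inner ℝ ξ (μ • y)) * Complex.I) • cutoff ξ) μ⁻¹
      rw [finrank_euclideanSpace_fin] at this
      have h2 : |((μ⁻¹ ^ 2)⁻¹ : ℝ)| = μ ^ 2 := by
        rw [inv_pow, inv_inv, abs_of_pos (by positivity)]
      rw [h2] at this
      rw [← this]
      refine integral_congr_ae (Eventually.of_forall fun ξ => ?_)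
      simp only [hχ, filt, inner_smul_left, inner_smul_right]
      congr 4
      simp only [conj_trivial]
      field_simp
    have h3 := Measure.integral_comp_smul (volume : Measure Plane)
      (fun y => ‖(𝓕 cutoff) y‖) μ
    rw [finrank_euclideanSpace_fin] at h3
    simp only [e, norm_smul, integral_const_mul, h3, smul_eq_mul]
    rw [abs_of_pos (by positivity), Real.norm_of_nonneg (by positivity)]
    field_simp
  filter_upwards [ae_eq_inversion _ (integrable_ft_lowPass hμ f)] with x hx
  obtain ⟨ψ, hψ, hψ'⟩ := exists_modulation χ hcs x
  have e1 : ∫ ξ, chr x ξ * ft (lowPass μ f) ξ = ∫ ξ, ψ ξ * ft f ξ := by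
    refine integral_congr_ae ?_
    filter_upwards [ft_lowPass μ f] with ξ hξ
    rw [hξ, hψ, hχ]
    ring
  rw [hx, e1, integral_ft_mul_schwartz]
  have hF0 : 0 ≤ F := by
    obtain ⟨x, hx⟩ := hF.exists
    exact (norm_nonneg _).trans hx
  calc ‖∫ y, (𝓕 ψ) y * f y‖ ≤ ∫ y, ‖(𝓕 ψ) y * f y‖ := norm_integral_le_integral_norm _
    _ ≤ ∫ y, ‖(𝓕 ψ) y‖ * F := by
        refine integral_mono_of_nonneg (Eventually.of_forall fun y => norm_nonneg _)
          ((𝓕 ψ).integrable.norm.mul_const F) ?_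
        filter_upwards [hF] with y hy
        simp only [norm_mul]
        exact mul_le_mul_of_nonneg_left hy (norm_nonneg _)
    _ = (∫ y, ‖(𝓕 χ) y‖) * F := by
        rw [integral_mul_const]
        simp only [hψ']
        have := integral_sub_right_eq_self (μ := volume) (fun y => ‖(𝓕 χ) y‖) x
        rw [this]
    _ ≤ _ := by
        rw [hint]
        exact mul_le_mul_of_nonneg_right (le_max_right _ _) hF0

/-! ### Convergence in `L²` and essential bounds. -/

/-- Dominated convergence in `L²`. -/
lemma tendsto_of_dominated {f : ℕ → H} {g : H} (bound : Plane → ℝ) (hb : MemLp bound 2 volume)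
    (hle : ∀ n, ∀ᵐ x, ‖f n x‖ ≤ bound x)
    (hlim : ∀ᵐ x, Tendsto (fun n => f n x) atTop (𝓝 (g x))) : Tendsto f atTop (𝓝 g) := by
  rw [Lp.tendsto_Lp_iff_tendsto_eLpNorm']
  have hg : ∀ᵐ x, ‖g x‖ ≤ bound x := by
    filter_upwards [hlim, ae_all_iff.2 hle] with x h1 h2
    exact le_of_tendsto h1.norm (Eventually.of_forall h2)
  have key : Tendsto (fun n => ∫⁻ x, ‖f n x - g x‖ₑ ^ (2 : ℝ)) atTop
      (𝓝 (∫⁻ x, ‖(0 : ℂ)‖ₑ ^ (2 : ℝ) ∂(volume : Measure Plane))) := by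
    refine tendsto_lintegral_of_dominated_convergence'
      (fun x => (2 * ‖bound x‖ₑ) ^ (2 : ℝ)) (fun n => ?_) (fun n => ?_) ?_ ?_
    · exact (((Lp.aestronglyMeasurable (f n)).sub (Lp.aestronglyMeasurable g)).enorm).pow_const _
    · filter_upwards [hle n, hg] with x h1 h2
      refine ENNReal.rpow_le_rpow ?_ (by norm_num)
      have h3 : ‖f n x‖ₑ ≤ ‖bound x‖ₑ := by
        rw [enorm_le_iff_norm_le]; exact h1.trans (le_abs_self _)
      have h4 : ‖g x‖ₑ ≤ ‖bound x‖ₑ := by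
        rw [enorm_le_iff_norm_le]; exact h2.trans (le_abs_self _)
      calc ‖f n x - g x‖ₑ ≤ ‖f n x‖ₑ + ‖g x‖ₑ := enorm_sub_le
        _ ≤ ‖bound x‖ₑ + ‖bound x‖ₑ := add_le_add h3 h4
        _ = _ := (two_mul _).symm
    · have := (eLpNorm_lt_top_iff_lintegral_rpow_enorm_lt_top (by norm_num) (by norm_num)).1
        (hb.const_mul 2).2
      convert! this.ne using 3 with x
      have h2 : ‖(2 : ℝ)‖ₑ = 2 := by
        rw [Real.enorm_eq_ofReal (by norm_num)]
        simp
      norm_num [enorm_mul, h2]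
    · filter_upwards [hlim] with x hx
      have h1 : Tendsto (fun n => f n x - g x) atTop (𝓝 0) := by
        simpa using hx.sub_const (g x)
      exact (h1.enorm).ennrpow_const 2
  have e : ∀ n, eLpNorm (⇑(f n) - ⇑g) 2 volume
      = (∫⁻ x, ‖f n x - g x‖ₑ ^ (2 : ℝ)) ^ (1 / 2 : ℝ) := fun n => by
    rw [eLpNorm_eq_lintegral_rpow_enorm_toReal (by norm_num) (by norm_num)]
    norm_num
  simp only [e]
  have := key.ennrpow_const (1 / 2 : ℝ)
  simpa using this

lemma tendsto_of_ft {f : ℕ → H} {g : H} (h : Tendsto (fun n => ft (f n)) atTop (𝓝 (ft g))) :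
    Tendsto f atTop (𝓝 g) := by
  have := ((Lp.fourierTransformₗᵢ Plane ℂ).symm.continuous.tendsto _).comp h
  convert! this using 2
  · exact funext fun n => ((Lp.fourierTransformₗᵢ Plane ℂ).symm_apply_apply _).symm
  · exact ((Lp.fourierTransformₗᵢ Plane ℂ).symm_apply_apply _).symm

/-- `L²` convergence gives almost everywhere convergence along a subsequence, and pointwise bounds
survive that. -/
lemma Bdd.of_tendsto {C : ℝ} {f : ℕ → H} {g : H} (hf : ∀ n, Bdd C (f n))
    (h : Tendsto f atTop (𝓝 g)) : Bdd C g := by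
  obtain ⟨ns, _, hns⟩ := (tendstoInMeasure_of_tendsto_Lp h).exists_seq_tendsto_ae
  have : ∀ᵐ x, ∀ n, ‖f n x‖ ≤ C := ae_all_iff.2 hf
  filter_upwards [hns, this] with x h1 h2
  exact le_of_tendsto h1.norm (Eventually.of_forall fun n => h2 _)

lemma Bdd.nonneg {C : ℝ} {f : Plane → ℂ} (h : Bdd C f) : 0 ≤ C := by
  obtain ⟨x, hx⟩ := h.exists
  exact (norm_nonneg _).trans hx

lemma Bdd.mono {C D : ℝ} {f : Plane → ℂ} (h : Bdd C f) (hCD : C ≤ D) : Bdd D f :=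
  Eventually.mono h fun _ hx => hx.trans hCD

lemma Bdd.add {C D : ℝ} {f g : H} (hf : Bdd C f) (hg : Bdd D g) : Bdd (C + D) (f + g : H) := by
  filter_upwards [hf, hg, Lp.coeFn_add f g] with x h1 h2 h3
  rw [h3]
  exact (norm_add_le _ _).trans (add_le_add h1 h2)

lemma Bdd.smul {C : ℝ} {f : H} (c : ℂ) (hf : Bdd C f) : Bdd (‖c‖ * C) (c • f : H) := by
  filter_upwards [hf, Lp.coeFn_smul c f] with x h1 h3
  rw [h3, Pi.smul_apply, norm_smul]
  exact mul_le_mul_of_nonneg_left h1 (norm_nonneg _)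

lemma Bdd.sum {ι : Type*} (s : Finset ι) {C : ι → ℝ} {f : ι → H} (hf : ∀ i ∈ s, Bdd (C i) (f i)) :
    Bdd (∑ i ∈ s, C i) (∑ i ∈ s, f i : H) := by
  classical
  induction s using Finset.induction_on with
  | empty =>
    simp only [Finset.sum_empty]
    filter_upwards [Lp.coeFn_zero ℂ 2 (volume : Measure Plane)] with x hx
    simp
  | insert a s ha ih =>
    rw [Finset.sum_insert ha, Finset.sum_insert ha]
    exact (hf a (Finset.mem_insert_self a s)).add
      (ih fun i hi => hf i (Finset.mem_insert_of_mem hi))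

lemma ae_comp_add {p : Plane → Prop} (h : ∀ᵐ x, p x) (a : Plane) : ∀ᵐ x : Plane, p (x + a) :=
  (measurePreserving_add_right volume a).quasiMeasurePreserving.ae h

lemma Bdd.translate {C : ℝ} {f : H} (a : Plane) (hf : Bdd C f) : Bdd C (tr a f) := by
  filter_upwards [coeFn_tr a f, ae_comp_add hf a] with x h1 h2
  rwa [h1]

/-! ### Difference quotients and partial derivatives. -/

/-- The standard basis of the plane. -/
def ev (e : Fin 2) : Plane := EuclideanSpace.single e 1

lemma inner_smul_ev (h : ℝ) (e : Fin 2) (ξ : Plane) : inner ℝ (h • ev e) ξ = h * ξ e := by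
  rw [inner_smul_left, ev, EuclideanSpace.inner_single_left]
  simp

lemma chr_add (a b ξ : Plane) : chr (a + b) ξ = chr a ξ * chr b ξ := by
  simp only [chr, inner_add_left, ← Complex.exp_add]
  congr 1; push_cast; ring

lemma chr_zero (ξ : Plane) : chr 0 ξ = 1 := by simp [chr]

lemma tr_add (a b : Plane) (f : H) : tr (a + b) f = tr a (tr b f) := by
  refine eq_of_ft_ae_eq ?_
  filter_upwards [ft_tr (a + b) f, ft_tr a (tr b f), ft_tr b f] with ξ h1 h2 h3
  rw [h1, h2, h3, chr_add, mul_assoc]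

lemma tr_zero (f : H) : tr 0 f = f := by
  refine eq_of_ft_ae_eq ?_
  filter_upwards [ft_tr 0 f] with ξ h1
  rw [h1, chr_zero, one_mul]

/-- The difference quotient in direction `e` with step `h`. -/
def dq (h : ℝ) (e : Fin 2) : H →L[ℂ] H :=
  (h : ℂ)⁻¹ • ((tr (h • ev e)).toContinuousLinearMap - ContinuousLinearMap.id ℂ H)

lemma dq_apply (h : ℝ) (e : Fin 2) (f : H) : dq h e f = (h : ℂ)⁻¹ • (tr (h • ev e) f - f) := rfl

lemma coeFn_dq (h : ℝ) (e : Fin 2) (f : H) :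
    dq h e f =ᵐ[volume] fun x => (h : ℂ)⁻¹ * (f (x + h • ev e) - f x) := by
  rw [dq_apply]
  filter_upwards [Lp.coeFn_smul (h : ℂ)⁻¹ (tr (h • ev e) f - f), Lp.coeFn_sub (tr (h • ev e) f) f,
    coeFn_tr (h • ev e) f] with x h1 h2 h3
  rw [h1, Pi.smul_apply, h2, Pi.sub_apply, h3, smul_eq_mul]

/-- The symbol of `dq h e`. -/
def dsym (h : ℝ) (e : Fin 2) (ξ : Plane) : ℂ := (h : ℂ)⁻¹ * (chr (h • ev e) ξ - 1)

/-- The symbol of `∂ₑ`. -/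
def psym (e : Fin 2) (ξ : Plane) : ℂ := 2 * Real.pi * Complex.I * (ξ e : ℝ)

lemma ft_dq (h : ℝ) (e : Fin 2) (f : H) :
    ft (dq h e f) =ᵐ[volume] fun ξ => dsym h e ξ * ft f ξ := by
  rw [dq_apply, ft_smul, ft_sub]
  filter_upwards [Lp.coeFn_smul (h : ℂ)⁻¹ (ft (tr (h • ev e) f) - ft f),
    Lp.coeFn_sub (ft (tr (h • ev e) f)) (ft f), ft_tr (h • ev e) f] with x h1 h2 h3
  rw [h1, Pi.smul_apply, h2, Pi.sub_apply, h3, smul_eq_mul, dsym]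
  ring

lemma chr_smul_ev (h : ℝ) (e : Fin 2) (ξ : Plane) :
    chr (h • ev e) ξ = Complex.exp (Complex.I * (2 * Real.pi * (h * ξ e) : ℝ)) := by
  rw [chr, inner_smul_ev]
  congr 1; push_cast; ring

/-- This is `|exp (iθ) - 1| ≤ |θ|`. A difference quotient is dominated in frequency by the
derivative, with constant one and uniformly in the step. -/
lemma norm_dsym_le (h : ℝ) (e : Fin 2) (ξ : Plane) : ‖dsym h e ξ‖ ≤ 2 * Real.pi * |ξ e| := by
  by_cases h0 : h = 0
  · subst h0; simp [dsym]; positivity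
  rw [dsym, norm_mul, norm_inv, Complex.norm_real, Real.norm_eq_abs, chr_smul_ev,
    inv_mul_le_iff₀ (abs_pos.2 h0)]
  refine (Real.norm_exp_I_mul_ofReal_sub_one_le).trans (le_of_eq ?_)
  rw [Real.norm_eq_abs, abs_mul, abs_mul (2 : ℝ), abs_mul h, abs_of_pos Real.pi_pos, abs_two]
  ring

lemma norm_dsym_le_zt (h : ℝ) (e : Fin 2) (ξ : Plane) : ‖dsym h e ξ‖ ≤ zt ξ :=
  (norm_dsym_le h e ξ).trans (le_zt e ξ)

lemma norm_psym (e : Fin 2) (ξ : Plane) : ‖psym e ξ‖ = 2 * Real.pi * |ξ e| := by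
  simp [psym, abs_of_pos Real.pi_pos]

lemma norm_psym_le_zt (e : Fin 2) (ξ : Plane) : ‖psym e ξ‖ ≤ zt ξ :=
  (norm_psym e ξ).le.trans (le_zt e ξ)

lemma tendsto_dsym (e : Fin 2) (ξ : Plane) {δ : ℕ → ℝ} (hδ : Tendsto δ atTop (𝓝[≠] 0)) :
    Tendsto (fun n => dsym (δ n) e ξ) atTop (𝓝 (psym e ξ)) := by
  have h1 : HasDerivAt (fun t : ℝ => Complex.exp (Complex.I * (2 * Real.pi * (t * ξ e) : ℝ)))
      (psym e ξ) 0 := by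
    have h2 : HasDerivAt (fun t : ℝ => Complex.I * (2 * Real.pi * (t * ξ e) : ℝ))
        (psym e ξ) 0 := by
      have h3 : HasDerivAt (fun t : ℝ => 2 * Real.pi * (t * ξ e)) (2 * Real.pi * (1 * ξ e)) 0 :=
        ((hasDerivAt_id (0 : ℝ)).mul_const _).const_mul _
      convert! (h3.ofReal_comp).const_mul Complex.I using 1
      rw [psym]; push_cast; ring
    convert! h2.cexp using 1
    simp
  have h4 := (hasDerivAt_iff_tendsto_slope.1 h1).comp hδ
  refine h4.congr fun n => ?_
  simp only [Function.comp, slope, dsym, chr_smul_ev]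
  simp

/-- `g = ∂ₑ f`, in terms of Fourier transforms. -/
def IsPd (e : Fin 2) (f g : H) : Prop := ft g =ᵐ[volume] fun ξ => psym e ξ * ft f ξ

lemma tendsto_dq {e : Fin 2} {f g : H} (hfg : IsPd e f g) {δ : ℕ → ℝ}
    (hδ : Tendsto δ atTop (𝓝[≠] 0)) : Tendsto (fun n => dq (δ n) e f) atTop (𝓝 g) := by
  refine tendsto_of_ft (tendsto_of_dominated (fun ξ => ‖ft g ξ‖) (Lp.memLp (ft g)).norm
    (fun n => ?_) ?_)
  · filter_upwards [ft_dq (δ n) e f, hfg] with ξ h1 h2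
    rw [h1, h2, norm_mul, norm_mul, norm_psym]
    exact mul_le_mul_of_nonneg_right (norm_dsym_le _ _ _) (norm_nonneg _)
  · filter_upwards [ae_all_iff.2 fun n => ft_dq (δ n) e f, hfg] with ξ h1 h2
    simp only [h1, h2]
    exact (tendsto_dsym e ξ hδ).mul_const _

/-- The increment over a step `h` telescopes into `n` increments over steps `h / n`. Letting `n → ∞`
turns a bound on the derivative into a bound on the quotient without pointwise calculus. -/
lemma dq_eq_average (h : ℝ) (e : Fin 2) (f : H) (n : ℕ) (hn : n ≠ 0) :
    dq h e f = ∑ k ∈ Finset.range n,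
      ((n : ℂ)⁻¹) • tr ((k * (h / n)) • ev e) (dq (h / n) e f) := by
  have hn' : (n : ℂ) ≠ 0 := Nat.cast_ne_zero.2 hn
  have hn'' : (n : ℝ) ≠ 0 := Nat.cast_ne_zero.2 hn
  have e1 : ∀ k : ℕ, ((n : ℂ)⁻¹) • tr ((k * (h / n)) • ev e) (dq (h / n) e f)
      = (h : ℂ)⁻¹ • (tr (((k + 1 : ℕ) * (h / n)) • ev e) f - tr ((k * (h / n)) • ev e) f) := by
    intro k
    rw [dq_apply, map_smul, map_sub, ← tr_add, ← add_smul, smul_smul]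
    congr 1
    · push_cast
      rw [inv_div, ← mul_div_assoc, inv_mul_cancel₀ hn', one_div]
    · congr 3
      push_cast; ring_nf
  rw [Finset.sum_congr rfl fun k _ => e1 k, ← Finset.smul_sum,
    Finset.sum_range_sub (fun k : ℕ => tr ((k * (h / n)) • ev e) f), dq_apply]
  simp [mul_div_cancel₀, hn'', tr_zero]

/-- A bound for a partial derivative bounds the difference quotients. -/
lemma Bdd.dq_of_isPd {e : Fin 2} {f g : H} (hfg : IsPd e f g) {C : ℝ} (hg : Bdd C g) (h : ℝ) :
    Bdd C (dq h e f) := by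
  by_cases h0 : h = 0
  -- For `h = 0` the quotient is the zero function, since `0⁻¹ = 0`.
  · subst h0
    rw [dq_apply]
    have := (hg.smul 0).mono (D := C) (by simpa using hg.nonneg)
    simpa using this
  have hδ : Tendsto (fun n : ℕ => h / ((n + 1 : ℕ) : ℝ)) atTop (𝓝[≠] 0) := by
    refine tendsto_nhdsWithin_iff.2 ⟨?_, Eventually.of_forall fun n => ?_⟩
    · exact (tendsto_const_div_atTop_nhds_zero_nat h).comp (tendsto_add_atTop_nat 1)
    · exact div_ne_zero h0 (Nat.cast_ne_zero.2 n.succ_ne_zero)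
  have hlim := tendsto_dq hfg hδ
  -- The same averages with the short difference quotients replaced by their limit `g`. Averages of
  -- translates of `g` inherit its bound, and the replacement error is at most the `L²` distance
  -- from the short quotient to `g`.
  let A : ℕ → H := fun n => ∑ k ∈ Finset.range (n + 1),
      (((n + 1 : ℕ) : ℂ)⁻¹) • tr ((k * (h / (n + 1 : ℕ))) • ev e) g
  have hA : ∀ n, Bdd C (A n) := fun n => by
    have := Bdd.sum (Finset.range (n + 1)) (fun k _ =>
      ((hg.translate ((k * (h / (n + 1 : ℕ))) • ev e)).smul (((n + 1 : ℕ) : ℂ)⁻¹)))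
    refine this.mono (le_of_eq ?_)
    rw [Finset.sum_const, Finset.card_range, nsmul_eq_mul, norm_inv, Complex.norm_natCast,
      ← mul_assoc, mul_inv_cancel₀ (Nat.cast_ne_zero.2 n.succ_ne_zero), one_mul]
  refine Bdd.of_tendsto hA ?_
  rw [tendsto_iff_norm_sub_tendsto_zero]
  refine squeeze_zero (fun _ => norm_nonneg _) (fun n => ?_)
    (tendsto_iff_norm_sub_tendsto_zero.1 hlim)
  rw [dq_eq_average h e f (n + 1) n.succ_ne_zero]
  simp only [A]
  rw [← Finset.sum_sub_distrib]
  refine (norm_sum_le _ _).trans (le_of_eq ?_)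
  have : ∀ k ∈ Finset.range (n + 1), ‖(((n + 1 : ℕ) : ℂ)⁻¹) • tr ((k * (h / (n + 1 : ℕ))) • ev e) g
      - (((n + 1 : ℕ) : ℂ)⁻¹) • tr ((k * (h / (n + 1 : ℕ))) • ev e) (dq (h / (n + 1 : ℕ)) e f)‖
      = ((n + 1 : ℕ) : ℝ)⁻¹ * ‖dq (h / (n + 1 : ℕ)) e f - g‖ := fun k _ => by
    rw [← smul_sub, ← map_sub, norm_smul, LinearIsometry.norm_map, norm_sub_rev, norm_inv,
      Complex.norm_natCast]
  rw [Finset.sum_congr rfl this, Finset.sum_const, Finset.card_range, nsmul_eq_mul, ← mul_assoc,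
    mul_inv_cancel₀ (Nat.cast_ne_zero.2 n.succ_ne_zero), one_mul]

/-! ### Bernstein's inequality with constant one. -/

/-- The full cosine series is that of the second Bernoulli polynomial. Its even terms form a quarter
of the same series at `2x`, and subtracting them leaves the odd ones. The restriction `x ≤ 1/2`
keeps `2x` in the period. -/
lemma hasSum_odd_cos {x : ℝ} (hx : x ∈ Icc (0 : ℝ) (1 / 2)) :
    HasSum (fun k : ℕ => 1 / ((2 * k + 1 : ℕ) : ℝ) ^ 2 * Real.cos (2 * Real.pi * (2 * k + 1 : ℕ) * x))
      (Real.pi ^ 2 / 8 - Real.pi ^ 2 * x / 2) := by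
  have hB : ∀ y : ℝ, (Polynomial.map (algebraMap ℚ ℝ) (Polynomial.bernoulli 2)).eval y
      = y ^ 2 - y + 1 / 6 := fun y => by
    have e2 : Polynomial.bernoulli 2 = Polynomial.X ^ 2 - Polynomial.X
        + Polynomial.C (1 / 6 : ℚ) := by
      rw [Polynomial.bernoulli]
      simp only [Finset.sum_range_succ, Finset.sum_range_zero]
      norm_num [bernoulli_eq_bernoulli'_of_ne_one, bernoulli_one, bernoulli'_two, bernoulli_two,
        ← Polynomial.C_mul_X_pow_eq_monomial]
      ring
    rw [e2]
    simp
  have h1 := hasSum_one_div_nat_pow_mul_cos (k := 1) one_ne_zero (x := x)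
    ⟨hx.1, hx.2.trans (by norm_num)⟩
  have h2 := hasSum_one_div_nat_pow_mul_cos (k := 1) one_ne_zero (x := 2 * x)
    ⟨by linarith [hx.1], by linarith [hx.2]⟩
  simp only [mul_one, hB] at h1 h2
  have h2' := h2.mul_left (1 / 4)
  have hev : HasSum (fun k : ℕ => 1 / ((2 * k : ℕ) : ℝ) ^ 2
      * Real.cos (2 * Real.pi * (2 * k : ℕ) * x)) (1 / 4 * ((-1) ^ (1 + 1) * (2 * Real.pi) ^ 2 / 2 /
        (Nat.factorial 2) * ((2 * x) ^ 2 - 2 * x + 1 / 6))) := by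
    convert! h2' using 2 with k
    rw [show 2 * Real.pi * (2 * k : ℕ) * x = 2 * Real.pi * k * (2 * x) by push_cast; ring]
    rw [show 1 / ((2 * k : ℕ) : ℝ) ^ 2 = 1 / 4 * (1 / (k : ℝ) ^ 2) by
      push_cast
      rw [mul_pow, one_div, one_div, one_div, mul_inv]
      norm_num, mul_assoc]
  have hodd : Summable (fun k : ℕ => 1 / ((2 * k + 1 : ℕ) : ℝ) ^ 2
      * Real.cos (2 * Real.pi * (2 * k + 1 : ℕ) * x)) :=
    h1.summable.comp_injective (i := fun k : ℕ => 2 * k + 1) fun a b h => by simpa using h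
  have h3 := (HasSum.even_add_odd (f := fun n : ℕ => 1 / (n : ℝ) ^ 2
    * Real.cos (2 * Real.pi * n * x)) hev hodd.hasSum).unique h1
  have h4 : ∑' k : ℕ, 1 / ((2 * k + 1 : ℕ) : ℝ) ^ 2
      * Real.cos (2 * Real.pi * (2 * k + 1 : ℕ) * x) = Real.pi ^ 2 / 8 - Real.pi ^ 2 * x / 2 := by
    have : ((Nat.factorial 2 : ℕ) : ℝ) = 2 := by norm_num
    rw [this] at h3
    linear_combination h3
  rw [← h4]
  exact hodd.hasSum

lemma hasSum_odd_inv_sq : HasSum (fun k : ℕ => 1 / ((2 * k + 1 : ℕ) : ℝ) ^ 2)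
    (Real.pi ^ 2 / 8) := by
  simpa using hasSum_odd_cos (x := 0) ⟨le_rfl, by norm_num⟩

/-- The triangle wave expansion of the identity on `[-M, M]`. -/
lemma hasSum_triangle {M s : ℝ} (hM : 0 < M) (hs : |s| ≤ M) :
    HasSum (fun k : ℕ => 8 * M / Real.pi ^ 2 * (1 / ((2 * k + 1 : ℕ) : ℝ) ^ 2
      * Real.cos (2 * Real.pi * (2 * k + 1 : ℕ) * (1 / 4 - s / (4 * M))))) s := by
  have h1 : s / (4 * M) ≤ 1 / 4 := by
    rw [div_le_div_iff₀ (by positivity) (by norm_num)]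
    linarith [(abs_le.1 hs).2]
  have h2 : -(1 / 4) ≤ s / (4 * M) := by
    rw [le_div_iff₀ (by positivity)]
    linarith [(abs_le.1 hs).1]
  convert! (hasSum_odd_cos (x := 1 / 4 - s / (4 * M)) ⟨by linarith, by linarith⟩).mul_left
    (8 * M / Real.pi ^ 2) using 1
  have := Real.pi_pos
  field_simp
  ring

/-- The Fourier transform of `f` is supported where `zt ≤ M`. -/
def BandLim (M : ℝ) (f : H) : Prop := ∀ᵐ ξ, M < zt ξ → ft f ξ = 0

/-- Bernstein's inequality. -/
lemma Bdd.of_bandLim {M : ℝ} (hM : 0 < M) {f g : H} {e : Fin 2} (hf : BandLim M f)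
    (hfg : IsPd e f g) {F : ℝ} (hF : Bdd F f) : Bdd (M * F) g := by
  have hpi := Real.pi_pos
  -- On `[-M, M]` the derivative symbol is `i` times a triangle wave. Its cosine series has
  -- nonnegative coefficients `c k` with sum `M`, and each cosine is the symbol of a combination of
  -- two translations. On band-limited functions `∂ₑ` is therefore a combination of translations of
  -- total mass `M`.
  let c : ℕ → ℝ := fun k => 8 * M / Real.pi ^ 2 * (1 / ((2 * k + 1 : ℕ) : ℝ) ^ 2)
  let a : ℕ → ℝ := fun k => (2 * k + 1 : ℕ) * Real.pi / (2 * M)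
  let z : ℕ → ℂ := fun k => Complex.exp ((Real.pi * (2 * k + 1 : ℕ) / 2 : ℝ) * Complex.I)
  let T : ℕ → H := fun k => (c k * Complex.I / 2 * z k) • tr ((-a k) • ev e) f
    + (c k * Complex.I / 2 * (z k)⁻¹) • tr (a k • ev e) f
  have hc0 : ∀ k, 0 ≤ c k := fun k => by positivity
  have hz : ∀ k, ‖z k‖ = 1 := fun k => Complex.norm_exp_ofReal_mul_I _
  have hcs : HasSum c M := by
    convert! hasSum_odd_inv_sq.mul_left (8 * M / Real.pi ^ 2) using 1
    field_simp
  have hTb : ∀ k, Bdd (c k * F) (T k) := fun k => by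
    refine (((hF.translate _).smul _).add ((hF.translate _).smul _)).mono (le_of_eq ?_)
    simp only [norm_mul, norm_div, norm_inv, hz, Complex.norm_real, Complex.norm_I,
      Real.norm_of_nonneg (hc0 k)]
    norm_num
    ring
  let Ts : ℕ → Plane → ℂ := fun k ξ => Complex.I * ((8 * M / Real.pi ^ 2 *
    (1 / ((2 * k + 1 : ℕ) : ℝ) ^ 2 * Real.cos (2 * Real.pi * (2 * k + 1 : ℕ) *
      (1 / 4 - 2 * Real.pi * ξ e / (4 * M)))) : ℝ) : ℂ)
  have hTs : ∀ k, ft (T k) =ᵐ[volume] fun ξ => Ts k ξ * ft f ξ := fun k => by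
    simp only [T, ft_add, ft_smul]
    filter_upwards [Lp.coeFn_add ((c k * Complex.I / 2 * z k) • ft (tr ((-a k) • ev e) f))
      ((c k * Complex.I / 2 * (z k)⁻¹) • ft (tr (a k • ev e) f)),
      Lp.coeFn_smul (c k * Complex.I / 2 * z k) (ft (tr ((-a k) • ev e) f)),
      Lp.coeFn_smul (c k * Complex.I / 2 * (z k)⁻¹) (ft (tr (a k • ev e) f)),
      ft_tr ((-a k) • ev e) f, ft_tr (a k • ev e) f] with ξ h1 h2 h3 h4 h5
    rw [h1, Pi.add_apply, h2, h3, Pi.smul_apply, Pi.smul_apply, h4, h5]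
    set θ : ℝ := 2 * Real.pi * (2 * k + 1 : ℕ) * (1 / 4 - 2 * Real.pi * ξ e / (4 * M)) with hθ
    have e1 : (Real.pi * (2 * k + 1 : ℕ) / 2 : ℝ) * Complex.I
        + Complex.I * (2 * Real.pi * (-a k * ξ e) : ℝ) = (θ : ℂ) * Complex.I := by
      rw [mul_comm Complex.I, ← add_mul, ← Complex.ofReal_add]
      congr 2
      simp only [hθ, a]
      field_simp
      ring
    have e2 : -((Real.pi * (2 * k + 1 : ℕ) / 2 : ℝ) * Complex.I)
        + Complex.I * (2 * Real.pi * (a k * ξ e) : ℝ) = -(θ : ℂ) * Complex.I := by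
      rw [← Complex.ofReal_neg, mul_comm Complex.I, ← neg_mul, ← Complex.ofReal_neg, ← add_mul,
        ← Complex.ofReal_add]
      congr 2
      simp only [hθ, a]
      field_simp
      ring
    have e3 : Complex.exp (θ * Complex.I) + Complex.exp (-(θ : ℂ) * Complex.I)
        = 2 * ((Real.cos θ : ℝ) : ℂ) := by
      rw [Complex.ofReal_cos, Complex.two_cos]
    have e4 : z k * chr ((-a k) • ev e) ξ = Complex.exp (θ * Complex.I) := by
      simp only [z]
      rw [chr_smul_ev, ← Complex.exp_add, e1]
    have e5 : (z k)⁻¹ * chr (a k • ev e) ξ = Complex.exp (-(θ : ℂ) * Complex.I) := by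
      simp only [z]
      rw [chr_smul_ev, ← Complex.exp_neg, ← Complex.exp_add, e2]
    have e6 : Ts k ξ = Complex.I * (c k * ((Real.cos θ : ℝ) : ℂ)) := by
      simp only [Ts, c]
      rw [← mul_assoc (8 * M / Real.pi ^ 2), Complex.ofReal_mul]
    rw [e6]
    simp only [smul_eq_mul]
    linear_combination (c k * Complex.I / 2 * ft f ξ) * (e4 + e5 + e3)
  have hTsn : ∀ k ξ, ‖Ts k ξ‖ ≤ c k := fun k ξ => by
    simp only [Ts, norm_mul, Complex.norm_I, one_mul, Complex.norm_real]
    rw [← mul_assoc, ← norm_mul, ← norm_mul, norm_mul, Real.norm_of_nonneg (hc0 k)]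
    exact mul_le_of_le_one_right (hc0 k) (Real.abs_cos_le_one _)
  refine Bdd.of_tendsto (f := fun N => ∑ k ∈ Finset.range N, T k) (fun N => ?_) ?_
  · refine (Bdd.sum (Finset.range N) fun k _ => hTb k).mono ?_
    rw [← Finset.sum_mul]
    exact mul_le_mul_of_nonneg_right (sum_le_hasSum _ (fun k _ => hc0 k) hcs) hF.nonneg
  have hsum : ∀ N, ft (∑ k ∈ Finset.range N, T k) =ᵐ[volume]
      fun ξ => (∑ k ∈ Finset.range N, Ts k ξ) * ft f ξ := fun N => by
    rw [ft_sum]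
    filter_upwards [Lp.coeFn_finsetSum (Finset.range N) (fun k => ft (T k)), ae_all_iff.2 hTs]
      with ξ h1 h2
    rw [h1, Finset.sum_apply, Finset.sum_mul]
    exact Finset.sum_congr rfl fun k _ => h2 k
  refine tendsto_of_ft (tendsto_of_dominated (fun ξ => M * ‖ft f ξ‖)
    ((Lp.memLp (ft f)).norm.const_mul M) (fun N => ?_) ?_)
  · filter_upwards [hsum N] with ξ h1
    rw [h1, norm_mul]
    refine mul_le_mul_of_nonneg_right ((norm_sum_le _ _).trans ?_) (norm_nonneg _)
    exact (Finset.sum_le_sum fun k _ => hTsn k ξ).trans (sum_le_hasSum _ (fun k _ => hc0 k) hcs)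
  · filter_upwards [ae_all_iff.2 hsum, hfg, hf] with ξ h1 h2 h3
    simp only [h1, h2]
    by_cases hξ : M < zt ξ
    · simp [h3 hξ]
    refine Tendsto.mul_const _ ?_
    have h4 := hasSum_triangle hM (s := 2 * Real.pi * ξ e) (by
      rw [abs_mul, abs_of_pos (by positivity)]
      exact (le_zt e ξ).trans (not_lt.1 hξ))
    have h5 : HasSum (fun k => Ts k ξ) (Complex.I * ((2 * Real.pi * ξ e : ℝ) : ℂ)) :=
      (Complex.hasSum_ofReal.2 h4).mul_left Complex.I
    rw [show psym e ξ = Complex.I * ((2 * Real.pi * ξ e : ℝ) : ℂ) by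
      rw [psym]; push_cast; ring]
    exact h5.tendsto_sum_nat

/-! ### Homogeneous seminorms and bilinear interpolation. -/

lemma lintegral_sq_enorm (f : H) : ∫⁻ x, ‖f x‖ₑ ^ 2 = ‖f‖ₑ ^ 2 := by
  rw [Lp.enorm_def, eLpNorm_eq_lintegral_rpow_enorm_toReal (by norm_num) (by norm_num)]
  rw [← ENNReal.rpow_natCast, ← ENNReal.rpow_mul]
  norm_num

lemma lintegral_sq_enorm_ft (f : H) : ∫⁻ ξ, ‖ft f ξ‖ₑ ^ 2 = ∫⁻ x, ‖f x‖ₑ ^ 2 := by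
  rw [lintegral_sq_enorm, lintegral_sq_enorm, enorm_eq_iff_norm_eq.2 (norm_ft f)]

/-- The homogeneous Sobolev seminorm `‖(2π|ξ|_∞)^j f̂‖_{L²}`. -/
def X (j : ℕ) (f : H) : ℝ≥0∞ := eLpNorm (fun ξ => ((zt ξ ^ j : ℝ) : ℂ) * ft f ξ) 2 volume

lemma X_sq (j : ℕ) (f : H) : X j f ^ 2 = ∫⁻ ξ, ENNReal.ofReal (zt ξ ^ (2 * j)) * ‖ft f ξ‖ₑ ^ 2 := by
  rw [X, eLpNorm_eq_lintegral_rpow_enorm_toReal (by norm_num) (by norm_num)]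
  rw [← ENNReal.rpow_natCast, ← ENNReal.rpow_mul]
  rw [show (1 / (2 : ℝ≥0∞).toReal * ((2 : ℕ) : ℝ)) = 1 by norm_num, ENNReal.rpow_one]
  refine lintegral_congr fun ξ => ?_
  rw [show (2 : ℝ≥0∞).toReal = ((2 : ℕ) : ℝ) by norm_num, ENNReal.rpow_natCast]
  rw [enorm_mul, mul_pow]
  congr 1
  rw [← ofReal_norm, Complex.norm_real,
    Real.norm_of_nonneg (pow_nonneg (zt_nonneg ξ) j),
    ← ENNReal.ofReal_pow (pow_nonneg (zt_nonneg ξ) j), ← pow_mul, mul_comm j 2]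

/-- A geometric series read downwards from the largest power of `5/4` below `z`. Its ratio is at
most `16/25` because `n ≥ 1`, and `1 / (1 - 16/25) = 25/9 ≤ 3`. -/
lemma tsum_zpow_lt_le (n : ℕ) (hn : 1 ≤ n) (z : ℝ) :
    ∑' m : ℤ, (if ((5 / 4 : ℝ) ^ m) < z then ENNReal.ofReal (((5 / 4 : ℝ) ^ m) ^ (2 * n)) else 0)
      ≤ 3 * ENNReal.ofReal (z ^ (2 * n)) := by
  rcases le_or_gt z 0 with hz | hz
  · have : ∀ m : ℤ, ¬ ((5 / 4 : ℝ) ^ m) < z := fun m =>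
      not_lt.2 (hz.trans (zpow_pos (by norm_num) m).le)
    simp [this]
  obtain ⟨m₀, h1, h2⟩ := exists_mem_Ioc_zpow hz (by norm_num : (1 : ℝ) < 5 / 4)
  have hinj : Function.Injective (fun k : ℕ => m₀ - (k : ℤ)) := fun a b h => by
    simpa using h
  rw [← hinj.tsum_eq]
  · calc ∑' k : ℕ, (if ((5 / 4 : ℝ) ^ (m₀ - (k : ℤ))) < z then
          ENNReal.ofReal (((5 / 4 : ℝ) ^ (m₀ - (k : ℤ))) ^ (2 * n)) else 0)
        ≤ ∑' k : ℕ, ENNReal.ofReal (z ^ (2 * n)) * (ENNReal.ofReal (16 / 25)) ^ k := by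
          refine ENNReal.tsum_le_tsum fun k => ?_
          split_ifs
          · rw [← ENNReal.ofReal_pow (by norm_num), ← ENNReal.ofReal_mul (by positivity)]
            refine ENNReal.ofReal_le_ofReal ?_
            have e1 : ((5 / 4 : ℝ) ^ (m₀ - (k : ℤ))) = (5 / 4 : ℝ) ^ m₀ * (4 / 5 : ℝ) ^ k := by
              rw [zpow_sub₀ (by norm_num), zpow_natCast, div_eq_mul_inv, ← inv_pow]
              norm_num
            rw [e1, mul_pow]
            refine mul_le_mul (pow_le_pow_left₀ (by positivity) h1.le _) ?_ (by positivity)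
              (by positivity)
            rw [← pow_mul, show (16 / 25 : ℝ) = (4 / 5) ^ 2 by norm_num, ← pow_mul]
            exact pow_le_pow_of_le_one (by norm_num) (by norm_num) (by nlinarith)
          · exact zero_le
      _ ≤ _ := by
          rw [ENNReal.tsum_mul_left, ENNReal.tsum_geometric, mul_comm]
          refine mul_le_mul_left ?_ _
          rw [← ENNReal.ofReal_one, ← ENNReal.ofReal_sub _ (by norm_num),
            ← ENNReal.ofReal_inv_of_pos (by norm_num), show (3 : ℝ≥0∞) = ENNReal.ofReal 3 by simp]
          exact ENNReal.ofReal_le_ofReal (by norm_num)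
  · intro m hm
    rw [Function.mem_support] at hm
    have h3 : ((5 / 4 : ℝ) ^ m) < z := by
      by_contra hcon
      exact hm (if_neg hcon)
    have h4 : m < m₀ + 1 := by
      rw [← zpow_lt_zpow_iff_right₀ (by norm_num : (1 : ℝ) < 5 / 4)]
      exact h3.trans_le h2
    refine ⟨(m₀ - m).toNat, ?_⟩
    simp only
    omega

/-- Pointwise interpolation: at each frequency a function splits into a bounded low-frequency part
and a high-frequency part controlled by a square function. -/
lemma exists_square_function {f Ω : H} {i n : ℕ} (hn : 1 ≤ n)
    (hf : ∀ᵐ ξ, ‖ft f ξ‖ ≤ zt ξ ^ i * ‖ft Ω ξ‖) {D : ℝ}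
    (hlow : ∀ μ : ℝ, 0 < μ → Bdd (D * (5 / 4 * μ) ^ i) (lowPass μ f)) :
    ∃ S : Plane → ℝ≥0∞, AEMeasurable S volume ∧ ∫⁻ x, S x ^ 2 ≤ 3 * X (i + n) Ω ^ 2 ∧
      ∀ᵐ x, ∀ m : ℤ, ‖f x‖ₑ * ENNReal.ofReal (((5 / 4 : ℝ) ^ m) ^ n) ≤
        ENNReal.ofReal (D * (5 / 4 * (5 / 4 : ℝ) ^ m) ^ i * ((5 / 4 : ℝ) ^ m) ^ n) + S x := by
  let μ : ℤ → ℝ := fun m => (5 / 4 : ℝ) ^ m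
  have hμ : ∀ m, 0 < μ m := fun m => zpow_pos (by norm_num) m
  let r : ℤ → H := fun m => f - lowPass (μ m) f
  -- The square of the square function. Summing over all scales yields one `L²` function that
  -- controls every remainder `r m` at once, so that the scale may later depend on the point.
  let T : Plane → ℝ≥0∞ := fun x => ∑' m : ℤ, ENNReal.ofReal (μ m ^ (2 * n)) * ‖r m x‖ₑ ^ 2
  have hmeas : ∀ m, AEMeasurable (fun x => ENNReal.ofReal (μ m ^ (2 * n)) * ‖r m x‖ₑ ^ 2) volume :=
    fun m => ((Lp.aestronglyMeasurable (r m)).enorm.pow_const _).const_mul _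
  have hTm : AEMeasurable T volume := AEMeasurable.tsum hmeas
  have hsq : ∀ x, (T x ^ (1 / 2 : ℝ)) ^ 2 = T x := fun x => by
    rw [← ENNReal.rpow_natCast, ← ENNReal.rpow_mul]; norm_num
  refine ⟨fun x => T x ^ (1 / 2 : ℝ), hTm.pow_const _, ?_, ?_⟩
  · simp only [hsq, T]
    rw [lintegral_tsum hmeas, X_sq]
    have h1 : ∀ m, ∫⁻ x, ENNReal.ofReal (μ m ^ (2 * n)) * ‖r m x‖ₑ ^ 2
        = ∫⁻ ξ, ENNReal.ofReal (μ m ^ (2 * n)) * ‖ft (r m) ξ‖ₑ ^ 2 := fun m => by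
      rw [lintegral_const_mul' _ _ ENNReal.ofReal_ne_top,
        lintegral_const_mul' _ _ ENNReal.ofReal_ne_top, lintegral_sq_enorm_ft]
    simp only [h1]
    have hmeas' : ∀ m, AEMeasurable
        (fun ξ => ENNReal.ofReal (μ m ^ (2 * n)) * ‖ft (r m) ξ‖ₑ ^ 2) volume :=
      fun m => ((Lp.aestronglyMeasurable (ft (r m))).enorm.pow_const _).const_mul _
    rw [← lintegral_tsum hmeas', ← lintegral_const_mul' _ _ (by norm_num)]
    refine lintegral_mono_ae ?_
    have hr : ∀ m, ∀ᵐ ξ, ft (r m) ξ = (1 - filt (μ m) ξ) * ft f ξ := fun m => by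
      simp only [r, ft_sub]
      filter_upwards [Lp.coeFn_sub (ft f) (ft (lowPass (μ m) f)), ft_lowPass (μ m) f] with ξ h2 h3
      rw [h2, Pi.sub_apply, h3]
      ring
    filter_upwards [ae_all_iff.2 hr, hf] with ξ h2 h3
    -- The filter is `1` where `zt ξ ≤ μ m`, so only scales below `zt ξ` contribute, and the sum
    -- over them is geometric.
    have h4 : ∀ m, ENNReal.ofReal (μ m ^ (2 * n)) * ‖ft (r m) ξ‖ₑ ^ 2 ≤
        (if μ m < zt ξ then ENNReal.ofReal (μ m ^ (2 * n)) else 0) *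
          (ENNReal.ofReal (zt ξ ^ (2 * i)) * ‖ft Ω ξ‖ₑ ^ 2) := fun m => by
      rw [h2]
      split_ifs with hm
      · refine mul_le_mul_right ?_ _
        have h5 : ‖(1 - filt (μ m) ξ) * ft f ξ‖ ≤ zt ξ ^ i * ‖ft Ω ξ‖ := by
          rw [norm_mul]
          exact (mul_le_of_le_one_left (norm_nonneg _) (norm_one_sub_filt_le _ _)).trans h3
        rw [← ofReal_norm, ← ofReal_norm, ← ENNReal.ofReal_pow (norm_nonneg _),
          ← ENNReal.ofReal_pow (norm_nonneg _), ← ENNReal.ofReal_mul (by have := zt_nonneg ξ; positivity)]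
        refine ENNReal.ofReal_le_ofReal ((pow_le_pow_left₀ (norm_nonneg _) h5 2).trans (le_of_eq ?_))
        ring
      · rw [filt_eq_one (hμ m) (not_lt.1 hm)]
        simp
    refine (ENNReal.tsum_le_tsum h4).trans ?_
    rw [ENNReal.tsum_mul_right]
    refine (mul_le_mul_left (tsum_zpow_lt_le n hn (zt ξ)) _).trans (le_of_eq ?_)
    rw [mul_assoc, ← mul_assoc (ENNReal.ofReal _) (ENNReal.ofReal _),
      ← ENNReal.ofReal_mul (by have := zt_nonneg ξ; positivity), ← pow_add]
    congr 4
    ring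
  · have hb : ∀ᵐ x, ∀ m, ‖lowPass (μ m) f x‖ ≤ D * (5 / 4 * μ m) ^ i :=
      ae_all_iff.2 fun m => hlow (μ m) (hμ m)
    have hs : ∀ᵐ x, ∀ m, r m x = f x - lowPass (μ m) f x :=
      ae_all_iff.2 fun m => Lp.coeFn_sub f (lowPass (μ m) f)
    filter_upwards [hb, hs] with x h1 h2 m
    have h3 : ‖f x‖ₑ ≤ ENNReal.ofReal (D * (5 / 4 * μ m) ^ i) + ‖r m x‖ₑ := by
      have e : f x = lowPass (μ m) f x + r m x := by rw [h2]; ring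
      rw [e]
      refine (enorm_add_le _ _).trans (add_le_add_left ?_ _)
      rw [← ofReal_norm]
      exact ENNReal.ofReal_le_ofReal (h1 m)
    have h4 : ‖r m x‖ₑ * ENNReal.ofReal (μ m ^ n) ≤ T x ^ (1 / 2 : ℝ) := by
      have h5 : (‖r m x‖ₑ * ENNReal.ofReal (μ m ^ n)) ^ 2 ≤ T x := by
        refine le_trans (le_of_eq ?_) (ENNReal.le_tsum m)
        rw [mul_pow, ← ENNReal.ofReal_pow (pow_pos (hμ m) n).le, ← pow_mul, mul_comm n 2, mul_comm]
      calc ‖r m x‖ₑ * ENNReal.ofReal (μ m ^ n)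
          = ((‖r m x‖ₑ * ENNReal.ofReal (μ m ^ n)) ^ 2) ^ (1 / 2 : ℝ) := by
            rw [← ENNReal.rpow_natCast, ← ENNReal.rpow_mul]; norm_num
        _ ≤ _ := ENNReal.rpow_le_rpow h5 (by norm_num)
    calc ‖f x‖ₑ * ENNReal.ofReal (μ m ^ n)
        ≤ (ENNReal.ofReal (D * (5 / 4 * μ m) ^ i) + ‖r m x‖ₑ) * ENNReal.ofReal (μ m ^ n) :=
          mul_le_mul_left h3 _
      _ ≤ _ := by
          rw [add_mul, ← ENNReal.ofReal_mul' (pow_pos (hμ m) n).le]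
          exact add_le_add_right h4 _

/-- Take the power of `5/4` just below `s`. At that scale the low-frequency bound and the remainder
are both at most `(5/4)^(i+n) D s^i` after division by the weight, whence the factor `2`. -/
lemma le_of_forall_scale {a D S s : ℝ} {i n : ℕ} (hs : 0 < s) (hD : 0 ≤ D)
    (hS : S ≤ D * s ^ (i + n))
    (h : ∀ m : ℤ, a * ((5 / 4 : ℝ) ^ m) ^ n ≤
      D * (5 / 4 * (5 / 4 : ℝ) ^ m) ^ i * ((5 / 4 : ℝ) ^ m) ^ n + S) :
    a ≤ 2 * (5 / 4) ^ (i + n) * D * s ^ i := by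
  obtain ⟨m, h1, h2⟩ := exists_mem_Ico_zpow hs (by norm_num : (1 : ℝ) < 5 / 4)
  have hm := h m
  set μ : ℝ := (5 / 4 : ℝ) ^ m with hμd
  have hμ : 0 < μ := zpow_pos (by norm_num) m
  rw [zpow_add_one₀ (by norm_num)] at h2
  have hq1 : (1 : ℝ) ≤ (5 / 4) ^ i := one_le_pow₀ (by norm_num)
  have hq2 : (1 : ℝ) ≤ (5 / 4) ^ n := one_le_pow₀ (by norm_num)
  have h3 : s ^ n ≤ (5 / 4) ^ n * μ ^ n := by
    rw [← mul_pow]; exact pow_le_pow_left₀ hs.le (by linarith) n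
  have h4 : μ ^ i ≤ s ^ i := pow_le_pow_left₀ hμ.le h1 i
  have hsi : 0 < s ^ i := pow_pos hs i
  have hμn : 0 < μ ^ n := pow_pos hμ n
  refine le_of_mul_le_mul_right (hm.trans ?_) hμn
  have h5 : S ≤ D * s ^ i * (5 / 4) ^ (i + n) * μ ^ n := by
    calc S ≤ D * s ^ i * s ^ n := by rw [mul_assoc, ← pow_add]; exact hS
      _ ≤ D * s ^ i * ((5 / 4) ^ n * μ ^ n) := by gcongr
      _ ≤ D * s ^ i * ((5 / 4) ^ (i + n) * μ ^ n) := by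
          have : ((5 / 4 : ℝ)) ^ n ≤ (5 / 4) ^ (i + n) :=
            pow_le_pow_right₀ (by norm_num) (by omega)
          gcongr
      _ = _ := by ring
  have h6 : D * (5 / 4 * μ) ^ i * μ ^ n ≤ D * s ^ i * (5 / 4) ^ (i + n) * μ ^ n := by
    have : ((5 / 4 : ℝ)) ^ i ≤ (5 / 4) ^ (i + n) :=
      pow_le_pow_right₀ (by norm_num) (by omega)
    calc D * (5 / 4 * μ) ^ i * μ ^ n = D * ((5 / 4) ^ i * μ ^ i) * μ ^ n := by rw [mul_pow]
      _ ≤ D * ((5 / 4) ^ (i + n) * s ^ i) * μ ^ n := by gcongr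
      _ = _ := by ring
  linarith

/-- The product estimate behind the bilinear interpolation inequality, pointwise. -/
lemma mul_le_of_forall_scale {a b D S₁ S₂ : ℝ} {i n : ℕ} (hi : 1 ≤ i) (hD : 0 < D)
    (ha0 : 0 ≤ a) (hS₁ : 0 ≤ S₁) (hS₂ : 0 ≤ S₂)
    (ha : ∀ m : ℤ, a * ((5 / 4 : ℝ) ^ m) ^ n ≤
      D * (5 / 4 * (5 / 4 : ℝ) ^ m) ^ i * ((5 / 4 : ℝ) ^ m) ^ n + S₁)
    (hb : ∀ m : ℤ, b * ((5 / 4 : ℝ) ^ m) ^ i ≤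
      D * (5 / 4 * (5 / 4 : ℝ) ^ m) ^ n * ((5 / 4 : ℝ) ^ m) ^ i + S₂) :
    a * b ≤ 4 * (25 / 16) ^ (i + n) * D * (S₁ + S₂) := by
  -- The `ε` keeps the optimal scales positive when `S₁` or `S₂` vanishes.
  have key : ∀ ε > 0, a * b ≤ 4 * (25 / 16) ^ (i + n) * D * (S₁ + S₂ + 2 * ε) := fun ε hε => by
    have hj : i + n ≠ 0 := by omega
    -- `s` and `t` balance low against high frequencies: `D s^(i+n) = S₁ + ε` and `D t^(i+n) = S₂ +
    -- ε`. Then `a` is of size `D s^i` and `b` of size `D t^n`, and `s^i t^n` is at most the sum of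
    -- the two powers of order `i + n`.
    let s : ℝ := ((S₁ + ε) / D) ^ (((i + n : ℕ) : ℝ)⁻¹)
    let t : ℝ := ((S₂ + ε) / D) ^ (((i + n : ℕ) : ℝ)⁻¹)
    have hs : 0 < s := by positivity
    have ht : 0 < t := by positivity
    have hs1 : D * s ^ (i + n) = S₁ + ε := by
      rw [Real.rpow_inv_natCast_pow (by positivity) hj]; field_simp
    have ht1 : D * t ^ (i + n) = S₂ + ε := by
      rw [Real.rpow_inv_natCast_pow (by positivity) hj]; field_simp
    have h1 := le_of_forall_scale hs hD.le (by rw [hs1]; linarith) ha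
    have h2 := le_of_forall_scale (i := n) (n := i) ht hD.le (by rw [add_comm n i, ht1]; linarith) hb
    have h3 : s ^ i * t ^ n ≤ s ^ (i + n) + t ^ (i + n) := by
      rcases le_total s t with h | h
      · calc s ^ i * t ^ n ≤ t ^ i * t ^ n := by gcongr
          _ = t ^ (i + n) := (pow_add _ _ _).symm
          _ ≤ _ := by linarith [pow_pos hs (i + n)]
      · calc s ^ i * t ^ n ≤ s ^ i * s ^ n := by gcongr
          _ = s ^ (i + n) := (pow_add _ _ _).symm
          _ ≤ _ := by linarith [pow_pos ht (i + n)]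
    calc a * b ≤ a * (2 * (5 / 4) ^ (n + i) * D * t ^ n) := by gcongr
      _ ≤ (2 * (5 / 4) ^ (i + n) * D * s ^ i) * (2 * (5 / 4) ^ (n + i) * D * t ^ n) := by gcongr
      _ = 4 * ((5 / 4) ^ (i + n) * (5 / 4) ^ (i + n)) * D * (D * (s ^ i * t ^ n)) := by
          rw [add_comm n i]; ring
      _ ≤ 4 * ((5 / 4) ^ (i + n) * (5 / 4) ^ (i + n)) * D * (D * (s ^ (i + n) + t ^ (i + n))) := by
          gcongr
      _ = _ := by
          rw [← mul_pow, mul_add D, hs1, ht1]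
          norm_num
          left
          ring
  have hlim : Tendsto (fun ε : ℝ => 4 * (25 / 16) ^ (i + n) * D * (S₁ + S₂ + 2 * ε)) (𝓝[>] 0)
      (𝓝 (4 * (25 / 16) ^ (i + n) * D * (S₁ + S₂ + 2 * 0))) := by
    refine Tendsto.mono_left (Continuous.tendsto ?_ 0) nhdsWithin_le_nhds
    fun_prop
  rw [mul_zero, add_zero] at hlim
  exact ge_of_tendsto hlim (eventually_mem_nhdsWithin.mono fun ε hε => key ε hε)

/-- Bilinear interpolation: `‖f g‖_{L²} ≤ C D ‖Ω‖` where `f`, `g` behave like derivatives of `Ω` of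
orders `i` and `n` in frequency, and like derivatives of bounded functions at low frequency. -/
lemma eLpNorm_mul_le {f g Ω : H} {i n : ℕ} (hi : 1 ≤ i) (hn : 1 ≤ n) {D : ℝ} (hD : 0 < D)
    (hf : ∀ᵐ ξ, ‖ft f ξ‖ ≤ zt ξ ^ i * ‖ft Ω ξ‖) (hg : ∀ᵐ ξ, ‖ft g ξ‖ ≤ zt ξ ^ n * ‖ft Ω ξ‖)
    (hlf : ∀ μ : ℝ, 0 < μ → Bdd (D * (5 / 4 * μ) ^ i) (lowPass μ f))
    (hlg : ∀ μ : ℝ, 0 < μ → Bdd (D * (5 / 4 * μ) ^ n) (lowPass μ g)) :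
    eLpNorm (fun x => f x * g x) 2 volume ≤
      ENNReal.ofReal (16 * (25 / 16) ^ (i + n) * D) * X (i + n) Ω := by
  by_cases hX : X (i + n) Ω = ∞
  · rw [hX, ENNReal.mul_top (by simp; positivity)]
    exact le_top
  obtain ⟨S₁, hm₁, hS₁, h₁⟩ := exists_square_function hn hf hlf
  obtain ⟨S₂, hm₂, hS₂, h₂⟩ := exists_square_function hi hg hlg
  rw [add_comm n i] at hS₂
  have hfin : 3 * X (i + n) Ω ^ 2 ≠ ∞ :=
    ENNReal.mul_ne_top (by norm_num) (ENNReal.pow_ne_top hX)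
  have hlt : ∀ {S : Plane → ℝ≥0∞}, AEMeasurable S volume → ∫⁻ x, S x ^ 2 ≤ 3 * X (i + n) Ω ^ 2 →
      ∀ᵐ x, S x < ∞ := fun {S} hm hS => by
    filter_upwards [ae_lt_top' (hm.pow_const 2) (ne_top_of_le_ne_top hfin hS)] with x hx
    by_contra hcon
    rw [not_lt, top_le_iff] at hcon
    simp [hcon] at hx
  obtain ⟨c, hc⟩ : ∃ c : ℝ, c = 4 * (25 / 16) ^ (i + n) * D := ⟨_, rfl⟩
  have hc0 : 0 < c := by rw [hc]; positivity
  have hpt : ∀ᵐ x, ‖f x * g x‖ₑ ^ 2 ≤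
      ENNReal.ofReal (c ^ 2 * 2) * (S₁ x ^ 2 + S₂ x ^ 2) := by
    filter_upwards [h₁, h₂, hlt hm₁ hS₁, hlt hm₂ hS₂] with x k₁ k₂ l₁ l₂
    have conv : ∀ {u : ℂ} {S : ℝ≥0∞} {p q : ℝ}, 0 ≤ p → 0 ≤ q → S < ∞ →
        ‖u‖ₑ * ENNReal.ofReal p ≤ ENNReal.ofReal q + S → ‖u‖ * p ≤ q + S.toReal := by
      intro u S p q hp hq hS h
      rw [← ofReal_norm, ← ENNReal.ofReal_mul (norm_nonneg _), ← ENNReal.ofReal_toReal hS.ne,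
        ← ENNReal.ofReal_add hq ENNReal.toReal_nonneg, ENNReal.ofReal_le_ofReal_iff
          (add_nonneg hq ENNReal.toReal_nonneg)] at h
      exact h
    have key := mul_le_of_forall_scale (n := n) hi hD (norm_nonneg (f x))
      (ENNReal.toReal_nonneg (a := S₁ x)) (ENNReal.toReal_nonneg (a := S₂ x))
      (fun m => conv (by positivity) (by positivity) l₁ (k₁ m))
      (fun m => conv (by positivity) (by positivity) l₂ (k₂ m))
    rw [← hc, ← norm_mul] at key
    rw [← ENNReal.ofReal_toReal l₁.ne, ← ENNReal.ofReal_toReal l₂.ne, ← ofReal_norm,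
      ← ENNReal.ofReal_pow (norm_nonneg _), ← ENNReal.ofReal_pow ENNReal.toReal_nonneg,
      ← ENNReal.ofReal_pow ENNReal.toReal_nonneg, ← ENNReal.ofReal_add (by positivity)
        (by positivity), ← ENNReal.ofReal_mul (by positivity)]
    refine ENNReal.ofReal_le_ofReal ((pow_le_pow_left₀ (norm_nonneg _) key 2).trans ?_)
    rw [mul_pow, mul_assoc]
    refine mul_le_mul_of_nonneg_left ?_ (by positivity)
    nlinarith [sq_nonneg ((S₁ x).toReal - (S₂ x).toReal)]
  have hint : eLpNorm (fun x => f x * g x) 2 volume ^ 2 ≤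
      (ENNReal.ofReal (16 * (25 / 16) ^ (i + n) * D) * X (i + n) Ω) ^ 2 := by
    rw [eLpNorm_eq_lintegral_rpow_enorm_toReal (by norm_num) (by norm_num),
      ← ENNReal.rpow_natCast, ← ENNReal.rpow_mul,
      show (1 / (2 : ℝ≥0∞).toReal * ((2 : ℕ) : ℝ)) = 1 by norm_num, ENNReal.rpow_one,
      show (2 : ℝ≥0∞).toReal = ((2 : ℕ) : ℝ) by norm_num]
    simp only [ENNReal.rpow_natCast]
    calc ∫⁻ x, ‖f x * g x‖ₑ ^ 2
        ≤ ∫⁻ x, ENNReal.ofReal (c ^ 2 * 2) * (S₁ x ^ 2 + S₂ x ^ 2) := lintegral_mono_ae hpt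
      _ = ENNReal.ofReal (c ^ 2 * 2) * ((∫⁻ x, S₁ x ^ 2) + ∫⁻ x, S₂ x ^ 2) := by
          rw [lintegral_const_mul' _ _ ENNReal.ofReal_ne_top,
            lintegral_add_left' (hm₁.pow_const 2)]
      _ ≤ ENNReal.ofReal (c ^ 2 * 2) * (3 * X (i + n) Ω ^ 2 + 3 * X (i + n) Ω ^ 2) := by gcongr
      _ = ENNReal.ofReal (c ^ 2 * 2) * ENNReal.ofReal 6 * X (i + n) Ω ^ 2 := by
          rw [← add_mul, mul_assoc]
          norm_num
      _ ≤ _ := by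
          rw [mul_pow, ← ENNReal.ofReal_mul (by positivity), ← ENNReal.ofReal_pow (by positivity)]
          refine mul_le_mul_left (ENNReal.ofReal_le_ofReal ?_) _
          -- The accumulated factor `2 * 6 = 12` is rounded up to `16 = 4²`.
          rw [show 16 * (25 / 16 : ℝ) ^ (i + n) * D = 4 * c by rw [hc]; ring]
          nlinarith [sq_nonneg c]
  exact (ENNReal.pow_le_pow_left_iff two_ne_zero).1 hint

/-! ### Words of difference quotients and shifts. -/

/-- Letters: `(true, e)` is a difference quotient, `(false, e)` a shift, in direction `e`. -/
abbrev Word : Type := List (Bool × Fin 2)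

/-- The number of difference quotients in a word. -/
def deg (w : Word) : ℕ := w.countP (·.1)

/-- The word of difference quotients in the given directions. -/
def diffs (w : List (Fin 2)) : Word := w.map (true, ·)

/-- The word of shifts in the given directions. -/
def shifts (w : List (Fin 2)) : Word := w.map (false, ·)

@[simp] lemma deg_nil : deg [] = 0 := rfl

@[simp] lemma deg_true (e : Fin 2) (w : Word) : deg ((true, e) :: w) = deg w + 1 := by
  simp [deg]

@[simp] lemma deg_false (e : Fin 2) (w : Word) : deg ((false, e) :: w) = deg w := by
  simp [deg]

@[simp] lemma deg_append (v w : Word) : deg (v ++ w) = deg v + deg w := by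
  simp [deg]

@[simp] lemma deg_diffs (w : List (Fin 2)) : deg (diffs w) = w.length := by
  induction w with
  | nil => rfl
  | cons e w ih => rw [diffs, List.map_cons, deg_true, List.length_cons]; congr 1

@[simp] lemma deg_shifts (w : List (Fin 2)) : deg (shifts w) = 0 := by
  induction w with
  | nil => rfl
  | cons e w ih => rw [shifts, List.map_cons, deg_false]; exact ih

lemma diffs_cons (e : Fin 2) (w : List (Fin 2)) : diffs (e :: w) = (true, e) :: diffs w := rfl

lemma shifts_cons (e : Fin 2) (w : List (Fin 2)) : shifts (e :: w) = (false, e) :: shifts w := rfl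

/-- The operator of a letter on `L²`. -/
def lop (h : ℝ) : Bool × Fin 2 → H →L[ℂ] H
  | (true, e) => dq h e
  | (false, e) => (tr (h • ev e)).toContinuousLinearMap

/-- The operator of a word on `L²`; the first letter acts first. -/
def wop (h : ℝ) : Word → H →L[ℂ] H
  | [] => ContinuousLinearMap.id ℂ H
  | l :: w => (wop h w).comp (lop h l)

lemma wop_nil (h : ℝ) (f : H) : wop h [] f = f := rfl

lemma wop_cons (h : ℝ) (l : Bool × Fin 2) (w : Word) (f : H) :
    wop h (l :: w) f = wop h w (lop h l f) := rfl

/-- The symbol of a letter. -/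
def lsym (h : ℝ) : Bool × Fin 2 → Plane → ℂ
  | (true, e) => dsym h e
  | (false, e) => chr (h • ev e)

/-- The symbol of a word. -/
def wsym (h : ℝ) : Word → Plane → ℂ
  | [] => fun _ => 1
  | l :: w => fun ξ => wsym h w ξ * lsym h l ξ

lemma ft_lop (h : ℝ) (l : Bool × Fin 2) (f : H) :
    ft (lop h l f) =ᵐ[volume] fun ξ => lsym h l ξ * ft f ξ := by
  obtain ⟨_ | _, e⟩ := l
  · exact ft_tr _ _
  · exact ft_dq _ _ _

lemma ft_wop (h : ℝ) (w : Word) (f : H) :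
    ft (wop h w f) =ᵐ[volume] fun ξ => wsym h w ξ * ft f ξ := by
  induction w generalizing f with
  | nil => exact Eventually.of_forall fun ξ => by simp [wop_nil, wsym]
  | cons l w ih =>
    rw [wop_cons]
    filter_upwards [ih (lop h l f), ft_lop h l f] with ξ h1 h2
    rw [h1, h2, wsym, mul_assoc]

lemma norm_wsym_le (h : ℝ) (w : Word) (ξ : Plane) : ‖wsym h w ξ‖ ≤ zt ξ ^ deg w := by
  induction w with
  | nil => simp [wsym]
  | cons l w ih =>
    obtain ⟨_ | _, e⟩ := l
    · simpa [wsym, lsym, norm_chr] using ih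
    · simp only [wsym, lsym, norm_mul, deg_true, pow_succ]
      exact mul_le_mul ih (norm_dsym_le_zt h e ξ) (norm_nonneg _) (pow_nonneg (zt_nonneg ξ) _)

lemma norm_ft_wop_le (h : ℝ) (w : Word) (f : H) :
    ∀ᵐ ξ, ‖ft (wop h w f) ξ‖ ≤ zt ξ ^ deg w * ‖ft f ξ‖ := by
  filter_upwards [ft_wop h w f] with ξ h1
  rw [h1, norm_mul]
  exact mul_le_mul_of_nonneg_right (norm_wsym_le h w ξ) (norm_nonneg _)

lemma lowPass_wop (h μ : ℝ) (w : Word) (f : H) : lowPass μ (wop h w f) = wop h w (lowPass μ f) := by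
  refine eq_of_ft_ae_eq ?_
  filter_upwards [ft_lowPass μ (wop h w f), ft_wop h w f, ft_wop h w (lowPass μ f),
    ft_lowPass μ f] with ξ h1 h2 h3 h4
  rw [h1, h2, h3, h4]
  ring

lemma lop_comm (h : ℝ) (l l' : Bool × Fin 2) (f : H) :
    lop h l (lop h l' f) = lop h l' (lop h l f) := by
  refine eq_of_ft_ae_eq ?_
  filter_upwards [ft_lop h l (lop h l' f), ft_lop h l' f, ft_lop h l' (lop h l f),
    ft_lop h l f] with ξ h1 h2 h3 h4
  rw [h1, h2, h3, h4]
  ring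

lemma BandLim.wop {M h : ℝ} {f : H} (hf : BandLim M f) (w : Word) : BandLim M (wop h w f) := by
  filter_upwards [hf, ft_wop h w f] with ξ h1 h2 h3
  rw [h2, h1 h3, mul_zero]

lemma bandLim_lowPass {μ : ℝ} (hμ : 0 < μ) (f : H) : BandLim (5 / 4 * μ) (lowPass μ f) := by
  filter_upwards [ft_lowPass μ f] with ξ h1 h2
  rw [h1, filt_eq_zero hμ h2.le, zero_mul]

lemma continuous_psym (e : Fin 2) : Continuous (psym e) := by unfold psym; fun_prop

lemma BandLim.exists_isPd {M : ℝ} {f : H} (hf : BandLim M f) (e : Fin 2) : ∃ g, IsPd e f g := by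
  refine ⟨mulOp (psym e) f, ft_mulOp ?_⟩
  refine MemLp.of_le_mul (c := M) (Lp.memLp (ft f))
    ((continuous_psym e).aestronglyMeasurable.mul (Lp.aestronglyMeasurable _)) ?_
  filter_upwards [hf] with ξ h1
  by_cases h2 : M < zt ξ
  · simp [h1 h2]
  · rw [norm_mul]
    exact mul_le_mul_of_nonneg_right ((norm_psym_le_zt e ξ).trans (not_lt.1 h2)) (norm_nonneg _)

lemma Bdd.dq_of_bandLim {M : ℝ} (hM : 0 < M) {f : H} (hf : BandLim M f) {F : ℝ} (hF : Bdd F f)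
    (h : ℝ) (e : Fin 2) : Bdd (M * F) (dq h e f) := by
  obtain ⟨g, hg⟩ := hf.exists_isPd e
  exact Bdd.dq_of_isPd hg (Bdd.of_bandLim hM hf hg hF) h

/-- Every difference quotient costs a factor `M` by Bernstein's inequality and preserves the band
limit; a shift costs nothing. -/
lemma Bdd.wop_of_bandLim {M : ℝ} (hM : 0 < M) (h : ℝ) (w : Word) {f : H} (hf : BandLim M f)
    {F : ℝ} (hF : Bdd F f) : Bdd (M ^ deg w * F) (wop h w f) := by
  induction w generalizing f F with
  | nil => simpa [wop_nil] using hF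
  | cons l w ih =>
    obtain ⟨_ | e', e⟩ := l
    · rw [wop_cons, deg_false]
      exact ih (BandLim.wop hf [(false, e)]) (hF.translate _)
    · rw [wop_cons, deg_true, pow_succ, mul_assoc]
      exact ih (BandLim.wop hf [(true, e)]) (hF.dq_of_bandLim hM hf h e)

/-- For the velocity, where only first derivatives are controlled in `L^∞`: the first difference
quotient in the word is spent on the hypothesis, after commuting it past the shifts, and only the
other `i` cost a factor `M`. -/
lemma Bdd.wop_succ_of_bandLim {M : ℝ} (hM : 0 < M) (h : ℝ) {i : ℕ} (w : Word)
    (hw : deg w = i + 1) {f : H} (hf : BandLim M f) {F : ℝ} (hF : ∀ e, Bdd F (dq h e f)) :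
    Bdd (M ^ i * F) (wop h w f) := by
  induction w generalizing f with
  | nil => simp at hw
  | cons l w ih =>
    obtain ⟨_ | e', e⟩ := l
    · rw [wop_cons]
      refine ih (by simpa using hw) (BandLim.wop hf [(false, e)]) fun e' => ?_
      have := lop_comm h (true, e') (false, e) f
      change Bdd F (lop h (true, e') (lop h (false, e) f))
      rw [this]
      exact (hF e').translate _
    · rw [wop_cons]
      have hd : deg w = i := by simpa using hw
      rw [← hd]
      exact Bdd.wop_of_bandLim hM h w (BandLim.wop hf [(true, e)]) (hF e)

lemma Bdd.wop_of_deg_eq_zero (h : ℝ) (w : Word) (hw : deg w = 0) {f : H} {F : ℝ} (hF : Bdd F f) :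
    Bdd F (wop h w f) := by
  induction w generalizing f with
  | nil => exact hF
  | cons l w ih =>
    obtain ⟨_ | e', e⟩ := l
    · exact ih (by simpa using hw) (hF.translate _)
    · simp at hw

lemma Bdd.wop_of_deg_eq_one (h : ℝ) (w : Word) (hw : deg w = 1) {f : H} {F : ℝ}
    (hF : ∀ e, Bdd F (dq h e f)) : Bdd F (wop h w f) := by
  induction w generalizing f with
  | nil => simp at hw
  | cons l w ih =>
    obtain ⟨_ | e', e⟩ := l
    · rw [wop_cons]
      refine ih (by simpa using hw) fun e' => ?_
      have := lop_comm h (true, e') (false, e) f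
      change Bdd F (lop h (true, e') (lop h (false, e) f))
      rw [this]
      exact (hF e').translate _
    · exact Bdd.wop_of_deg_eq_zero h w (by simpa using hw) (hF e)

lemma eLpNorm_bdd_mul_le {f g : Plane → ℂ} {A : ℝ} (hf : Bdd A f) :
    eLpNorm (fun x => f x * g x) 2 volume ≤ ENNReal.ofReal A * eLpNorm g 2 volume := by
  refine eLpNorm_le_mul_eLpNorm_of_ae_le_mul ?_ 2
  filter_upwards [hf] with x hx
  rw [norm_mul]
  exact mul_le_mul_of_nonneg_right hx (norm_nonneg _)

lemma eLpNorm_ft (f : H) : eLpNorm (ft f) 2 volume = eLpNorm f 2 volume := by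
  have := enorm_eq_iff_norm_eq.2 (norm_ft f)
  rwa [Lp.enorm_def, Lp.enorm_def] at this

lemma eLpNorm_le_X {f Ω : H} {j : ℕ} (hf : ∀ᵐ ξ, ‖ft f ξ‖ ≤ zt ξ ^ j * ‖ft Ω ξ‖) :
    eLpNorm f 2 volume ≤ X j Ω := by
  rw [← eLpNorm_ft]
  refine eLpNorm_mono_ae ?_
  filter_upwards [hf] with ξ h
  rwa [norm_mul, Complex.norm_real, Real.norm_of_nonneg (pow_nonneg (zt_nonneg ξ) j)]

/-! ### Bounds for the terms of the commutator. -/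

/-- The constant of the uniform `L^∞` bound for the low-pass filters. -/
def C₀ : ℝ := exists_bdd_lowPass.choose

lemma one_le_C₀ : 1 ≤ C₀ := exists_bdd_lowPass.choose_spec.1

lemma Bdd.lowPass {μ : ℝ} (hμ : 0 < μ) {f : H} {F : ℝ} (hF : Bdd F f) :
    Bdd (C₀ * F) (lowPass μ f) := exists_bdd_lowPass.choose_spec.2 μ hμ f F hF

lemma IsPd.lowPass {e : Fin 2} {f g : H} (h : IsPd e f g) (μ : ℝ) :
    IsPd e (lowPass μ f) (lowPass μ g) := by
  unfold IsPd at *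
  filter_upwards [ft_lowPass μ f, ft_lowPass μ g, h] with ξ h1 h2 h3
  rw [h1, h2, h3]
  ring

lemma IsPd.wop {e : Fin 2} {f g : H} (hfg : IsPd e f g) (h : ℝ) (w : Word) :
    IsPd e (wop h w f) (wop h w g) := by
  unfold IsPd at *
  filter_upwards [ft_wop h w f, ft_wop h w g, hfg] with ξ h1 h2 h3
  rw [h1, h2, h3]
  ring

/-- Estimate for one term of the commutator. -/
lemma eLpNorm_commutator_term_le {Ω U G : H} {e : Fin 2} {A h : ℝ} (hA : 0 < A)
    (hU : ∀ᵐ ξ, zt ξ * ‖ft U ξ‖ ≤ ‖ft Ω ξ‖) (hUA : ∀ e, Bdd A (dq h e U)) (hΩ : Bdd A Ω)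
    (hG : IsPd e Ω G) (O : Word) (b : List (Fin 2)) (hO : 1 ≤ deg O) :
    eLpNorm (fun x => wop h O U x * wop h (diffs b) G x) 2 volume ≤
      ENNReal.ofReal (16 * (25 / 16) ^ (deg O + b.length) * (C₀ * A)) * X (deg O + b.length) Ω := by
  -- `U` is one order smoother than `Ω` and `G` one order rougher. Measured against `Ω`, the two
  -- factors have orders `i = deg O - 1` and `b.length + 1`, with unchanged total.
  obtain ⟨i, hi⟩ : ∃ i, deg O = i + 1 := ⟨deg O - 1, by omega⟩
  have hj : deg O + b.length = i + (b.length + 1) := by omega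
  rw [hj]
  have hC := one_le_C₀
  have hg : ∀ᵐ ξ, ‖ft (wop h (diffs b) G) ξ‖ ≤ zt ξ ^ (b.length + 1) * ‖ft Ω ξ‖ := by
    filter_upwards [norm_ft_wop_le h (diffs b) G, hG] with ξ h1 h2
    refine h1.trans ?_
    rw [deg_diffs, h2, norm_mul, pow_succ, mul_assoc]
    exact mul_le_mul_of_nonneg_left (mul_le_mul_of_nonneg_right (norm_psym_le_zt e ξ)
      (norm_nonneg _)) (pow_nonneg (zt_nonneg ξ) _)
  -- Interpolation needs positive orders. For `i = 0` the velocity factor carries a single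
  -- difference quotient and is bounded by `A` outright.
  rcases Nat.eq_zero_or_pos i with hi0 | hi0
  · subst hi0
    refine (eLpNorm_bdd_mul_le (Bdd.wop_of_deg_eq_one h O hi hUA)).trans ?_
    rw [zero_add]
    refine mul_le_mul (ENNReal.ofReal_le_ofReal ?_) (eLpNorm_le_X hg) zero_le zero_le
    have h1 : (1 : ℝ) ≤ (25 / 16) ^ (b.length + 1) := one_le_pow₀ (by norm_num)
    have h2 : A ≤ C₀ * A := le_mul_of_one_le_left hA.le hC
    have h3 : C₀ * A ≤ 16 * (25 / 16) ^ (b.length + 1) * (C₀ * A) :=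
      le_mul_of_one_le_left (by positivity) (by nlinarith)
    exact h2.trans h3
  · refine eLpNorm_mul_le hi0 (Nat.le_add_left 1 _) (by positivity) ?_ hg ?_ ?_
    · filter_upwards [norm_ft_wop_le h O U, hU] with ξ h1 h2
      refine h1.trans ?_
      rw [hi, pow_succ, mul_assoc]
      exact mul_le_mul_of_nonneg_left h2 (pow_nonneg (zt_nonneg ξ) _)
    · intro μ hμ
      rw [lowPass_wop, mul_comm]
      refine Bdd.wop_succ_of_bandLim (by positivity) h O hi (bandLim_lowPass hμ U) fun e' => ?_
      have e1 : dq h e' (lowPass μ U) = lowPass μ (dq h e' U) :=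
        (lowPass_wop h μ [(true, e')] U).symm
      rw [e1]
      exact (hUA e').lowPass hμ
    · intro μ hμ
      have hM : (0 : ℝ) < 5 / 4 * μ := by positivity
      have hbl : BandLim (5 / 4 * μ) (lowPass μ G) := bandLim_lowPass hμ G
      have h1 : Bdd (5 / 4 * μ * (C₀ * A)) (lowPass μ G) :=
        Bdd.of_bandLim hM (bandLim_lowPass hμ Ω) (hG.lowPass μ) (hΩ.lowPass hμ)
      rw [lowPass_wop]
      refine (Bdd.wop_of_bandLim hM h (diffs b) hbl h1).mono (le_of_eq ?_)
      rw [deg_diffs]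
      ring

/-! ### The discrete Leibniz rule and the commutator. -/

/-- The operator of a letter on functions. -/
def lfun (h : ℝ) : Bool × Fin 2 → (Plane → ℂ) → Plane → ℂ
  | (true, e), f => fun x => (h : ℂ)⁻¹ * (f (x + h • ev e) - f x)
  | (false, e), f => fun x => f (x + h • ev e)

/-- The operator of a word on functions; the first letter acts first. -/
def wfun (h : ℝ) : Word → (Plane → ℂ) → Plane → ℂ
  | [], f => f
  | l :: w, f => wfun h w (lfun h l f)

lemma lfun_congr (h : ℝ) (l : Bool × Fin 2) {f g : Plane → ℂ} (hfg : f =ᵐ[volume] g) :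
    lfun h l f =ᵐ[volume] lfun h l g := by
  obtain ⟨_ | _, e⟩ := l
  · exact ae_comp_add hfg _
  · filter_upwards [ae_comp_add hfg (h • ev e), hfg] with x h1 h2
    simp only [lfun, h1, h2]

lemma wfun_congr (h : ℝ) (w : Word) {f g : Plane → ℂ} (hfg : f =ᵐ[volume] g) :
    wfun h w f =ᵐ[volume] wfun h w g := by
  induction w generalizing f g with
  | nil => exact hfg
  | cons l w ih => exact ih (lfun_congr h l hfg)

/-- The bridge between the two calculi: the Leibniz rule concerns products of plain functions, while
the Fourier bounds concern elements of `L²`. -/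
lemma coeFn_wop (h : ℝ) (w : Word) (f : H) : wop h w f =ᵐ[volume] wfun h w f := by
  induction w generalizing f with
  | nil => rfl
  | cons l w ih =>
    refine (ih _).trans (wfun_congr h w ?_)
    obtain ⟨_ | _, e⟩ := l
    · exact coeFn_tr _ _
    · exact coeFn_dq _ _ _

lemma lfun_aesm (h : ℝ) (l : Bool × Fin 2) {f : Plane → ℂ} (hf : AEStronglyMeasurable f volume) :
    AEStronglyMeasurable (lfun h l f) volume := by
  have hs : ∀ a : Plane, AEStronglyMeasurable (fun x => f (x + a)) volume := fun a =>
    hf.comp_measurePreserving (measurePreserving_add_right volume a)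
  obtain ⟨_ | _, e⟩ := l
  · exact hs _
  · exact ((hs _).sub hf).const_mul _

lemma wfun_aesm (h : ℝ) (w : Word) {f : Plane → ℂ} (hf : AEStronglyMeasurable f volume) :
    AEStronglyMeasurable (wfun h w f) volume := by
  induction w generalizing f with
  | nil => exact hf
  | cons l w ih => exact ih (lfun_aesm h l hf)

lemma wfun_append (h : ℝ) (v w : Word) (f : Plane → ℂ) :
    wfun h (v ++ w) f = wfun h w (wfun h v f) := by
  induction v generalizing f with
  | nil => rfl
  | cons l v ih => exact ih _

lemma wfun_add (h : ℝ) (w : Word) (f g : Plane → ℂ) :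
    wfun h w (f + g) = wfun h w f + wfun h w g := by
  induction w generalizing f g with
  | nil => rfl
  | cons l w ih =>
    simp only [wfun]
    rw [← ih]
    congr 1
    obtain ⟨_ | _, e⟩ := l
    · rfl
    · funext x
      simp only [lfun, Pi.add_apply]
      ring

/-- The discrete Leibniz rule. -/
lemma lfun_mul (h : ℝ) (e : Fin 2) (f g : Plane → ℂ) :
    lfun h (true, e) (f * g) =
      lfun h (false, e) f * lfun h (true, e) g + lfun h (true, e) f * g := by
  funext x
  simp only [lfun, Pi.add_apply, Pi.mul_apply]
  ring

section Leibniz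

variable {h : ℝ} {f g : Plane → ℂ} {B : ℝ≥0∞} {n : ℕ}

/-- Once a difference quotient has hit `f`, every later application of the Leibniz rule yields two
terms of the same kind, so the number of terms at most doubles with each letter. -/
lemma eLpNorm_diffs_term_le (hf : AEStronglyMeasurable f volume)
    (hg : AEStronglyMeasurable g volume)
    (hB : ∀ (O : Word) (b : List (Fin 2)), 1 ≤ deg O → deg O + b.length = n →
      eLpNorm (wfun h O f * wfun h (diffs b) g) 2 volume ≤ B)
    (w : List (Fin 2)) (O : Word) (b : List (Fin 2)) (hO : 1 ≤ deg O)
    (hn : deg O + b.length + w.length = n) :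
    eLpNorm (wfun h (diffs w) (wfun h O f * wfun h (diffs b) g)) 2 volume
      ≤ 2 ^ w.length * B := by
  induction w generalizing O b with
  | nil => simpa [wfun, diffs] using hB O b hO (by simpa using hn)
  | cons e w ih =>
    rw [diffs_cons, wfun, lfun_mul, wfun_add]
    have e1 : lfun h (false, e) (wfun h O f) = wfun h (O ++ [(false, e)]) f := by
      rw [wfun_append]; rfl
    have e2 : lfun h (true, e) (wfun h O f) = wfun h (O ++ [(true, e)]) f := by
      rw [wfun_append]; rfl
    have e3 : lfun h (true, e) (wfun h (diffs b) g) = wfun h (diffs (b ++ [e])) g := by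
      rw [diffs, diffs, List.map_append, wfun_append]; rfl
    rw [e1, e2, e3]
    have hm : ∀ O' b', AEStronglyMeasurable
        (wfun h (diffs w) (wfun h O' f * wfun h (diffs b') g)) volume := fun O' b' =>
      wfun_aesm h _ ((wfun_aesm h _ hf).mul (wfun_aesm h _ hg))
    refine (eLpNorm_add_le (hm _ _) (hm _ _) (by norm_num)).trans ?_
    rw [List.length_cons] at hn ⊢
    have k1 := ih (O ++ [(false, e)]) (b ++ [e]) (by simp; omega) (by simp; omega)
    have k2 := ih (O ++ [(true, e)]) b (by simp) (by simp; omega)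
    refine (add_le_add k1 k2).trans (le_of_eq ?_)
    rw [pow_succ]
    ring

/-- The commutator of iterated difference quotients with multiplication by `f`. -/
lemma eLpNorm_commutator_le_aux (hf : AEStronglyMeasurable f volume)
    (hg : AEStronglyMeasurable g volume)
    (hB : ∀ (O : Word) (b : List (Fin 2)), 1 ≤ deg O → deg O + b.length = n →
      eLpNorm (wfun h O f * wfun h (diffs b) g) 2 volume ≤ B)
    (w : List (Fin 2)) (S : Word) (b : List (Fin 2)) (hS : deg S = 0)
    (hn : b.length + w.length = n) :
    eLpNorm (wfun h (diffs w) (wfun h S f * wfun h (diffs b) g) -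
      wfun h (S ++ shifts w) f * wfun h (diffs (b ++ w)) g) 2 volume ≤ 2 ^ w.length * B := by
  induction w generalizing S b with
  | nil => simp [wfun, diffs, shifts]
  | cons e w ih =>
    rw [diffs_cons, wfun, lfun_mul, wfun_add]
    have e1 : lfun h (false, e) (wfun h S f) = wfun h (S ++ [(false, e)]) f := by
      rw [wfun_append]; rfl
    have e2 : lfun h (true, e) (wfun h S f) = wfun h (S ++ [(true, e)]) f := by
      rw [wfun_append]; rfl
    have e3 : lfun h (true, e) (wfun h (diffs b) g) = wfun h (diffs (b ++ [e])) g := by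
      rw [diffs, diffs, List.map_append, wfun_append]; rfl
    rw [e1, e2, e3]
    have hm : ∀ O' b', AEStronglyMeasurable
        (wfun h (diffs w) (wfun h O' f * wfun h (diffs b') g)) volume := fun O' b' =>
      wfun_aesm h _ ((wfun_aesm h _ hf).mul (wfun_aesm h _ hg))
    rw [List.length_cons] at hn ⊢
    -- The term in which `f` is only shifted continues the recursion and ends in the subtracted main
    -- term. The other one has a difference quotient on `f` and goes entirely into the error.
    have k1 := ih (S ++ [(false, e)]) (b ++ [e]) (by simp [hS]) (by simp; omega)
    have k2 := eLpNorm_diffs_term_le hf hg hB w (S ++ [(true, e)]) b (by simp)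
      (by simp [hS]; omega)
    rw [List.append_assoc, List.append_assoc] at k1
    rw [add_sub_right_comm]
    refine (eLpNorm_add_le ?_ (hm _ _) (by norm_num)).trans ?_
    · exact (hm _ _).sub ((wfun_aesm h _ hf).mul (wfun_aesm h _ hg))
    · refine (add_le_add k1 k2).trans (le_of_eq ?_)
      rw [pow_succ]
      ring

lemma eLpNorm_commutator_le (hf : AEStronglyMeasurable f volume)
    (hg : AEStronglyMeasurable g volume) (w : List (Fin 2))
    (hB : ∀ (O : Word) (b : List (Fin 2)), 1 ≤ deg O → deg O + b.length = w.length →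
      eLpNorm (wfun h O f * wfun h (diffs b) g) 2 volume ≤ B) :
    eLpNorm (wfun h (diffs w) (f * g) - wfun h (shifts w) f * wfun h (diffs w) g) 2 volume
      ≤ 2 ^ w.length * B :=
  eLpNorm_commutator_le_aux hf hg hB w [] [] rfl (by simp)

end Leibniz

/-! ### Multiplication by the velocity and antisymmetry of transport. -/

lemma norm_sq_le_zt (ξ : Plane) : ‖ξ‖ ^ 2 ≤ zt ξ ^ 2 := by
  have h1 : ‖ξ‖ ^ 2 = |ξ 0| ^ 2 + |ξ 1| ^ 2 := by
    rw [EuclideanSpace.norm_sq_eq]; simp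
  have h2 : |ξ 0| ≤ max |ξ 0| |ξ 1| := le_max_left _ _
  have h3 : |ξ 1| ≤ max |ξ 0| |ξ 1| := le_max_right _ _
  have h4 : 0 ≤ |ξ 0| := abs_nonneg _
  have h5 : 0 ≤ |ξ 1| := abs_nonneg _
  have h6 : 2 ≤ 2 * Real.pi := by linarith [Real.pi_gt_three]
  rw [h1, zt, mul_pow]
  set m := max |ξ 0| |ξ 1|
  have : (4 : ℝ) ≤ (2 * Real.pi) ^ 2 := by nlinarith
  nlinarith [pow_le_pow_left₀ h4 h2 2, pow_le_pow_left₀ h5 h3 2, sq_nonneg m]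

/-- A function with one more derivative than an `H¹` function is bounded. -/
lemma exists_bdd_of_zt_mul_le {U Ω : H} (hU : ∀ᵐ ξ, zt ξ * ‖ft U ξ‖ ≤ ‖ft Ω ξ‖)
    (hX : X 1 Ω ≠ ∞) : ∃ C, Bdd C U := by
  refine exists_bdd_of_integrable_ft U ?_
  -- Cauchy–Schwarz: the weight `(1 + |ξ|²)⁻¹` is square-integrable in the plane. Its inverse times
  -- `ft U` is square-integrable because `U ∈ L²` handles the summand `1` and `zt ξ * ‖ft Ω ξ‖`
  -- handles `|ξ|²`.
  have ha : MemLp (fun ξ : Plane => (1 + ‖ξ‖ ^ 2)⁻¹) 2 volume := by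
    rw [memLp_two_iff_integrable_sq (by
      refine Continuous.aestronglyMeasurable (Continuous.inv₀ (by fun_prop) fun x => ?_)
      positivity)]
    have := integrable_rpow_neg_one_add_norm_sq (E := Plane) (μ := volume) (r := 4)
      (by rw [finrank_euclideanSpace_fin]; norm_num)
    refine this.congr (Eventually.of_forall fun x => ?_)
    simp only
    rw [show (-4 / 2 : ℝ) = ((-2 : ℤ) : ℝ) by norm_num, Real.rpow_intCast, inv_pow]
    rfl
  have hb : MemLp (fun ξ => ((1 + ‖ξ‖ ^ 2 : ℝ) : ℂ) * ft U ξ) 2 volume := by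
    have hXm : MemLp (fun ξ => ((zt ξ ^ 1 : ℝ) : ℂ) * ft Ω ξ) 2 volume :=
      ⟨(Continuous.aestronglyMeasurable (by fun_prop)).mul (Lp.aestronglyMeasurable _),
        lt_top_iff_ne_top.2 hX⟩
    refine MemLp.of_le ((Lp.memLp (ft U)).norm.add hXm.norm)
      ((Continuous.aestronglyMeasurable (by fun_prop)).mul (Lp.aestronglyMeasurable _)) ?_
    filter_upwards [hU] with ξ h1
    have hz := zt_nonneg ξ
    rw [norm_mul, Complex.norm_real, Real.norm_of_nonneg (by positivity), Pi.add_apply, norm_mul,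
      Complex.norm_real, Real.norm_of_nonneg (by positivity : 0 ≤ zt ξ ^ 1),
      Real.norm_of_nonneg (by positivity), pow_one, add_mul, one_mul]
    refine add_le_add le_rfl ?_
    calc ‖ξ‖ ^ 2 * ‖ft U ξ‖ ≤ zt ξ ^ 2 * ‖ft U ξ‖ :=
          mul_le_mul_of_nonneg_right (norm_sq_le_zt ξ) (norm_nonneg _)
      _ = zt ξ * (zt ξ * ‖ft U ξ‖) := by ring
      _ ≤ _ := mul_le_mul_of_nonneg_left h1 hz
  have := MemLp.integrable_mul (p := 2) (q := 2) hb ha.ofReal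
  refine this.congr (Eventually.of_forall fun ξ => ?_)
  have h0 : ((1 + ‖ξ‖ ^ 2 : ℝ) : ℂ) ≠ 0 := by
    rw [Complex.ofReal_ne_zero]; positivity
  simp only [Pi.mul_apply]
  have e : ((RCLike.ofReal ((1 + ‖ξ‖ ^ 2)⁻¹ : ℝ) : ℂ)) = ((1 + ‖ξ‖ ^ 2 : ℝ) : ℂ)⁻¹ := by
    rw [← Complex.ofReal_inv]; rfl
  rw [e]
  field_simp

lemma memLp_mul_of_bdd {U : H} {C : ℝ} (hU : Bdd C U) (f : H) :
    MemLp (fun x => U x * f x) 2 volume := by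
  refine MemLp.of_le_mul (c := C) (Lp.memLp f)
    ((Lp.aestronglyMeasurable U).mul (Lp.aestronglyMeasurable f)) ?_
  filter_upwards [hU] with x hx
  rw [norm_mul]
  exact mul_le_mul_of_nonneg_right hx (norm_nonneg _)

/-- Multiplication by a bounded function. -/
def mulBdd {U : H} {C : ℝ} (hU : Bdd C U) : H →L[ℂ] H :=
  LinearMap.mkContinuous
    { toFun := fun f => (memLp_mul_of_bdd hU f).toLp _
      map_add' := fun f g => by
        refine Lp.ext ?_
        filter_upwards [(memLp_mul_of_bdd hU (f + g)).coeFn_toLp,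
          (memLp_mul_of_bdd hU f).coeFn_toLp, (memLp_mul_of_bdd hU g).coeFn_toLp,
          Lp.coeFn_add f g, Lp.coeFn_add ((memLp_mul_of_bdd hU f).toLp _)
            ((memLp_mul_of_bdd hU g).toLp _)] with x h1 h2 h3 h4 h5
        rw [h1, h5, Pi.add_apply, h2, h3, h4, Pi.add_apply, mul_add]
      map_smul' := fun c f => by
        refine Lp.ext ?_
        filter_upwards [(memLp_mul_of_bdd hU (c • f)).coeFn_toLp,
          (memLp_mul_of_bdd hU f).coeFn_toLp, Lp.coeFn_smul c f,
          Lp.coeFn_smul c ((memLp_mul_of_bdd hU f).toLp _)] with x h1 h2 h3 h4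
        rw [h1, RingHom.id_apply, h4, Pi.smul_apply, h2, h3, Pi.smul_apply, smul_eq_mul,
          smul_eq_mul]
        ring } C fun f => by
    refine Lp.norm_le_mul_norm_of_ae_le_mul ?_
    filter_upwards [(memLp_mul_of_bdd hU f).coeFn_toLp, hU] with x h1 h2
    simp only [LinearMap.coe_mk, AddHom.coe_mk]
    rw [h1, norm_mul]
    exact mul_le_mul_of_nonneg_right h2 (norm_nonneg _)

lemma coeFn_mulBdd {U : H} {C : ℝ} (hU : Bdd C U) (f : H) :
    mulBdd hU f =ᵐ[volume] fun x => U x * f x := (memLp_mul_of_bdd hU f).coeFn_toLp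

/-- Almost everywhere real-valued functions. -/
def IsReal (f : Plane → ℂ) : Prop := ∀ᵐ x, (f x).im = 0

lemma inner_mulBdd_symm {U : H} {C : ℝ} (hU : Bdd C U) (hr : IsReal U) (f g : H) :
    inner ℂ f (mulBdd hU g) = inner ℂ (mulBdd hU f) g := by
  rw [L2.inner_def, L2.inner_def]
  refine integral_congr_ae ?_
  filter_upwards [coeFn_mulBdd hU f, coeFn_mulBdd hU g, hr] with x h1 h2 h3
  rw [h1, h2]
  simp only [RCLike.inner_apply, map_mul]
  rw [Complex.conj_eq_iff_im.2 h3]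
  ring

/-- Integration by parts, `∫ U ∂|v|² = -∫ ∂U |v|²`, carried out on difference quotients. The
function `p = |v|²` is required in `L²` so that it can be paired with `V = ∂U`. -/
lemma re_inner_mulBdd_dq {U V v g : H} {C : ℝ} {e : Fin 2} (hU : Bdd C U) (hr : IsReal U)
    (hV : IsPd e U V) (hg : IsPd e v g) {p : H}
    (hp : p =ᵐ[volume] fun x => (starRingEnd ℂ) (v x) * v x) :
    2 * (inner ℂ v (mulBdd hU g)).re = - (inner ℂ p V).re := by
  let δ : ℕ → ℝ := fun n => ((n : ℝ) + 1)⁻¹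
  have hδ0 : ∀ n, δ n ≠ 0 := fun n => by positivity
  have hδ : Tendsto δ atTop (𝓝 0) := by
    simpa [δ, one_div] using tendsto_one_div_add_atTop_nhds_zero_nat (𝕜 := ℝ)
  have hδ1 : Tendsto δ atTop (𝓝[≠] 0) :=
    tendsto_nhdsWithin_iff.2 ⟨hδ, Eventually.of_forall hδ0⟩
  have hδ2 : Tendsto (fun n => - δ n) atTop (𝓝[≠] 0) :=
    tendsto_nhdsWithin_iff.2 ⟨by simpa using hδ.neg, Eventually.of_forall fun n => by
      simpa using hδ0 n⟩
  -- A change of variables moves the translation from `|v|²` to `U`.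
  have hshift : ∀ a : Plane, inner ℂ (tr a v) (mulBdd hU (tr a v)) = inner ℂ p (tr (-a) U) := by
    intro a
    rw [L2.inner_def, L2.inner_def]
    have e1 : ∫ x, inner ℂ (p x) (tr (-a) U x) = ∫ x, U (x + -a) * ((starRingEnd ℂ) (v x) * v x) := by
      refine integral_congr_ae ?_
      filter_upwards [hp, coeFn_tr (-a) U] with x h1 h2
      rw [h1, h2]
      simp only [RCLike.inner_apply, map_mul, Complex.conj_conj]
      ring
    have e2 := integral_add_right_eq_self (μ := volume)
      (fun x => U (x + -a) * ((starRingEnd ℂ) (v x) * v x)) a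
    rw [e1, ← e2]
    refine integral_congr_ae ?_
    filter_upwards [coeFn_mulBdd hU (tr a v), coeFn_tr a v] with x h1 h2
    rw [h1, h2]
    simp only [RCLike.inner_apply, add_neg_cancel_right]
    ring
  -- `hshift` minus its value at `a = 0`, divided by the step. The discrete product rule leaves a
  -- quadratic term with a factor `δ n`, which disappears in the limit.
  have hid : ∀ n, inner ℂ (dq (δ n) e v) (mulBdd hU v) + inner ℂ v (mulBdd hU (dq (δ n) e v))
      + (δ n : ℂ) * inner ℂ (dq (δ n) e v) (mulBdd hU (dq (δ n) e v))
      = - inner ℂ p (dq (-δ n) e U) := fun n => by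
    have h1 : inner ℂ v (mulBdd hU v) = inner ℂ p U := by
      have := hshift 0
      simpa [tr_zero] using this
    have h2 := hshift (δ n • ev e)
    have h3 : (δ n : ℂ) ≠ 0 := Complex.ofReal_ne_zero.2 (hδ0 n)
    have h4 : tr (δ n • ev e) v = (δ n : ℂ) • dq (δ n) e v + v := by
      rw [dq_apply, smul_smul, mul_inv_cancel₀ h3, one_smul, sub_add_cancel]
    have h5 : tr (-(δ n • ev e)) U = -(δ n : ℂ) • dq (-δ n) e U + U := by
      rw [dq_apply, neg_smul, Complex.ofReal_neg, smul_smul, neg_smul, inv_neg, mul_neg,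
        mul_inv_cancel₀ h3, neg_smul, one_smul, neg_neg, sub_add_cancel]
    rw [h4, h5] at h2
    simp only [map_add, map_smul, inner_add_left, inner_add_right, inner_smul_left,
      inner_smul_right, Complex.conj_ofReal, neg_mul] at h2
    rw [h1] at h2
    refine mul_left_cancel₀ h3 ?_
    linear_combination h2
  have hdv := tendsto_dq hg hδ1
  have hdU := tendsto_dq hV hδ2
  have hMv := ((mulBdd hU).continuous.tendsto _).comp hdv
  have hδc : Tendsto (fun n => (δ n : ℂ)) atTop (𝓝 0) := by
    have := (Complex.continuous_ofReal.tendsto 0).comp hδ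
    rwa [Complex.ofReal_zero] at this
  have hl : Tendsto (fun n => inner ℂ (dq (δ n) e v) (mulBdd hU v)
      + inner ℂ v (mulBdd hU (dq (δ n) e v))
      + (δ n : ℂ) * inner ℂ (dq (δ n) e v) (mulBdd hU (dq (δ n) e v))) atTop
      (𝓝 (inner ℂ g (mulBdd hU v) + inner ℂ v (mulBdd hU g)
        + 0 * inner ℂ g (mulBdd hU g))) :=
    ((hdv.inner tendsto_const_nhds).add (tendsto_const_nhds.inner hMv)).add
      (hδc.mul (hdv.inner hMv))
  have hrr : Tendsto (fun n => - inner ℂ p (dq (-δ n) e U)) atTop (𝓝 (- inner ℂ p V)) :=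
    (tendsto_const_nhds.inner hdU).neg
  simp only [hid] at hl
  have key := tendsto_nhds_unique hl hrr
  have h6 : (inner ℂ g (mulBdd hU v)).re = (inner ℂ v (mulBdd hU g)).re := by
    rw [inner_mulBdd_symm hU hr g v, ← inner_conj_symm]
    exact Complex.conj_re _
  have h7 := congrArg Complex.re key
  simp only [zero_mul, add_zero, Complex.add_re, Complex.neg_re] at h7
  rw [h6] at h7
  linarith

lemma tendsto_lowPass (f : H) : Tendsto (fun n : ℕ => lowPass ((n : ℝ) + 1) f) atTop (𝓝 f) := by
  refine tendsto_of_ft (tendsto_of_dominated (fun ξ => ‖ft f ξ‖) (Lp.memLp (ft f)).norm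
    (fun n => ?_) ?_)
  · filter_upwards [ft_lowPass ((n : ℝ) + 1) f] with ξ h1
    rw [h1, norm_mul]
    exact mul_le_of_le_one_left (norm_nonneg _) (norm_filt_le _ _)
  · filter_upwards [ae_all_iff.2 fun n : ℕ => ft_lowPass ((n : ℝ) + 1) f] with ξ h1
    refine tendsto_const_nhds.congr' ?_
    filter_upwards [eventually_ge_atTop ⌈zt ξ⌉₊] with n hn
    rw [h1 n, filt_eq_one (by positivity), one_mul]
    have := Nat.ceil_le.1 hn
    linarith

/-- Transport by a divergence-free field is antisymmetric. -/
lemma re_inner_transport {U V : Fin 2 → H} {v : H} {g : Fin 2 → H} {C : ℝ}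
    (hU : ∀ l, Bdd C (U l)) (hr : ∀ l, IsReal (U l)) (hV : ∀ l, IsPd l (U l) (V l))
    (hdiv : V 0 + V 1 = 0) (hg : ∀ l, IsPd l v (g l)) :
    (inner ℂ v (mulBdd (hU 0) (g 0) + mulBdd (hU 1) (g 1))).re = 0 := by
  -- A low-pass filtered `v` is bounded, hence `|v|²` lies in `L²` and the integration by parts
  -- applies. Both sides of the pairing are continuous in `L²`, so the filter can be removed
  -- afterwards.
  have key : ∀ n : ℕ, (inner ℂ (lowPass ((n : ℝ) + 1) v)
      (mulBdd (hU 0) (lowPass ((n : ℝ) + 1) (g 0)) +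
        mulBdd (hU 1) (lowPass ((n : ℝ) + 1) (g 1)))).re = 0 := fun n => by
    have hμ : (0 : ℝ) < n + 1 := by positivity
    set vn := lowPass ((n : ℝ) + 1) v with hvn
    obtain ⟨K, hK⟩ := exists_bdd_of_integrable_ft vn (integrable_ft_lowPass hμ v)
    have hm : MemLp (fun x => (starRingEnd ℂ) (vn x) * vn x) 2 volume := by
      refine MemLp.of_le_mul (c := K) (Lp.memLp vn)
        ((Complex.continuous_conj.comp_aestronglyMeasurable (Lp.aestronglyMeasurable vn)).mul
          (Lp.aestronglyMeasurable vn)) ?_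
      filter_upwards [hK] with x hx
      rw [norm_mul, RCLike.norm_conj]
      exact mul_le_mul_of_nonneg_right hx (norm_nonneg _)
    have h0 := re_inner_mulBdd_dq (hU 0) (hr 0) (hV 0) ((hg 0).lowPass ((n : ℝ) + 1))
      hm.coeFn_toLp
    have h1 := re_inner_mulBdd_dq (hU 1) (hr 1) (hV 1) ((hg 1).lowPass ((n : ℝ) + 1))
      hm.coeFn_toLp
    have h2 : (inner ℂ (hm.toLp _) (V 0)).re + (inner ℂ (hm.toLp _) (V 1)).re = 0 := by
      rw [← Complex.add_re, ← inner_add_right, hdiv, inner_zero_right, Complex.zero_re]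
    rw [inner_add_right, Complex.add_re]
    linarith
  have hlim : Tendsto (fun n : ℕ => (inner ℂ (lowPass ((n : ℝ) + 1) v)
      (mulBdd (hU 0) (lowPass ((n : ℝ) + 1) (g 0)) +
        mulBdd (hU 1) (lowPass ((n : ℝ) + 1) (g 1)))).re) atTop
      (𝓝 (inner ℂ v (mulBdd (hU 0) (g 0) + mulBdd (hU 1) (g 1))).re) := by
    refine (Complex.continuous_re.tendsto _).comp ?_
    exact (tendsto_lowPass v).inner
      ((((mulBdd (hU 0)).continuous.tendsto _).comp (tendsto_lowPass (g 0))).add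
        (((mulBdd (hU 1)).continuous.tendsto _).comp (tendsto_lowPass (g 1))))
  simp only [key] at hlim
  exact (tendsto_nhds_unique hlim tendsto_const_nhds)

lemma IsReal.wop_shifts {U : H} (hU : IsReal U) (h : ℝ) (w : List (Fin 2)) :
    IsReal (wop h (shifts w) U) := by
  induction w generalizing U with
  | nil => exact hU
  | cons e w ih =>
    rw [shifts_cons, wop_cons]
    refine ih ?_
    filter_upwards [coeFn_tr (h • ev e) U, ae_comp_add hU (h • ev e)] with x h1 h2
    change (tr (h • ev e) U x).im = 0
    rw [h1]
    exact h2

/-! ### The energy identity at a fixed time. -/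

/-- The data of the equation at a fixed time: `Ω' + U · ∇Ω = β L₁Ω`, with `G = ∇Ω` and `U` the
velocity, `V l = ∂ₗ Uₗ`. -/
structure Snapshot (β : ℝ) (Ω Ω' L : H) (U V G : Fin 2 → H) : Prop where
  grad : ∀ l, IsPd l Ω (G l)
  vel : ∀ l, ∀ᵐ ξ, zt ξ * ‖ft (U l) ξ‖ ≤ ‖ft Ω ξ‖
  velReal : ∀ l, IsReal (U l)
  velBdd : ∃ C, ∀ l, Bdd C (U l)
  velGrad : ∀ l, IsPd l (U l) (V l)
  divFree : V 0 + V 1 = 0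
  skew : ∃ m : Plane → ℂ, (∀ ξ, (m ξ).re = 0) ∧ ft L =ᵐ[volume] fun ξ => m ξ * ft Ω ξ
  eqn : ∀ᵐ x, Ω' x + (U 0 x * G 0 x + U 1 x * G 1 x) = β * L x

/-- By Plancherel the pairing is the integral of `m |f̂|²`, which is purely imaginary. This is why
`β` does not enter the estimate. -/
lemma re_inner_eq_zero_of_skew {f g : H} {m : Plane → ℂ} (hm : ∀ ξ, (m ξ).re = 0)
    (h : ft g =ᵐ[volume] fun ξ => m ξ * ft f ξ) : (inner ℂ f g).re = 0 := by
  rw [← Lp.inner_fourier_eq f g, L2.inner_def]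
  have e : ∫ ξ, inner ℂ (ft f ξ) (ft g ξ)
      = ∫ ξ, Complex.I * (((m ξ).im * ‖ft f ξ‖ ^ 2 : ℝ) : ℂ) := by
    refine integral_congr_ae ?_
    filter_upwards [h] with ξ h1
    rw [h1]
    have h2 : m ξ = Complex.I * ((m ξ).im : ℂ) := by
      apply Complex.ext <;> simp [hm ξ]
    simp only [RCLike.inner_apply]
    rw [mul_assoc, RCLike.mul_conj]
    conv_lhs => rw [h2]
    push_cast
    rw [mul_assoc]
    rfl
  change (∫ ξ, inner ℂ (ft f ξ) (ft g ξ)).re = 0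
  rw [e, integral_const_mul, integral_complex_ofReal]
  simp

lemma Snapshot.wop_skew {β : ℝ} {Ω Ω' L : H} {U V G : Fin 2 → H} (S : Snapshot β Ω Ω' L U V G)
    (h : ℝ) (w : Word) : (inner ℂ (wop h w Ω) (wop h w L)).re = 0 := by
  obtain ⟨m, hm, hL⟩ := S.skew
  refine re_inner_eq_zero_of_skew hm ?_
  filter_upwards [hL, ft_wop h w Ω, ft_wop h w L] with ξ h1 h2 h3
  rw [h3, h1, h2]
  ring

/-- The energy identity, up to the commutator. -/
lemma Snapshot.abs_re_inner_le {β : ℝ} {Ω Ω' L : H} {U V G : Fin 2 → H}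
    (S : Snapshot β Ω Ω' L U V G) (h : ℝ) (w : List (Fin 2)) (B : ℝ) (hB0 : 0 ≤ B)
    (hB : ∀ (l : Fin 2) (O : Word) (b : List (Fin 2)), 1 ≤ deg O → deg O + b.length = w.length →
      eLpNorm (fun x => wop h O (U l) x * wop h (diffs b) (G l) x) 2 volume ≤ ENNReal.ofReal B) :
    |(inner ℂ (wop h (diffs w) Ω) (wop h (diffs w) Ω')).re| ≤
      ‖wop h (diffs w) Ω‖ * (2 * 2 ^ w.length * B) := by
  obtain ⟨C, hC⟩ := S.velBdd
  -- The discrete Leibniz rule leaves the undifferentiated velocity shifted along the whole word, so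
  -- the transport is by this shifted field.
  have hC' : ∀ l, Bdd C (wop h (shifts w) (U l)) := fun l =>
    Bdd.wop_of_deg_eq_zero h _ (deg_shifts w) (hC l)
  set v := wop h (diffs w) Ω with hv
  set g : Fin 2 → H := fun l => wop h (diffs w) (G l) with hg
  set M : H := mulBdd (hC' 0) (g 0) + mulBdd (hC' 1) (g 1) with hM
  have hzero : (inner ℂ v M).re = 0 := by
    refine re_inner_transport (V := fun l => wop h (shifts w) (V l)) hC'
      (fun l => (S.velReal l).wop_shifts h w) (fun l => (S.velGrad l).wop h _) ?_
      (fun l => (S.grad l).wop h _)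
    rw [← map_add, S.divFree, map_zero]
  -- By the equation `β L - Ω'` equals `U · G`, so `R` is the commutator: the difference quotients
  -- of the product minus transport by the shifted velocity.
  set R : H := (β : ℂ) • wop h (diffs w) L - wop h (diffs w) Ω' - M with hR
  have hRn : ‖R‖ ≤ 2 * 2 ^ w.length * B := by
    have hcomm : ∀ l, eLpNorm (wfun h (diffs w) (⇑(U l) * ⇑(G l))
        - wfun h (shifts w) (U l) * wfun h (diffs w) (G l)) 2 volume
        ≤ 2 ^ w.length * ENNReal.ofReal B := fun l => by
      refine eLpNorm_commutator_le (Lp.aestronglyMeasurable _) (Lp.aestronglyMeasurable _) w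
        fun O b hO hn => ?_
      refine le_trans (le_of_eq (eLpNorm_congr_ae ?_)) (hB l O b hO hn)
      filter_upwards [coeFn_wop h O (U l), coeFn_wop h (diffs b) (G l)] with x h1 h2
      rw [Pi.mul_apply, h1, h2]
    have hae : R =ᵐ[volume] (wfun h (diffs w) (⇑(U 0) * ⇑(G 0))
        - wfun h (shifts w) (U 0) * wfun h (diffs w) (G 0)) +
        (wfun h (diffs w) (⇑(U 1) * ⇑(G 1))
        - wfun h (shifts w) (U 1) * wfun h (diffs w) (G 1)) := by
      have e1 : wop h (diffs w) ((β : ℂ) • L - Ω') =ᵐ[volume]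
          wfun h (diffs w) (⇑(U 0) * ⇑(G 0)) + wfun h (diffs w) (⇑(U 1) * ⇑(G 1)) := by
        rw [← wfun_add]
        refine (coeFn_wop h (diffs w) _).trans (wfun_congr h _ ?_)
        filter_upwards [S.eqn, Lp.coeFn_sub ((β : ℂ) • L) Ω', Lp.coeFn_smul (β : ℂ) L]
          with x h1 h2 h3
        rw [h2, Pi.sub_apply, h3]
        simp only [Pi.smul_apply, Pi.add_apply, Pi.mul_apply, smul_eq_mul]
        linear_combination -h1
      rw [hR, ← map_smul, ← map_sub]
      filter_upwards [e1, Lp.coeFn_sub (wop h (diffs w) ((β : ℂ) • L - Ω')) M,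
        Lp.coeFn_add (mulBdd (hC' 0) (g 0)) (mulBdd (hC' 1) (g 1)),
        coeFn_mulBdd (hC' 0) (g 0), coeFn_mulBdd (hC' 1) (g 1),
        coeFn_wop h (shifts w) (U 0), coeFn_wop h (shifts w) (U 1),
        coeFn_wop h (diffs w) (G 0), coeFn_wop h (diffs w) (G 1)]
        with x h1 h2 h3 h4 h5 h6 h7 h8 h9
      rw [h2, Pi.sub_apply, h1, hM, h3]
      simp only [Pi.add_apply, Pi.sub_apply, Pi.mul_apply]
      rw [h4, h5, h6, h7]
      simp only [hg]
      rw [h8, h9]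
      ring
    have hm : ∀ l, AEStronglyMeasurable (wfun h (diffs w) (⇑(U l) * ⇑(G l))
        - wfun h (shifts w) (U l) * wfun h (diffs w) (G l)) volume := fun l =>
      (wfun_aesm h _ ((Lp.aestronglyMeasurable _).mul (Lp.aestronglyMeasurable _))).sub
        ((wfun_aesm h _ (Lp.aestronglyMeasurable _)).mul
          (wfun_aesm h _ (Lp.aestronglyMeasurable _)))
    have hE : eLpNorm R 2 volume ≤ ENNReal.ofReal (2 * 2 ^ w.length * B) := by
      rw [eLpNorm_congr_ae hae]
      refine (eLpNorm_add_le (hm 0) (hm 1) (by norm_num)).trans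
        ((add_le_add (hcomm 0) (hcomm 1)).trans (le_of_eq ?_))
      rw [← two_mul, mul_assoc, ENNReal.ofReal_mul (by norm_num), ENNReal.ofReal_mul (by positivity),
        ENNReal.ofReal_pow (by norm_num)]
      simp
    rw [Lp.norm_def]
    exact ENNReal.toReal_le_of_le_ofReal (by positivity) hE
  have hsplit : wop h (diffs w) Ω' = (β : ℂ) • wop h (diffs w) L - M - R := by
    rw [hR]; abel
  have hval : (inner ℂ v (wop h (diffs w) Ω')).re = - (inner ℂ v R).re := by
    rw [hsplit, inner_sub_right, inner_sub_right, inner_smul_right, Complex.sub_re, Complex.sub_re,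
      hzero, Complex.re_ofReal_mul, S.wop_skew]
    ring
  rw [hval, abs_neg]
  exact (Complex.abs_re_le_norm _).trans ((norm_inner_le_norm v R).trans
    (mul_le_mul_of_nonneg_left hRn (norm_nonneg _)))

/-! ### From distributional norms to the Fourier side. -/

/-- The Fourier transform of the distribution `F` is the function `g`. -/
def HasFT (F : 𝓢'(Plane, ℂ)) (g : Plane → ℂ) : Prop := ∀ φ : 𝓢(Plane, ℂ), 𝓕 F φ = ∫ ξ, φ ξ * g ξ

lemma hasFT_coe (f : H) : HasFT (Lp.toTemperedDistribution f) (ft f) := fun φ => by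
  rw [Lp.fourier_toTemperedDistribution_eq, Lp.toTemperedDistribution_apply]
  rfl

lemma HasFT.pd {F : 𝓢'(Plane, ℂ)} {g : Plane → ℂ} (h : HasFT F g) (i : Fin 2) :
    HasFT (pd i F) (fun ξ => psym i ξ * g ξ) := fun φ => by
  have ht : (fun ξ : Plane => inner ℝ ξ (EuclideanSpace.single i (1 : ℝ))).HasTemperateGrowth := by
    fun_prop
  have h1 : 𝓕 (BetaPlane.pd i F) φ = (2 * Real.pi * Complex.I) *
      𝓕 F (SchwartzMap.smulLeftCLM ℂ
        (fun ξ : Plane => inner ℝ ξ (EuclideanSpace.single i (1 : ℝ))) φ) := by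
    rw [BetaPlane.pd, TemperedDistribution.fourier_lineDerivOp_eq,
      ← SchwartzMap.smulLeftCLM_ofReal ℂ ht]
    rfl
  rw [h1, h, ← integral_const_mul]
  refine integral_congr_ae (Eventually.of_forall fun ξ => ?_)
  simp only
  rw [SchwartzMap.smulLeftCLM_apply_apply ht]
  simp only [psym, EuclideanSpace.inner_single_right]
  simp
  ring

lemma HasFT.pd_iterate {F : 𝓢'(Plane, ℂ)} {g : Plane → ℂ} (h : HasFT F g) (i : Fin 2) (a : ℕ) :
    HasFT ((BetaPlane.pd i)^[a] F) (fun ξ => psym i ξ ^ a * g ξ) := by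
  induction a with
  | zero => simpa using h
  | succ a ih =>
    rw [Function.iterate_succ_apply']
    convert! ih.pd i using 2 with ξ
    ring

lemma HasFT.ae_eq {F : 𝓢'(Plane, ℂ)} {g g' : Plane → ℂ} (h : HasFT F g) (h' : HasFT F g')
    (hg : LocallyIntegrable g volume) (hg' : LocallyIntegrable g' volume) : g =ᵐ[volume] g' :=
  ae_eq_of_schwartz hg hg' fun φ _ => (h φ).symm.trans (h' φ)

lemma HasFT.eq_coe {F : 𝓢'(Plane, ℂ)} {g : H} (h : HasFT F (ft g)) :
    F = Lp.toTemperedDistribution g := by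
  have h1 : 𝓕 F = 𝓕 (Lp.toTemperedDistribution g) := by
    ext φ
    rw [h φ, hasFT_coe g φ]
  have h2 := congrArg 𝓕⁻ h1
  rwa [FourierTransform.fourierInv_fourier_eq, FourierTransform.fourierInv_fourier_eq] at h2

/-- The symbol of `∂₁^a ∂₂^b`. -/
def asym (α : ℕ × ℕ) (ξ : Plane) : ℂ := psym 0 ξ ^ α.1 * psym 1 ξ ^ α.2

lemma continuous_asym (α : ℕ × ℕ) : Continuous (asym α) := by
  have h0 := continuous_psym 0
  have h1 := continuous_psym 1
  unfold asym
  fun_prop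

lemma locallyIntegrable_continuous_mul {m : Plane → ℂ} (hm : Continuous m) (f : H) :
    LocallyIntegrable (fun ξ => m ξ * f ξ) volume :=
  (locallyIntegrable_coe f).continuous_mul hm

lemma hasFT_deriv (α : ℕ × ℕ) (f : L2) :
    HasFT ((pd 0)^[α.1] ((pd 1)^[α.2] (toDist f))) (fun ξ => asym α ξ * ft (cplx f) ξ) := by
  convert! ((hasFT_coe (cplx f)).pd_iterate 1 α.2).pd_iterate 0 α.1 using 2 with ξ
  rw [asym, mul_assoc]

/-- An `L²` representative must have Fourier transform `asym α * f̂`, so it exists exactly when that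
function is square-integrable. Otherwise the infimum is over the empty set and both sides are
infinite. -/
lemma distLpNorm_deriv (α : ℕ × ℕ) (f : L2) :
    distLpNorm 2 ((pd 0)^[α.1] ((pd 1)^[α.2] (toDist f))) =
      eLpNorm (fun ξ => asym α ξ * ft (cplx f) ξ) 2 volume := by
  have hFT := hasFT_deriv α f
  have hloc := locallyIntegrable_continuous_mul (continuous_asym α) (ft (cplx f))
  refine le_antisymm ?_ (le_iInf₂ fun g hg => ?_)
  · by_cases htop : eLpNorm (fun ξ => asym α ξ * ft (cplx f) ξ) 2 volume = ∞
    · rw [htop]; exact le_top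
    have hm : MemLp (fun ξ => asym α ξ * ft (cplx f) ξ) 2 volume :=
      ⟨(continuous_asym α).aestronglyMeasurable.mul (Lp.aestronglyMeasurable _),
        lt_top_iff_ne_top.2 htop⟩
    have hg := ft_mulOp hm
    have hF : HasFT ((pd 0)^[α.1] ((pd 1)^[α.2] (toDist f))) (ft (mulOp (asym α) (cplx f))) :=
      fun φ => by
        rw [hFT φ]
        refine integral_congr_ae ?_
        filter_upwards [hg] with ξ hξ
        rw [hξ]
    refine (iInf₂_le (mulOp (asym α) (cplx f)) hF.eq_coe : _ ≤ ‖mulOp (asym α) (cplx f)‖ₑ).trans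
      (le_of_eq ?_)
    rw [Lp.enorm_def, ← eLpNorm_ft]
    exact eLpNorm_congr_ae hg
  · rw [hg] at hFT
    rw [Lp.enorm_def, ← eLpNorm_ft,
      eLpNorm_congr_ae ((hasFT_coe g).ae_eq hFT (locallyIntegrable_coe _) hloc)]

/-- The square of the inhomogeneous Sobolev norm, in terms of the Fourier transform. -/
def energy (k : ℕ) (Ω : H) : ℝ≥0∞ :=
  ∑ j ∈ Finset.range (k + 1), ∑ α ∈ Finset.HasAntidiagonal.antidiagonal j,
    eLpNorm (fun ξ => asym α ξ * ft Ω ξ) 2 volume ^ 2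

lemma sobolevNorm_eq (k : ℕ) (f : L2) : sobolevNorm k f = energy k (cplx f) ^ (1 / 2 : ℝ) := by
  unfold sobolevNorm energy
  simp only [distLpNorm_deriv]

lemma distLpNorm_top_coe (V : H) :
    distLpNorm ∞ (Lp.toTemperedDistribution V) = eLpNorm V ∞ volume := by
  have hcoe : ∀ g : Lp ℂ ∞ (volume : Measure Plane),
      Lp.toTemperedDistribution V = Lp.toTemperedDistribution g → V =ᵐ[volume] g := fun g hg =>
    ae_eq_of_schwartz (locallyIntegrable_coe V)
      ((Lp.memLp g).locallyIntegrable (by norm_num)) fun φ _ => by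
        have := congrArg (fun D : 𝓢'(Plane, ℂ) => D φ) hg
        simpa only [Lp.toTemperedDistribution_apply, smul_eq_mul] using this
  refine le_antisymm ?_ (le_iInf₂ fun g hg => ?_)
  · by_cases htop : eLpNorm V ∞ volume = ∞
    · rw [htop]; exact le_top
    have hm : MemLp V ∞ volume := ⟨Lp.aestronglyMeasurable _, lt_top_iff_ne_top.2 htop⟩
    refine (iInf₂_le (hm.toLp _) ?_).trans (le_of_eq ?_)
    · ext φ
      rw [Lp.toTemperedDistribution_apply, Lp.toTemperedDistribution_apply]
      refine integral_congr_ae ?_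
      filter_upwards [hm.coeFn_toLp] with x hx
      rw [hx]
    · rw [Lp.enorm_def]
      exact eLpNorm_congr_ae hm.coeFn_toLp
  · rw [Lp.enorm_def, eLpNorm_congr_ae (hcoe g hg)]

lemma isPd_of_pd_eq {i : Fin 2} {f g : H}
    (h : pd i (Lp.toTemperedDistribution f) = Lp.toTemperedDistribution g) : IsPd i f g := by
  have h1 := (hasFT_coe f).pd i
  rw [h] at h1
  exact (hasFT_coe g).ae_eq h1 (locallyIntegrable_coe _)
    (locallyIntegrable_continuous_mul (continuous_psym i) _)

lemma IsPd.pd_eq {i : Fin 2} {f g : H} (h : IsPd i f g) :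
    pd i (Lp.toTemperedDistribution f) = Lp.toTemperedDistribution g := by
  refine HasFT.eq_coe fun φ => ?_
  rw [(hasFT_coe f).pd i φ]
  refine integral_congr_ae ?_
  filter_upwards [h] with ξ hξ
  rw [hξ]

lemma isReal_cplx (f : L2) : IsReal (cplx f) := by
  filter_upwards [Complex.ofRealCLM.coeFn_compLp f] with x hx
  rw [cplx, hx]
  simp

lemma eLpNorm_cplx (p : ℝ≥0∞) (f : L2) : eLpNorm (cplx f) p volume = eLpNorm f p volume := by
  refine eLpNorm_congr_norm_ae ?_
  filter_upwards [Complex.ofRealCLM.coeFn_compLp f] with x hx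
  rw [cplx, hx]
  simp

lemma bdd_of_eLpNorm_top_le {f : H} {A : ℝ} (hA : 0 ≤ A) (h : eLpNorm f ∞ volume ≤ ENNReal.ofReal A) :
    Bdd A f := by
  have h1 : ∀ᵐ x, ‖f x‖ₑ ≤ eLpNorm f ∞ volume := by
    rw [eLpNorm_exponent_top]; exact enorm_ae_le_eLpNormEssSup _ _
  filter_upwards [h1] with x hx
  have := hx.trans h
  rwa [← ofReal_norm, ENNReal.ofReal_le_ofReal_iff hA] at this

lemma eLpNorm_sq_eq_lintegral {g : Plane → ℂ} : eLpNorm g 2 volume ^ 2 = ∫⁻ x, ‖g x‖ₑ ^ 2 := by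
  rw [eLpNorm_eq_lintegral_rpow_enorm_toReal (by norm_num) (by norm_num),
    ← ENNReal.rpow_natCast, ← ENNReal.rpow_mul,
    show (1 / (2 : ℝ≥0∞).toReal * ((2 : ℕ) : ℝ)) = 1 by norm_num, ENNReal.rpow_one,
    show (2 : ℝ≥0∞).toReal = ((2 : ℕ) : ℝ) by norm_num]
  simp only [ENNReal.rpow_natCast]

/-- At each frequency the larger coordinate attains the maximum in `zt`, so one of the two pure
derivatives of order `j` has symbol of modulus exactly `zt ξ ^ j`. The choice of the sup norm in
`zt` thus avoids a constant depending on `j`. -/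
lemma X_sq_le (j : ℕ) (Ω : H) : X j Ω ^ 2 ≤ ∑ α ∈ Finset.HasAntidiagonal.antidiagonal j,
    eLpNorm (fun ξ => asym α ξ * ft Ω ξ) 2 volume ^ 2 := by
  simp only [X, eLpNorm_sq_eq_lintegral]
  rw [← lintegral_finsetSum']
  · refine lintegral_mono fun ξ => ?_
    simp only [enorm_mul, mul_pow]
    rw [← Finset.sum_mul]
    refine mul_le_mul_left ?_ _
    have h : ∃ α ∈ Finset.HasAntidiagonal.antidiagonal j, ‖((zt ξ ^ j : ℝ) : ℂ)‖ = ‖asym α ξ‖ := by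
      rw [Complex.norm_real, Real.norm_of_nonneg (pow_nonneg (zt_nonneg ξ) j)]
      rcases le_total |ξ 0| |ξ 1| with h | h
      · refine ⟨(0, j), by simp, ?_⟩
        rw [asym, norm_mul, norm_pow, norm_pow, norm_psym, norm_psym, zt, max_eq_right h]
        simp
      · refine ⟨(j, 0), by simp, ?_⟩
        rw [asym, norm_mul, norm_pow, norm_pow, norm_psym, norm_psym, zt, max_eq_left h]
        simp
    obtain ⟨α, hα, he⟩ := h
    rw [enorm_eq_iff_norm_eq.2 he]
    exact Finset.single_le_sum (f := fun α => ‖asym α ξ‖ₑ ^ 2) (fun _ _ => zero_le) hα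
  · intro α _
    exact (((continuous_asym α).aestronglyMeasurable.mul
      (Lp.aestronglyMeasurable (ft Ω))).enorm).pow_const 2

lemma sum_X_sq_le (k : ℕ) (Ω : H) : ∑ j ∈ Finset.range (k + 1), X j Ω ^ 2 ≤ energy k Ω :=
  Finset.sum_le_sum fun j _ => X_sq_le j Ω

lemma energy_mono {k m : ℕ} (h : k ≤ m) (Ω : H) : energy k Ω ≤ energy m Ω :=
  Finset.sum_le_sum_of_subset (Finset.range_subset_range.2 (by omega))

/-! ### The velocity in terms of the vorticity. -/

lemma norm_derivInvLaplaceSymbol_le (j : Fin 2) (ξ : Plane) :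
    zt ξ * ‖derivInvLaplaceSymbol j ξ‖ ≤ 1 := by
  rcases eq_or_ne ξ 0 with rfl | hξ
  · simp [zt]
  have hn : 0 < ‖ξ‖ := norm_pos_iff.2 hξ
  have hpi := Real.pi_pos
  have h1 : ‖derivInvLaplaceSymbol j ξ‖ = 2 * Real.pi * |ξ j| / (2 * Real.pi * ‖ξ‖) ^ 2 := by
    rw [derivInvLaplaceSymbol, norm_div, Complex.norm_real, Real.norm_of_nonneg (by positivity)]
    congr 1
    simp [abs_of_pos hpi]
  have h2 : |ξ j| ≤ ‖ξ‖ := by simpa using PiLp.norm_apply_le ξ j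
  rw [h1, ← mul_div_assoc, div_le_one (by positivity), sq]
  exact mul_le_mul (zt_le ξ) (by gcongr) (by positivity) (by positivity)

lemma re_derivInvLaplaceSymbol (j : Fin 2) (ξ : Plane) : (derivInvLaplaceSymbol j ξ).re = 0 := by
  rw [derivInvLaplaceSymbol, Complex.div_ofReal_re]
  simp

lemma IsVelocity.zt_mul_le {f : L2} {u : Fin 2 → L2} (h : IsVelocity f u) (l : Fin 2) :
    ∀ᵐ ξ, zt ξ * ‖ft (cplx (u l)) ξ‖ ≤ ‖ft (cplx f) ξ‖ := by
  have key : ∀ (m z : ℂ) (c : ℝ), c * ‖m‖ ≤ 1 → c * ‖m * z‖ ≤ ‖z‖ := fun m z c hc => by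
    rw [norm_mul, ← mul_assoc]
    exact mul_le_of_le_one_left (norm_nonneg _) hc
  obtain ⟨h0, h1⟩ := h
  fin_cases l
  · filter_upwards [h0] with ξ hξ
    change zt ξ * ‖ft (cplx (u 0)) ξ‖ ≤ _
    rw [hξ]
    exact key _ _ _ (by rw [norm_neg]; exact norm_derivInvLaplaceSymbol_le 1 ξ)
  · filter_upwards [h1] with ξ hξ
    change zt ξ * ‖ft (cplx (u 1)) ξ‖ ≤ _
    rw [hξ]
    exact key _ _ _ (norm_derivInvLaplaceSymbol_le 0 ξ)

/-- The derivative `∂ₑ uₗ` of the velocity. -/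
def velGrad (u : Fin 2 → L2) (e l : Fin 2) : H := mulOp (psym e) (cplx (u l))

lemma IsVelocity.isPd {f : L2} {u : Fin 2 → L2} (h : IsVelocity f u) (e l : Fin 2) :
    IsPd e (cplx (u l)) (velGrad u e l) := by
  refine ft_mulOp ?_
  refine MemLp.of_le (Lp.memLp (ft (cplx f)))
    ((continuous_psym e).aestronglyMeasurable.mul (Lp.aestronglyMeasurable _)) ?_
  filter_upwards [h.zt_mul_le l] with ξ hξ
  rw [norm_mul]
  exact (mul_le_mul_of_nonneg_right (norm_psym_le_zt e ξ) (norm_nonneg _)).trans hξ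

lemma IsVelocity.norm_ft_velGrad_le {f : L2} {u : Fin 2 → L2} (h : IsVelocity f u) (e l : Fin 2) :
    ∀ᵐ ξ, ‖ft (velGrad u e l) ξ‖ ≤ ‖ft (cplx f) ξ‖ := by
  filter_upwards [h.zt_mul_le l, h.isPd e l] with ξ h1 h2
  rw [h2, norm_mul]
  exact (mul_le_mul_of_nonneg_right (norm_psym_le_zt e ξ) (norm_nonneg _)).trans h1

lemma IsVelocity.jacobianSupNorm_eq {f : L2} {u : Fin 2 → L2} (h : IsVelocity f u) :
    jacobianSupNorm u = ⨆ (e : Fin 2) (l : Fin 2), eLpNorm (velGrad u e l) ∞ volume := by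
  unfold jacobianSupNorm toDist
  simp only [(h.isPd _ _).pd_eq, distLpNorm_top_coe]

lemma IsVelocity.divFree {f : L2} {u : Fin 2 → L2} (h : IsVelocity f u) :
    velGrad u 0 0 + velGrad u 1 1 = 0 := by
  refine eq_of_ft_ae_eq ?_
  rw [ft_add]
  have hz : ft 0 = 0 := (Lp.fourierTransformₗᵢ Plane ℂ).map_zero
  rw [hz]
  filter_upwards [Lp.coeFn_add (ft (velGrad u 0 0)) (ft (velGrad u 1 1)), h.isPd 0 0, h.isPd 1 1,
    h.1, h.2, Lp.coeFn_zero ℂ 2 (volume : Measure Plane)] with ξ h1 h2 h3 h4 h5 h6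
  rw [h1, h6, Pi.add_apply, h2, h3, h4, h5, Pi.zero_apply]
  simp only [psym, derivInvLaplaceSymbol]
  ring

lemma snapshot_of_equation {β : ℝ} {f f' L : L2} {u g : Fin 2 → L2} (hu : IsVelocity f u)
    (hL : IsL1 f L) (hg : IsGradient f g) (hX : X 1 (cplx f) ≠ ∞)
    (heq : ∀ᵐ x, f' x + (u 0 x * g 0 x + u 1 x * g 1 x) = β * L x) :
    Snapshot β (cplx f) (cplx f') (cplx L) (fun l => cplx (u l)) (fun l => velGrad u l l)
      (fun l => cplx (g l)) where
  grad l := isPd_of_pd_eq (hg l)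
  vel := hu.zt_mul_le
  velReal l := isReal_cplx _
  velBdd := by
    choose C hC using fun l => exists_bdd_of_zt_mul_le (hu.zt_mul_le l) hX
    refine ⟨max (C 0) (C 1), fun l => ?_⟩
    fin_cases l
    · exact (hC 0).mono (le_max_left _ _)
    · exact (hC 1).mono (le_max_right _ _)
  velGrad l := hu.isPd l l
  divFree := hu.divFree
  skew := ⟨derivInvLaplaceSymbol 0, re_derivInvLaplaceSymbol 0, hL⟩
  eqn := by
    have hc : ∀ w : L2, ∀ᵐ x, cplx w x = ((w x : ℝ) : ℂ) := fun w =>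
      Complex.ofRealCLM.coeFn_compLp w
    filter_upwards [heq, hc f', hc L, hc (u 0), hc (u 1), hc (g 0), hc (g 1)]
      with x h h1 h2 h3 h4 h5 h6
    rw [h1, h2, h3, h4, h5, h6]
    exact_mod_cast congrArg (fun r : ℝ => (r : ℂ)) h

/-! ### The energy estimate at a fixed time. -/

/-- The word `0^a 1^b`. -/
def dirs (α : ℕ × ℕ) : List (Fin 2) := List.replicate α.1 0 ++ List.replicate α.2 1

@[simp] lemma length_dirs (α : ℕ × ℕ) : (dirs α).length = α.1 + α.2 := by simp [dirs]

lemma norm_wop_le_X (h : ℝ) (w : List (Fin 2)) {Ω : H} (hX : X w.length Ω ≠ ∞) :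
    ‖wop h (diffs w) Ω‖ ≤ (X w.length Ω).toReal := by
  rw [Lp.norm_def]
  refine ENNReal.toReal_mono hX (eLpNorm_le_X ?_)
  simpa using norm_ft_wop_le h (diffs w) Ω

/-- The count of multi-indices `j + 1`, of Leibniz terms `2^j`, and the interpolation constant
`(25/16)^j` fit together under `4^j`, because `2 (5/4)² = 25/8 < 4` leaves an exponential margin
`(32/25)^j` that absorbs `j + 1` by Bernoulli's inequality. The scale ratio `5/4` provides this
room. -/
lemma succ_mul_pow_le (j : ℕ) : ((j : ℝ) + 1) * (25 / 8) ^ j ≤ 4 * 4 ^ j := by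
  have h1 : 1 + (j : ℝ) * (7 / 25) ≤ (1 + 7 / 25) ^ j :=
    one_add_mul_le_pow (by norm_num) j
  have h2 : ((j : ℝ) + 1) ≤ 4 * (32 / 25) ^ j := by
    have e : (1 + 7 / 25 : ℝ) = 32 / 25 := by norm_num
    rw [e] at h1
    have : (0 : ℝ) ≤ j := Nat.cast_nonneg j
    linarith
  calc ((j : ℝ) + 1) * (25 / 8) ^ j ≤ 4 * (32 / 25) ^ j * (25 / 8) ^ j := by gcongr
    _ = 4 * 4 ^ j := by rw [mul_assoc, ← mul_pow]; norm_num

/-- The sum over all derivatives of order at most `k` in the energy estimate. -/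
lemma sum_abs_re_inner_le {β : ℝ} {f f' L : L2} {u g : Fin 2 → L2} (hu : IsVelocity f u)
    (hL : IsL1 f L) (hg : IsGradient f g) (hX1 : X 1 (cplx f) ≠ ∞)
    (heq : ∀ᵐ x, f' x + (u 0 x * g 0 x + u 1 x * g 1 x) = β * L x) {k : ℕ}
    (hE : energy k (cplx f) ≠ ∞) {A : ℝ} (hA : 0 < A)
    (hAle : jacobianSupNorm u + eLpNorm f ∞ volume ≤ ENNReal.ofReal A) (h : ℝ) :
    ∑ j ∈ Finset.range (k + 1), ∑ α ∈ Finset.HasAntidiagonal.antidiagonal j,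
      |(inner ℂ (wop h (diffs (dirs α)) (cplx f)) (wop h (diffs (dirs α)) (cplx f'))).re| ≤
      128 * C₀ * 4 ^ k * A * (energy k (cplx f)).toReal := by
  have S := snapshot_of_equation hu hL hg hX1 heq
  have hC := one_le_C₀
  have hsum := sum_X_sq_le k (cplx f)
  have hXfin : ∀ j ∈ Finset.range (k + 1), X j (cplx f) ≠ ∞ := fun j hj hcon => by
    have h1 := (Finset.single_le_sum (f := fun j => X j (cplx f) ^ 2) (fun _ _ => zero_le)
      hj).trans hsum
    simp only [hcon] at h1
    exact hE (top_le_iff.1 (by simpa using h1))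
  have hΩ : Bdd A (cplx f) := bdd_of_eLpNorm_top_le hA.le (by
    rw [eLpNorm_cplx]; exact le_add_self.trans hAle)
  have hUA : ∀ l e, Bdd A (dq h e (cplx (u l))) := fun l e => by
    refine Bdd.dq_of_isPd (hu.isPd e l) (bdd_of_eLpNorm_top_le hA.le ?_) h
    refine le_trans ?_ (le_self_add.trans hAle)
    rw [hu.jacobianSupNorm_eq]
    exact le_iSup₂ (f := fun e l => eLpNorm (velGrad u e l) ∞ volume) e l
  -- `32 = 2 * 16` comes from the two velocity components and the interpolation constant, and
  -- `(25/8)^j` from `2^j` terms of size `(25/16)^j`.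
  have hterm : ∀ j ∈ Finset.range (k + 1), ∀ α ∈ Finset.HasAntidiagonal.antidiagonal j,
      |(inner ℂ (wop h (diffs (dirs α)) (cplx f)) (wop h (diffs (dirs α)) (cplx f'))).re| ≤
        32 * C₀ * (25 / 8) ^ j * A * (X j (cplx f)).toReal ^ 2 := fun j hj α hα => by
    have hlen : (dirs α).length = j := by
      rw [length_dirs]; simpa using hα
    set x := (X j (cplx f)).toReal with hx
    have hx0 : 0 ≤ x := ENNReal.toReal_nonneg
    have hB := S.abs_re_inner_le h (dirs α) (16 * (25 / 16) ^ j * (C₀ * A) * x) (by positivity)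
      fun l O b hO hn => by
        refine (eLpNorm_commutator_term_le hA (S.vel l) (hUA l) hΩ (S.grad l) O b hO).trans
          (le_of_eq ?_)
        rw [hn, hlen, ENNReal.ofReal_mul (p := 16 * (25 / 16) ^ j * (C₀ * A)) (by positivity),
          hx, ENNReal.ofReal_toReal (hXfin j hj)]
    refine hB.trans ?_
    have hn := norm_wop_le_X h (dirs α) (Ω := cplx f) (by rw [hlen]; exact hXfin j hj)
    rw [hlen] at hn ⊢
    refine (mul_le_mul_of_nonneg_right hn (by positivity)).trans (le_of_eq ?_)
    rw [← hx, show (25 / 8 : ℝ) = 2 * (25 / 16) by norm_num, mul_pow]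
    ring
  calc _ ≤ ∑ j ∈ Finset.range (k + 1), 128 * C₀ * 4 ^ k * A * (X j (cplx f)).toReal ^ 2 := by
        refine Finset.sum_le_sum fun j hj => (Finset.sum_le_sum (hterm j hj)).trans ?_
        rw [Finset.sum_const, Finset.Nat.card_antidiagonal, nsmul_eq_mul]
        have h1 := succ_mul_pow_le j
        have h2 : (4 : ℝ) ^ j ≤ 4 ^ k :=
          pow_le_pow_right₀ (by norm_num) (by have := Finset.mem_range.1 hj; omega)
        have h3 : ((j : ℝ) + 1) * (25 / 8) ^ j ≤ 4 * 4 ^ k := h1.trans (by gcongr)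
        calc ((j + 1 : ℕ) : ℝ) * (32 * C₀ * (25 / 8) ^ j * A * (X j (cplx f)).toReal ^ 2)
            = 32 * C₀ * (((j : ℝ) + 1) * (25 / 8) ^ j) * A * (X j (cplx f)).toReal ^ 2 := by
              push_cast; ring
          _ ≤ 32 * C₀ * (4 * 4 ^ k) * A * (X j (cplx f)).toReal ^ 2 := by gcongr
          _ = _ := by ring
    _ = 128 * C₀ * 4 ^ k * A * (∑ j ∈ Finset.range (k + 1), X j (cplx f) ^ 2).toReal := by
        rw [← Finset.mul_sum, ENNReal.toReal_sum fun j hj => ENNReal.pow_ne_top (hXfin j hj)]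
        simp only [ENNReal.toReal_pow]
    _ ≤ _ := by
        refine mul_le_mul_of_nonneg_left (ENNReal.toReal_mono hE hsum) (by positivity)

/-- The pairing of the equation with the solution vanishes. -/
lemma re_inner_eq_zero {β : ℝ} {f f' L : L2} {u g : Fin 2 → L2} (hu : IsVelocity f u)
    (hL : IsL1 f L) (hg : IsGradient f g) (hX1 : X 1 (cplx f) ≠ ∞)
    (heq : ∀ᵐ x, f' x + (u 0 x * g 0 x + u 1 x * g 1 x) = β * L x) :
    (inner ℂ (cplx f) (cplx f')).re = 0 := by
  have S := snapshot_of_equation hu hL hg hX1 heq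
  -- The empty word has no commutator terms: `1 ≤ deg O` contradicts a total order of `0`. The bound
  -- `B = 0` is therefore admissible.
  have := S.abs_re_inner_le 1 [] 0 le_rfl fun l O b hO hn => by
    simp only [List.length_nil] at hn
    omega
  simpa [diffs, wop_nil] using this

/-! ### Grönwall's inequality. -/

section Gronwall

variable {e b : ℝ → ℝ} {T : ℝ}

/-- At a point `r` where `e` is maximal on `[s, t]` the integral inequality reads `e r ≤ e s + δ * e
r`, and `e t ≤ e r`. -/
lemma gronwall_step {s t δ : ℝ} (hs : 0 ≤ s) (hst : s ≤ t) (ht : t ≤ T)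
    (he : ContinuousOn e (Icc 0 T)) (he0 : ∀ r ∈ Icc 0 T, 0 ≤ e r)
    (hb : IntegrableOn b (Icc 0 T)) (hb0 : ∀ r, 0 ≤ b r)
    (hle : ∀ s t, 0 ≤ s → s ≤ t → t ≤ T → e t ≤ e s + ∫ r in s..t, b r * e r)
    (hδ : ∫ r in s..t, b r ≤ δ) (hδ1 : δ < 1) : e t * (1 - δ) ≤ e s := by
  have hsub : Icc s t ⊆ Icc 0 T := Icc_subset_Icc hs ht
  obtain ⟨r, hr, hmax⟩ := isCompact_Icc.exists_isMaxOn (nonempty_Icc.2 hst) (he.mono hsub)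
  have hM0 : 0 ≤ e r := he0 r (hsub hr)
  have hsr : Icc s r ⊆ Icc 0 T := Icc_subset_Icc hs (hr.2.trans ht)
  have hbi : IntervalIntegrable b volume s r :=
    (intervalIntegrable_iff_integrableOn_Icc_of_le hr.1).2 (hb.mono_set hsr)
  have hbi' : IntervalIntegrable b volume s t :=
    (intervalIntegrable_iff_integrableOn_Icc_of_le hst).2 (hb.mono_set hsub)
  have hbe : IntervalIntegrable (fun x => b x * e x) volume s r := by
    refine (intervalIntegrable_iff_integrableOn_Icc_of_le hr.1).2 ?_
    exact (hb.mono_set hsr).mul_continuousOn (he.mono hsr) isCompact_Icc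
  have h1 : ∫ x in s..r, b x * e x ≤ ∫ x in s..r, b x * e r := by
    refine intervalIntegral.integral_mono_on hr.1 hbe (hbi.mul_const _) fun x hx => ?_
    exact mul_le_mul_of_nonneg_left (hmax ⟨hx.1, hx.2.trans hr.2⟩) (hb0 x)
  rw [intervalIntegral.integral_mul_const] at h1
  have h2 : ∫ x in s..r, b x ≤ ∫ x in s..t, b x :=
    intervalIntegral.integral_mono_interval le_rfl hr.1 hr.2
      (Eventually.of_forall fun x => hb0 x) hbi'
  have h3 := hle s r hs hr.1 (hr.2.trans ht)
  have h4 : e t ≤ e r := hmax ⟨hst, le_rfl⟩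
  have h5 : (∫ x in s..r, b x) * e r ≤ δ * e r := by gcongr; exact h2.trans hδ
  nlinarith

/-- Grönwall's inequality with an integrable coefficient. -/
lemma gronwall_integral (hT : 0 ≤ T)
    (he : ContinuousOn e (Icc 0 T)) (he0 : ∀ r ∈ Icc 0 T, 0 ≤ e r)
    (hb : IntegrableOn b (Icc 0 T)) (hb0 : ∀ r, 0 ≤ b r)
    (hle : ∀ s t, 0 ≤ s → s ≤ t → t ≤ T → e t ≤ e s + ∫ r in s..t, b r * e r) :
    e T ≤ e 0 * Real.exp (∫ r in 0..T, b r) := by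
  have hint : ∀ s t, s ∈ Icc 0 T → t ∈ Icc 0 T → IntervalIntegrable b volume s t :=
    fun s t hs ht => by
      rw [intervalIntegrable_iff]
      refine hb.mono_set ?_
      exact uIoc_subset_uIcc.trans ((uIcc_subset_Icc hs ht))
  set I : ℝ := ∫ r in 0..T, b r with hI
  have hBcont : ContinuousOn (fun t => ∫ r in 0..t, b r) (Icc 0 T) := by
    have := intervalIntegral.continuousOn_primitive_interval (μ := volume) (f := b) (a := 0) (b := T)
      (by rwa [uIcc_of_le hT])
    rwa [uIcc_of_le hT] at this
  -- The interval is cut by the intermediate value theorem into pieces on which `b` has integral at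
  -- most `δ`, each costing a factor `1 - δ`. With `n` pieces and `δ = I / n` the factors tend to
  -- `exp (-I)`.
  have key : ∀ (δ : ℝ), 0 ≤ δ → δ < 1 → ∀ i : ℕ, ∀ t ∈ Icc 0 T, ∫ r in 0..t, b r ≤ i * δ →
      e t * (1 - δ) ^ i ≤ e 0 := fun δ hδ0 hδ1 i => by
    induction i with
    | zero =>
      intro t ht hB
      simpa using gronwall_step le_rfl ht.1 ht.2 he he0 hb hb0 hle (δ := 0) (by simpa using hB)
        one_pos
    | succ i ih =>
      intro t ht hB
      rcases le_or_gt (∫ r in 0..t, b r) (i * δ) with h | h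
      · refine le_trans ?_ (ih t ht h)
        refine mul_le_mul_of_nonneg_left ?_ (he0 t ht)
        exact pow_le_pow_of_le_one (by linarith) (by linarith) (Nat.le_succ i)
      · obtain ⟨s, hs, hsB⟩ := intermediate_value_Icc ht.1
          (hBcont.mono (Icc_subset_Icc le_rfl ht.2))
          (show (i : ℝ) * δ ∈ Icc (∫ r in (0 : ℝ)..0, b r) (∫ r in 0..t, b r) from
            ⟨by simp only [intervalIntegral.integral_same]; positivity, h.le⟩)
        have hs' : s ∈ Icc 0 T := ⟨hs.1, hs.2.trans ht.2⟩
        have h0 : (0 : ℝ) ∈ Icc 0 T := ⟨le_rfl, hT⟩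
        have hadd := intervalIntegral.integral_add_adjacent_intervals (hint 0 s h0 hs')
          (hint s t hs' ht)
        simp only at hsB
        have hst := gronwall_step hs.1 hs.2 ht.2 he he0 hb hb0 hle (δ := δ)
          (by push_cast at hB; linarith) hδ1
        calc e t * (1 - δ) ^ (i + 1) = e t * (1 - δ) * (1 - δ) ^ i := by ring
          _ ≤ e s * (1 - δ) ^ i := by
              refine mul_le_mul_of_nonneg_right hst (pow_nonneg (by linarith) i)
          _ ≤ e 0 := ih s hs' hsB.le
  have hI0 : 0 ≤ I := intervalIntegral.integral_nonneg hT fun r _ => hb0 r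
  have hlim : Tendsto (fun n : ℕ => e T * (1 + -I / n) ^ n) atTop (𝓝 (e T * Real.exp (-I))) :=
    (Real.tendsto_one_add_div_pow_exp (-I)).const_mul _
  have hfin : e T * Real.exp (-I) ≤ e 0 := by
    refine le_of_tendsto hlim ?_
    obtain ⟨n₀, hn₀⟩ := exists_nat_gt I
    filter_upwards [eventually_ge_atTop (n₀ + 1)] with n hn
    have hn1 : I < n := hn₀.trans (by exact_mod_cast (Nat.lt_of_succ_le hn))
    have hn0 : (0 : ℝ) < n := hI0.trans_lt hn1
    have := key (I / n) (by positivity) ((div_lt_one hn0).2 hn1) n T ⟨hT, le_rfl⟩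
      (by rw [mul_div_cancel₀ _ hn0.ne'])
    rwa [neg_div, ← sub_eq_add_neg]
  calc e T = e T * Real.exp (-I) * Real.exp I := by
        rw [mul_assoc, ← Real.exp_add, neg_add_cancel, Real.exp_zero, mul_one]
    _ ≤ e 0 * Real.exp I := by gcongr

end Gronwall

/-! ### Measurability in time and passage to the limit. -/

/-- Sublevel sets are closed because `L²` limits keep essential bounds. Hence the `L^∞` norm of a
curve continuous in `L²` is measurable in time. -/
lemma lowerSemicontinuous_eLpNorm_top :
    LowerSemicontinuous fun f : H => eLpNorm f ∞ (volume : Measure Plane) := by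
  rw [lowerSemicontinuous_iff_isClosed_preimage]
  refine fun c => IsSeqClosed.isClosed fun f g hf hg => ?_
  rcases eq_or_ne c ∞ with rfl | hc
  · simp
  have h1 : ∀ n, Bdd c.toReal (f n) := fun n =>
    bdd_of_eLpNorm_top_le ENNReal.toReal_nonneg (by rw [ENNReal.ofReal_toReal hc]; exact hf n)
  have h2 := Bdd.of_tendsto h1 hg
  have h3 := eLpNormEssSup_le_of_ae_bound h2
  rw [ENNReal.ofReal_toReal hc] at h3
  simpa [eLpNorm_exponent_top] using h3

lemma aemeasurable_eLpNorm_top {F : ℝ → H} {s : Set ℝ} (hs : MeasurableSet s)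
    (hF : ContinuousOn F s) :
    AEMeasurable (fun t => eLpNorm (F t) ∞ (volume : Measure Plane)) (volume.restrict s) := by
  refine aemeasurable_restrict_of_measurable_subtype hs ?_
  exact (lowerSemicontinuous_eLpNorm_top.comp
    (continuousOn_iff_continuous_domRestrict.1 hF)).measurable

section DifferentialInequality

variable {T c : ℝ} {A : ℝ → ℝ≥0∞} {e : ℝ → ℝ} {N N' : ℕ → ℝ → ℝ}

/-- A differential inequality passes to the limit in its integrated form. -/
lemma le_add_integral_of_tendsto (hA : AEMeasurable A (volume.restrict (Icc 0 T)))
    (hAfin : ∫⁻ t in Icc 0 T, A t ≠ ∞) (he : ContinuousOn e (Icc 0 T))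
    (hlim : ∀ t ∈ Icc 0 T, Tendsto (fun n => N n t) atTop (𝓝 (e t)))
    (hN : ∀ n, ∀ t ∈ Icc 0 T, HasDerivWithinAt (N n) (N' n t) (Icc 0 T) t)
    (hle : ∀ n, ∀ t ∈ Icc 0 T, ∀ a : ℝ, 0 < a → A t ≤ ENNReal.ofReal a → N' n t ≤ c * a * e t)
    {s t : ℝ} (hs : 0 ≤ s) (hst : s ≤ t) (ht : t ≤ T) :
    e t ≤ e s + ∫ r in s..t, c * (A r).toReal * e r := by
  have hsub : Icc s t ⊆ Icc 0 T := Icc_subset_Icc hs ht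
  have ha : IntegrableOn (fun r => (A r).toReal) (Icc 0 T) := integrable_toReal_of_lintegral_ne_top hA hAfin
  have hint : IntegrableOn (fun r => c * (A r).toReal * e r) (Icc s t) :=
    (IntegrableOn.mono_set (ha.const_mul c) hsub).mul_continuousOn (he.mono hsub) isCompact_Icc
  have hfin : ∀ᵐ r ∂volume.restrict (Icc s t), A r < ∞ :=
    ae_mono (Measure.restrict_mono hsub le_rfl) (ae_lt_top' hA hAfin)
  -- The hypothesis admits only positive `a`; taking `a = A r + ε` and letting `ε → 0` covers `A r =
  -- 0`.
  have hbd : ∀ n, ∀ r ∈ Icc 0 T, A r < ∞ → N' n r ≤ c * (A r).toReal * e r := fun n r hr hAr => by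
    have h1 : Tendsto (fun ε : ℝ => c * ((A r).toReal + ε) * e r) (𝓝[>] 0)
        (𝓝 (c * ((A r).toReal + 0) * e r)) := by
      refine Tendsto.mono_left ?_ nhdsWithin_le_nhds
      exact Continuous.tendsto (by fun_prop) 0
    rw [add_zero] at h1
    refine ge_of_tendsto h1 ?_
    filter_upwards [self_mem_nhdsWithin] with ε hε
    have hε : 0 < ε := hε
    refine hle n r hr _ (by positivity) ?_
    rw [← ENNReal.ofReal_toReal hAr.ne]
    refine ENNReal.ofReal_le_ofReal ?_
    rw [ENNReal.toReal_ofReal ENNReal.toReal_nonneg]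
    linarith
  have key : ∀ n, N n t - N n s ≤ ∫ r in s..t, c * (A r).toReal * e r := fun n => by
    classical
    -- The majorant of the derivative is needed at every interior point, but `A` may be infinite on
    -- a null set; there `φ` is the derivative itself, which does not change its integral.
    set φ : ℝ → ℝ := fun r => if A r < ∞ then c * (A r).toReal * e r else N' n r
    have hφ : φ =ᵐ[volume.restrict (Icc s t)] fun r => c * (A r).toReal * e r := by
      filter_upwards [hfin] with r hr
      exact if_pos hr
    have h1 := intervalIntegral.sub_le_integral_of_hasDeriv_right_of_le (g := N n) (g' := N' n)
      (φ := φ) hst (fun r hr => (hN n r (hsub hr)).continuousWithinAt.mono hsub)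
      (fun r hr => ((hN n r (hsub (Ioo_subset_Icc_self hr))).hasDerivAt
        (Icc_mem_nhds (hs.trans_lt hr.1) (hr.2.trans_le ht))).hasDerivWithinAt)
      (hint.congr hφ.symm) (fun r hr => by
        simp only [φ]
        split_ifs with h
        · exact hbd n r (hsub (Ioo_subset_Icc_self hr)) h
        · exact le_rfl)
    refine h1.trans (le_of_eq ?_)
    rw [intervalIntegral.integral_of_le hst, intervalIntegral.integral_of_le hst]
    exact integral_congr_ae (ae_mono (Measure.restrict_mono Ioc_subset_Icc_self le_rfl) hφ)
  have h2 := le_of_tendsto' ((hlim t ⟨hs.trans hst, ht⟩).sub (hlim s ⟨hs, hst.trans ht⟩)) key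
  linarith

end DifferentialInequality

/-! ### Derivatives as `L²` functions and as limits of difference quotients. -/

lemma eLpNorm_sq_le_energy {k : ℕ} {α : ℕ × ℕ} (hα : α.1 + α.2 ≤ k) (Ω : H) :
    eLpNorm (fun ξ => asym α ξ * ft Ω ξ) 2 volume ^ 2 ≤ energy k Ω := by
  unfold energy
  refine le_trans ?_ (Finset.single_le_sum (fun _ _ => zero_le)
    (Finset.mem_range.2 (Nat.lt_succ_of_le hα)))
  exact Finset.single_le_sum (f := fun α => eLpNorm (fun ξ => asym α ξ * ft Ω ξ) 2 volume ^ 2)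
    (fun _ _ => zero_le) (Finset.HasAntidiagonal.mem_antidiagonal.2 rfl)

lemma memLp_asym_mul {k : ℕ} {α : ℕ × ℕ} (hα : α.1 + α.2 ≤ k) {Ω : H} (hE : energy k Ω ≠ ∞) :
    MemLp (fun ξ => asym α ξ * ft Ω ξ) 2 volume := by
  refine ⟨(continuous_asym α).aestronglyMeasurable.mul (Lp.aestronglyMeasurable _), ?_⟩
  have h := (eLpNorm_sq_le_energy hα Ω).trans_lt (lt_top_iff_ne_top.2 hE)
  contrapose! h
  rw [top_le_iff.1 h]
  simp

lemma enorm_mulOp {m : Plane → ℂ} {Ω : H} (h : MemLp (fun ξ => m ξ * ft Ω ξ) 2 volume) :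
    ‖mulOp m Ω‖ₑ = eLpNorm (fun ξ => m ξ * ft Ω ξ) 2 volume := by
  rw [Lp.enorm_def, ← eLpNorm_ft]
  exact eLpNorm_congr_ae (ft_mulOp h)

lemma toReal_energy {k : ℕ} {Ω : H} (hE : energy k Ω ≠ ∞) :
    (energy k Ω).toReal = ∑ j ∈ Finset.range (k + 1), ∑ α ∈ Finset.HasAntidiagonal.antidiagonal j,
      ‖mulOp (asym α) Ω‖ ^ 2 := by
  have hα : ∀ j ∈ Finset.range (k + 1), ∀ α ∈ Finset.HasAntidiagonal.antidiagonal j,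
      MemLp (fun ξ => asym α ξ * ft Ω ξ) 2 volume := fun j hj α hα =>
    memLp_asym_mul (by
      rw [Finset.HasAntidiagonal.mem_antidiagonal.1 hα]; exact Nat.lt_succ_iff.1 (Finset.mem_range.1 hj)) hE
  unfold energy
  rw [ENNReal.toReal_sum fun j hj => ENNReal.sum_ne_top.2 fun α h =>
    ENNReal.pow_ne_top (hα j hj α h).2.ne]
  refine Finset.sum_congr rfl fun j hj => ?_
  rw [ENNReal.toReal_sum fun α h => ENNReal.pow_ne_top (hα j hj α h).2.ne]
  refine Finset.sum_congr rfl fun α h => ?_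
  rw [ENNReal.toReal_pow, ← enorm_mulOp (hα j hj α h), toReal_enorm]

lemma mulOp_sub {m : Plane → ℂ} {f g : H} (hf : MemLp (fun ξ => m ξ * ft f ξ) 2 volume)
    (hg : MemLp (fun ξ => m ξ * ft g ξ) 2 volume) :
    mulOp m f - mulOp m g = mulOp m (f - g) := by
  have hsub : (fun ξ => m ξ * ft (f - g) ξ) =ᵐ[volume]
      (fun ξ => m ξ * ft f ξ) - fun ξ => m ξ * ft g ξ := by
    rw [ft_sub]
    filter_upwards [Lp.coeFn_sub (ft f) (ft g)] with ξ h
    rw [h, Pi.sub_apply, Pi.sub_apply, mul_sub]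
  have hfg : MemLp (fun ξ => m ξ * ft (f - g) ξ) 2 volume := (hf.sub hg).ae_eq hsub.symm
  refine eq_of_ft_ae_eq ?_
  rw [ft_sub]
  filter_upwards [Lp.coeFn_sub (ft (mulOp m f)) (ft (mulOp m g)), ft_mulOp hf, ft_mulOp hg,
    ft_mulOp hfg, hsub] with ξ h1 h2 h3 h4 h5
  rw [h1, Pi.sub_apply, h2, h3, h4, h5, Pi.sub_apply]

lemma wsym_diffs_append (h : ℝ) (v w : List (Fin 2)) (ξ : Plane) :
    wsym h (diffs (v ++ w)) ξ = wsym h (diffs v) ξ * wsym h (diffs w) ξ := by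
  induction v with
  | nil => simp [diffs, wsym]
  | cons e v ih =>
    rw [List.cons_append, diffs_cons, diffs_cons]
    simp only [wsym, ih]
    ring

lemma wsym_diffs_replicate (h : ℝ) (a : ℕ) (e : Fin 2) (ξ : Plane) :
    wsym h (diffs (List.replicate a e)) ξ = dsym h e ξ ^ a := by
  induction a with
  | zero => simp [diffs, wsym]
  | succ a ih =>
    rw [List.replicate_succ, diffs_cons]
    simp only [wsym, ih, lsym, pow_succ]

lemma wsym_diffs_dirs (h : ℝ) (α : ℕ × ℕ) (ξ : Plane) :
    wsym h (diffs (dirs α)) ξ = dsym h 0 ξ ^ α.1 * dsym h 1 ξ ^ α.2 := by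
  rw [dirs, wsym_diffs_append, wsym_diffs_replicate, wsym_diffs_replicate]

/-- Difference quotients converge to derivatives. -/
lemma tendsto_wop_dirs {α : ℕ × ℕ} {Ω : H}
    (hΩ : MemLp (fun ξ => asym α ξ * ft Ω ξ) 2 volume) {δ : ℕ → ℝ}
    (hδ : Tendsto δ atTop (𝓝[≠] 0)) :
    Tendsto (fun n => wop (δ n) (diffs (dirs α)) Ω) atTop (𝓝 (mulOp (asym α) Ω)) := by
  refine tendsto_of_ft (tendsto_of_dominated (fun ξ => ‖asym α ξ * ft Ω ξ‖) hΩ.norm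
    (fun n => ?_) ?_)
  · filter_upwards [ft_wop (δ n) (diffs (dirs α)) Ω] with ξ h1
    rw [h1, wsym_diffs_dirs, norm_mul, norm_mul, asym, norm_mul, norm_mul, norm_pow, norm_pow,
      norm_pow, norm_pow, norm_psym, norm_psym]
    gcongr <;> exact norm_dsym_le _ _ _
  · filter_upwards [ft_mulOp hΩ,
      ae_all_iff.2 fun n => ft_wop (δ n) (diffs (dirs α)) Ω] with ξ h1 h2
    simp only [h1, h2, wsym_diffs_dirs]
    exact (((tendsto_dsym 0 ξ hδ).pow _).mul ((tendsto_dsym 1 ξ hδ).pow _)).mul_const _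

/-- The map from vorticity to velocity gradient is linear with symbol of modulus at most one.
Continuity of `ω` in `L²` therefore carries over to `∇u`, which gives measurability of `‖Du‖_{L^∞}`
in time. -/
lemma velGrad_sub_le {f f' : L2} {u u' : Fin 2 → L2} (h : IsVelocity f u) (h' : IsVelocity f' u')
    (e l : Fin 2) : ‖velGrad u e l - velGrad u' e l‖ ≤ ‖cplx f - cplx f'‖ := by
  have hs : cplx f - cplx f' = cplx (f - f') :=
    (map_sub (Complex.ofRealCLM.compLpL 2 (volume : Measure Plane)) f f').symm
  have hsu : ∀ l, cplx (u l) - cplx (u' l) = cplx (u l - u' l) := fun l =>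
    (map_sub (Complex.ofRealCLM.compLpL 2 (volume : Measure Plane)) (u l) (u' l)).symm
  have hv : IsVelocity (f - f') (fun l => u l - u' l) := by
    have hm : ∀ (m : Plane → ℂ) (l : Fin 2), HasMultiplier m f (u l) → HasMultiplier m f' (u' l) →
        HasMultiplier m (f - f') (u l - u' l) := fun m l h1 h2 => by
      change ft (cplx (u l - u' l)) =ᵐ[volume] fun ξ => m ξ * ft (cplx (f - f')) ξ
      have h1 : ft (cplx (u l)) =ᵐ[volume] fun ξ => m ξ * ft (cplx f) ξ := h1
      have h2 : ft (cplx (u' l)) =ᵐ[volume] fun ξ => m ξ * ft (cplx f') ξ := h2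
      rw [← hs, ← hsu, ft_sub, ft_sub]
      filter_upwards [h1, h2, Lp.coeFn_sub (ft (cplx (u l))) (ft (cplx (u' l))),
        Lp.coeFn_sub (ft (cplx f)) (ft (cplx f'))] with ξ h1 h2 h3 h4
      rw [h3, h4, Pi.sub_apply, Pi.sub_apply, h1, h2, mul_sub]
    exact ⟨hm _ 0 h.1 h'.1, hm _ 1 h.2 h'.2⟩
  have he : velGrad u e l - velGrad u' e l = velGrad (fun l => u l - u' l) e l := by
    refine eq_of_ft_ae_eq ?_
    have h3 := hv.isPd e l
    rw [IsPd, ← hsu, ft_sub] at h3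
    rw [ft_sub]
    filter_upwards [h.isPd e l, h'.isPd e l, h3,
      Lp.coeFn_sub (ft (velGrad u e l)) (ft (velGrad u' e l)),
      Lp.coeFn_sub (ft (cplx (u l))) (ft (cplx (u' l)))] with ξ h1 h2 h3 h4 h5
    rw [h4, h3, h5, Pi.sub_apply, Pi.sub_apply, h1, h2, mul_sub]
  rw [he, hs, ← norm_ft, ← norm_ft (cplx (f - f'))]
  exact Lp.norm_le_norm_of_ae_le (hv.norm_ft_velGrad_le e l)

lemma cplx_sub (f g : L2) : cplx (f - g) = cplx f - cplx g :=
  map_sub (Complex.ofRealCLM.compLpL 2 (volume : Measure Plane)) f g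

lemma hasDerivWithinAt_cplx {f : ℝ → L2} {f' : L2} {s : Set ℝ} {t : ℝ}
    (h : HasDerivWithinAt f f' s t) :
    HasDerivWithinAt (fun t => cplx (f t)) (cplx f') s t :=
  (Complex.ofRealCLM.compLpL 2 (volume : Measure Plane)).hasFDerivAt.comp_hasDerivWithinAt t h

lemma hasDerivWithinAt_norm_sq {F : ℝ → H} {F' : H} {s : Set ℝ} {t : ℝ}
    (h : HasDerivWithinAt F F' s t) :
    HasDerivWithinAt (fun t => ‖F t‖ ^ 2) (2 * (inner ℂ (F t) F').re) s t := by
  have h1 := Complex.reCLM.hasFDerivAt.comp_hasDerivWithinAt t (h.inner ℂ h)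
  have h2 : (2 * (inner ℂ (F t) F').re) = Complex.reCLM (inner ℂ (F t) F' + inner ℂ F' (F t)) := by
    have h3 : (inner ℂ F' (F t)).re = (inner ℂ (F t) F').re := inner_re_symm (𝕜 := ℂ) F' (F t)
    rw [Complex.reCLM_apply, Complex.add_re, h3, two_mul]
  rw [h2]
  refine h1.congr (fun r _ => ?_) ?_
  · exact (inner_self_eq_norm_sq (𝕜 := ℂ) (F r)).symm
  · exact (inner_self_eq_norm_sq (𝕜 := ℂ) (F t)).symm

/-! ### The energy inequality along a solution. -/

namespace IsSolution

variable {β : ℝ} {m k : ℕ} {T : ℝ} {ω : ℝ → L2} {u : ℝ → Fin 2 → L2}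

lemma energy_ne_top (h : IsSolution β m T ω u) (hk : k ≤ m) {t : ℝ} (ht : t ∈ Icc 0 T) :
    energy k (cplx (ω t)) ≠ ∞ := by
  have h1 := h.memSobolev t ht
  rw [sobolevNorm_eq] at h1
  refine ne_top_of_le_ne_top ?_ (energy_mono hk _)
  contrapose! h1
  rw [h1, ENNReal.top_rpow_of_pos (by norm_num)]

lemma X_one_ne_top (h : IsSolution β m T ω u) (hm : 1 ≤ m) {t : ℝ} (ht : t ∈ Icc 0 T) :
    X 1 (cplx (ω t)) ≠ ∞ := by
  have h1 : X 1 (cplx (ω t)) ^ 2 ≤ energy m (cplx (ω t)) :=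
    (Finset.single_le_sum (f := fun j => X j (cplx (ω t)) ^ 2) (fun _ _ => zero_le)
      (Finset.mem_range.2 (Nat.lt_succ_of_le hm))).trans (sum_X_sq_le m _)
  intro h2
  rw [h2] at h1
  exact h.energy_ne_top le_rfl ht (top_le_iff.1 (by simpa using h1))

lemma continuousOn_cplx (h : IsSolution β m T ω u) :
    ContinuousOn (fun t => cplx (ω t)) (Icc 0 T) := fun t ht => by
  obtain ⟨ω', _, _, h1, _⟩ := h.equation t ht
  exact (hasDerivWithinAt_cplx h1).continuousWithinAt

lemma continuousOn_mulOp (h : IsSolution β m T ω u) {α : ℕ × ℕ} (hα : α.1 + α.2 ≤ m) :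
    ContinuousOn (fun t => mulOp (asym α) (cplx (ω t))) (Icc 0 T) := fun t ht => by
  rw [ContinuousWithinAt, tendsto_iff_edist_tendsto_0]
  refine tendsto_of_tendsto_of_tendsto_of_le_of_le' tendsto_const_nhds (h.continuous t ht)
    (Eventually.of_forall fun _ => zero_le) ?_
  filter_upwards [self_mem_nhdsWithin] with s hs
  have h1 := memLp_asym_mul hα (h.energy_ne_top le_rfl hs)
  have h2 := memLp_asym_mul hα (h.energy_ne_top le_rfl ht)
  have h3 : MemLp (fun ξ => asym α ξ * ft (cplx (ω s) - cplx (ω t)) ξ) 2 volume := by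
    refine (h1.sub h2).ae_eq ?_
    rw [ft_sub]
    filter_upwards [Lp.coeFn_sub (ft (cplx (ω s))) (ft (cplx (ω t)))] with ξ h
    rw [h, Pi.sub_apply, Pi.sub_apply, mul_sub]
  rw [edist_eq_enorm_sub, mulOp_sub h1 h2, enorm_mulOp h3, sobolevNorm_eq, cplx_sub]
  calc _ = (eLpNorm (fun ξ => asym α ξ * ft (cplx (ω s) - cplx (ω t)) ξ) 2 volume ^ 2) ^
        (1 / 2 : ℝ) := by
        rw [← ENNReal.rpow_natCast, ← ENNReal.rpow_mul]
        norm_num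
    _ ≤ _ := ENNReal.rpow_le_rpow (eLpNorm_sq_le_energy hα _) (by norm_num)

lemma continuousOn_energy (h : IsSolution β m T ω u) (hk : k ≤ m) :
    ContinuousOn (fun t => (energy k (cplx (ω t))).toReal) (Icc 0 T) := by
  have h1 : ContinuousOn (fun t => ∑ j ∈ Finset.range (k + 1),
      ∑ α ∈ Finset.HasAntidiagonal.antidiagonal j, ‖mulOp (asym α) (cplx (ω t))‖ ^ 2)
      (Icc 0 T) := by
    refine continuousOn_finsetSum _ fun j hj => continuousOn_finsetSum _ fun α hα => ?_
    refine (h.continuousOn_mulOp ?_).norm.pow 2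
    rw [(Finset.HasAntidiagonal.mem_antidiagonal.1 hα)]
    exact (Nat.lt_succ_iff.1 (Finset.mem_range.1 hj)).trans hk
  exact h1.congr fun t ht => toReal_energy (h.energy_ne_top hk ht)

lemma aemeasurable (h : IsSolution β m T ω u) :
    AEMeasurable (fun t => jacobianSupNorm (u t) + eLpNorm (ω t) ∞ volume)
      (volume.restrict (Icc 0 T)) := by
  have h1 : ∀ e l, ContinuousOn (fun t => velGrad (u t) e l) (Icc 0 T) := fun e l t ht => by
    have h2 := tendsto_iff_norm_sub_tendsto_zero.1 (h.continuousOn_cplx t ht)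
    refine tendsto_iff_norm_sub_tendsto_zero.2 ?_
    refine tendsto_of_tendsto_of_tendsto_of_le_of_le' tendsto_const_nhds h2
      (Eventually.of_forall fun _ => norm_nonneg _) ?_
    filter_upwards [self_mem_nhdsWithin] with s hs
    exact velGrad_sub_le (h.velocity s hs) (h.velocity t ht) e l
  have h3 : AEMeasurable (fun t => (⨆ (e : Fin 2) (l : Fin 2), eLpNorm (velGrad (u t) e l) ∞ volume) +
      eLpNorm (cplx (ω t)) ∞ volume) (volume.restrict (Icc 0 T)) :=
    (AEMeasurable.iSup fun e => AEMeasurable.iSup fun l =>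
      aemeasurable_eLpNorm_top measurableSet_Icc (h1 e l)).add
      (aemeasurable_eLpNorm_top measurableSet_Icc h.continuousOn_cplx)
  refine h3.congr ?_
  filter_upwards [ae_restrict_mem measurableSet_Icc] with t ht
  rw [(h.velocity t ht).jacobianSupNorm_eq, eLpNorm_cplx]

/-- The energies of difference quotients are differentiable in time, since words act as bounded
operators on `L²`. Their integrated inequality survives the limit of vanishing step, and Grönwall
applies. Differentiating a square doubles `128` to `256`. -/
lemma energy_le (h : IsSolution β m T ω u) (hm : 1 ≤ m) (hk : k ≤ m) (hT : 0 ≤ T)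
    (hfin : ∫⁻ t in Icc 0 T, (jacobianSupNorm (u t) + eLpNorm (ω t) ∞ volume) ≠ ∞) :
    (energy k (cplx (ω T))).toReal ≤ (energy k (cplx (ω 0))).toReal *
      Real.exp (256 * C₀ * 4 ^ k *
        (∫⁻ t in Icc 0 T, (jacobianSupNorm (u t) + eLpNorm (ω t) ∞ volume)).toReal) := by
  set A : ℝ → ℝ≥0∞ := fun t => jacobianSupNorm (u t) + eLpNorm (ω t) ∞ volume with hA
  have hAm : AEMeasurable A (volume.restrict (Icc 0 T)) := h.aemeasurable
  have hC := one_le_C₀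
  choose! ω' L g hω' hL hg heq using h.equation
  have hX := fun t ht => h.X_one_ne_top hm (t := t) ht
  set δ : ℕ → ℝ := fun n => 1 / ((n : ℝ) + 1) with hδdef
  have hδ : Tendsto δ atTop (𝓝[≠] 0) :=
    tendsto_nhdsWithin_iff.2 ⟨tendsto_one_div_add_atTop_nhds_zero_nat,
      Eventually.of_forall fun n => (Nat.one_div_pos_of_nat (α := ℝ)).ne'⟩
  have hle : ∀ s t, 0 ≤ s → s ≤ t → t ≤ T → (energy k (cplx (ω t))).toReal ≤
      (energy k (cplx (ω s))).toReal +
        ∫ r in s..t, 256 * C₀ * 4 ^ k * (A r).toReal * (energy k (cplx (ω r))).toReal :=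
    fun s t hs hst ht => by
      refine le_add_integral_of_tendsto
        (N := fun n t => ∑ j ∈ Finset.range (k + 1), ∑ α ∈ Finset.HasAntidiagonal.antidiagonal j,
          ‖wop (δ n) (diffs (dirs α)) (cplx (ω t))‖ ^ 2)
        (N' := fun n t => ∑ j ∈ Finset.range (k + 1), ∑ α ∈ Finset.HasAntidiagonal.antidiagonal j,
          2 * (inner ℂ (wop (δ n) (diffs (dirs α)) (cplx (ω t)))
            (wop (δ n) (diffs (dirs α)) (cplx (ω' t)))).re)
        hAm hfin (h.continuousOn_energy hk) (fun t ht => ?_) (fun n t ht => ?_)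
        (fun n t ht a ha hAa => ?_) hs hst ht
      · rw [toReal_energy (h.energy_ne_top hk ht)]
        refine tendsto_finsetSum _ fun j hj => tendsto_finsetSum _ fun α hα => ?_
        refine (tendsto_wop_dirs (memLp_asym_mul ?_ (h.energy_ne_top hk ht)) hδ).norm.pow 2
        rw [Finset.HasAntidiagonal.mem_antidiagonal.1 hα]
        exact Nat.lt_succ_iff.1 (Finset.mem_range.1 hj)
      · refine HasDerivWithinAt.fun_sum fun j hj => HasDerivWithinAt.fun_sum fun α hα => ?_
        refine hasDerivWithinAt_norm_sq ?_
        exact ((wop (δ n) (diffs (dirs α))).restrictScalars ℝ).hasFDerivAt.comp_hasDerivWithinAt t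
          (hasDerivWithinAt_cplx (hω' t ht))
      · have h1 := sum_abs_re_inner_le (h.velocity t ht) (hL t ht) (hg t ht) (hX t ht) (heq t ht)
          (h.energy_ne_top hk ht) ha hAa (δ n)
        simp only [← Finset.mul_sum]
        have h2 := (Finset.sum_le_sum fun j (_ : j ∈ Finset.range (k + 1)) =>
          Finset.sum_le_sum fun α (_ : α ∈ Finset.HasAntidiagonal.antidiagonal j) =>
            le_abs_self (inner ℂ (wop (δ n) (diffs (dirs α)) (cplx (ω t)))
              (wop (δ n) (diffs (dirs α)) (cplx (ω' t)))).re).trans h1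
        linarith
  have hint : IntegrableOn (fun t => (A t).toReal) (Icc 0 T) :=
    integrable_toReal_of_lintegral_ne_top hAm hfin
  refine (gronwall_integral hT (h.continuousOn_energy hk) (fun _ _ => ENNReal.toReal_nonneg)
    (hint.const_mul (256 * C₀ * 4 ^ k)) (fun r => by positivity) hle).trans (le_of_eq ?_)
  rw [intervalIntegral.integral_const_mul, intervalIntegral.integral_of_le hT,
    ← integral_Icc_eq_integral_Ioc, integral_toReal hAm (ae_lt_top' hAm hfin)]

/-- The `L²` norm is conserved, with no condition on the time integral. This settles zero initial
data when the exponent is infinite. -/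
lemma eq_zero (h : IsSolution β m T ω u) (hm : 1 ≤ m) (hT : 0 ≤ T) (h0 : cplx (ω 0) = 0) :
    cplx (ω T) = 0 := by
  choose! ω' L g hω' hL hg heq using h.equation
  have hderiv : ∀ t ∈ Icc 0 T, HasDerivWithinAt (fun t => ‖cplx (ω t)‖ ^ 2) 0 (Icc 0 T) t :=
    fun t ht => by
      have h1 := hasDerivWithinAt_norm_sq (hasDerivWithinAt_cplx (hω' t ht))
      rwa [re_inner_eq_zero (h.velocity t ht) (hL t ht) (hg t ht) (h.X_one_ne_top hm ht) (heq t ht),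
        mul_zero] at h1
  have h1 := constant_of_has_deriv_right_zero (fun t ht => (hderiv t ht).continuousWithinAt)
    (fun t ht => (hderiv t (Ico_subset_Icc_self ht)).mono_of_mem_nhdsWithin
      (Icc_mem_nhdsGE_of_mem ht)) T ⟨hT, le_rfl⟩
  simpa [h0] using h1

lemma sobolevNorm_le (h : IsSolution β m T ω u) (hm : 1 ≤ m) (hk : k ≤ m) (hT : 0 ≤ T) {c : ℝ≥0}
    (hc : (c : ℝ) = 128 * C₀) : sobolevNorm k (ω T) ≤ sobolevNorm k (ω 0) *
      EReal.exp (((c : ℝ≥0∞) * 2 ^ (2 * k) *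
        ∫⁻ t in Icc 0 T, (jacobianSupNorm (u t) + eLpNorm (ω t) ∞ volume) : ℝ≥0∞) : EReal) := by
  set I := ∫⁻ t in Icc 0 T, (jacobianSupNorm (u t) + eLpNorm (ω t) ∞ volume) with hI
  have hC := one_le_C₀
  by_cases hfin : I = ∞
  · have hc0 : (c : ℝ≥0∞) * 2 ^ (2 * k) ≠ 0 := by
      refine mul_ne_zero ?_ (by positivity)
      rw [ENNReal.coe_ne_zero]
      rintro rfl
      simp at hc
      linarith
    rw [hfin, ENNReal.mul_top hc0, EReal.coe_ennreal_top, EReal.exp_top]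
    -- In `[0,∞]` the product `0 * ∞` is `0`, so vanishing initial data demand a proof that the
    -- solution vanishes; otherwise the right-hand side is `∞`.
    by_cases h0 : sobolevNorm k (ω 0) = 0
    · have h1 : energy k (cplx (ω 0)) = 0 := by
        rw [sobolevNorm_eq] at h0
        exact (ENNReal.rpow_eq_zero_iff_of_pos (by norm_num)).1 h0
      have h2 : cplx (ω 0) = 0 := by
        have h3 := eLpNorm_sq_le_energy (α := (0, 0)) (Nat.zero_le k) (cplx (ω 0))
        rw [h1, nonpos_iff_eq_zero, pow_eq_zero_iff two_ne_zero] at h3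
        simp only [asym, pow_zero, one_mul] at h3
        rw [eLpNorm_ft, ← Lp.enorm_def, enorm_eq_zero] at h3
        exact h3
      rw [h0, zero_mul, sobolevNorm_eq, h.eq_zero hm hT h2, ← h2, ← sobolevNorm_eq, h0]
    · rw [ENNReal.mul_top h0]
      exact le_top
  · have h0 : (0 : ℝ) ∈ Icc 0 T := ⟨le_rfl, hT⟩
    have hT' : T ∈ Icc 0 T := ⟨hT, le_rfl⟩
    have h1 := h.energy_le hm hk hT hfin
    have hexp : ((((c : ℝ≥0∞) * 2 ^ (2 * k) * I : ℝ≥0∞)) : EReal) =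
        ((128 * C₀ * 4 ^ k * I.toReal : ℝ) : EReal) := by
      have hne : (c : ℝ≥0∞) * 2 ^ (2 * k) * I ≠ ∞ :=
        ENNReal.mul_ne_top (ENNReal.mul_ne_top ENNReal.coe_ne_top (by finiteness)) hfin
      rw [← EReal.coe_ennreal_toReal hne, ENNReal.toReal_mul, ENNReal.toReal_mul, ENNReal.coe_toReal,
        hc, pow_mul]
      norm_num
    rw [hexp, EReal.exp_coe, sobolevNorm_eq, sobolevNorm_eq,
      ← ENNReal.ofReal_toReal (h.energy_ne_top hk hT'), ← ENNReal.ofReal_toReal (h.energy_ne_top hk h0),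
      ENNReal.ofReal_rpow_of_nonneg ENNReal.toReal_nonneg (by norm_num),
      ENNReal.ofReal_rpow_of_nonneg ENNReal.toReal_nonneg (by norm_num),
      ← ENNReal.ofReal_mul (by positivity)]
    refine ENNReal.ofReal_le_ofReal ((Real.rpow_le_rpow ENNReal.toReal_nonneg h1 (by norm_num)).trans
      (le_of_eq ?_))
    -- The square root of the energy inequality halves the exponent: `256` becomes `128`.
    rw [Real.mul_rpow ENNReal.toReal_nonneg (Real.exp_pos _).le, ← Real.exp_mul]
    congr 2
    ring

end IsSolution

end BetaPlane

end

/-- Energy inequality: `c₁` is a universal constant. Both sides take values in `[0,∞]`, and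
`EReal.exp` is the exponential with `exp ∞ = ∞`. -/
theorem lemma4p1 :
    ∃ c₁ : ℝ≥0, ∀ (β : ℝ) (m k : ℕ), 1 ≤ m → k ≤ m →
      ∀ (T : ℝ), 0 ≤ T → ∀ (ω : ℝ → BetaPlane.L2) (u : ℝ → Fin 2 → BetaPlane.L2),
        BetaPlane.IsSolution β m T ω u →
          BetaPlane.sobolevNorm k (ω T) ≤
            BetaPlane.sobolevNorm k (ω 0) *
              EReal.exp (((c₁ : ℝ≥0∞) * 2 ^ (2 * k) *
                ∫⁻ t in Icc 0 T,
                  (BetaPlane.jacobianSupNorm (u t) + eLpNorm (ω t) ∞ volume) : ℝ≥0∞) : EReal) := by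
  have hC := BetaPlane.one_le_C₀
  refine ⟨⟨128 * BetaPlane.C₀, by linarith⟩, fun β m k hm hk T hT ω u h => ?_⟩
  exact h.sobolevNorm_le hm hk hT rfl
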